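/- Let $d\ge 1$ and let $\mathbb T^d=\mathbb R^d/\mathbb Z^d$ carry normalised Lebesgue measure $\mu$ and the flat Euclidean quotient distance; $\operatorname{dist}(x,\emptyset)=+\infty$, and $|k|$ is the Euclidean length of $k\in\mathbb Z^d$. All sets $\Omega\subseteq\mathbb T^d$ below are Lebesgue measurable, $\partial\Omega$ is the topological boundary, and $\chi_\Omega$ the characteristic function. For $m=n^d$ with $n\ge1$ an integer, let $$L(m)=\{m^{-1/d}(g_1,\dots,g_d): g_j\in\mathbb Z,\ 0\le g_j\le m^{1/d}-1\}\subset\mathbb T^d .$$ Let $\eta:\mathbb R^d\to\mathbb R$ be a smooth radial function with $\eta(\xi)=0$ for $|\xi|\ge 1/2$ and $\int\eta^2=1$, and put $$K(x)=\int_{\mathbb R^d}(1+|\xi|^2)^{-(d+1)/2}(\eta*\eta)(\xi)e^{2\pi i\xi\cdot x}\,d\xi,$$ $$\psi(t)=4e^{2\pi}\Big(\int_{|y|\le1}K(y)\,dy\Big)^{-1}\int_{|y|\ge t/2}K(y)\,dy\quad(t\ge0),\qquad \psi(+\infty)=0 .$$ For $0\le\alpha\le (d+1)/2$ and $0\le\beta\le1$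 let $F(\alpha,\beta,\Omega)\in[0,\infty]$ be the smallest constant $C$ such that $$\Big|\int_{\mathbb T^d}\chi_\Omega(x)e^{-2\pi ik\cdot x}dx\Big|\le C|k|^{-\alpha}\quad\text{for every }k\in\mathbb Z^d\setminus\{0\}$$ and, for every real $R>0$, $$\Big|\int_{\mathbb T^d}\psi\big(R\operatorname{dist}(x,\partial\Omega)\big)e^{-2\pi ik\cdot x}dx\Big|\le\begin{cases}C|k|^{-\alpha}&\text{if }0<|k|<R,\\ CR^{-\beta}&\text{if }k=0.\end{cases}$$ 1. For every such $\eta$ and every $0\le\alpha\le(d+1)/2$ there is a finite constant $c$, depending only on $d$, $\eta$ and, if $d=1$, on $\alpha$ (for $d\ge2$ one constant serves all $\alpha$), such that for every $0\le\beta\le1$ with $d+\beta-\alpha>0$, every $m=n^d$ ($n\ge1$) and every measurable $\Omega\subseteq\mathbb T^d$, $$\Big|\mu(\Omega)-m^{-1}\sum_{x\in L(m)}\chi_\Omega(x)\Big|\le c\,F(\alpha,\beta,\Omega)\,m^{-\beta/(d+\beta-\alpha)} .$$ 2. For $0\le\alpha\le1$ let $M(\alpha,\Omega)=\sup_{t>0}t^{-\alpha}\mu(\{x:\operatorname{dist}(x,\partial\Omega)<t\})\in[0,\infty]$.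 There is a constant $c$ depending only on $d$ such that for every $0\le\alpha\le1$, every $m=n^d$ ($n\ge1$) and every real $\gamma$, $$\sup_{M(\alpha,\Omega)<\gamma}\Big|\mu(\Omega)-m^{-1}\sum_{x\in L(m)}\chi_\Omega(x)\Big|\le c\,\gamma\,m^{-\alpha/d}.$$ Here, if no measurable $\Omega$ satisfies $M(\alpha,\Omega)<\gamma$, nothing is asserted. -/

import Mathlib

open MeasureTheory Set
open scoped ENNReal NNReal FourierTransform ContDiff

noncomputable section

namespace TorusDiscrepancy

/-- Normalised Lebesgue measure on the torus `𝕋^d = ℝ^d / ℤ^d`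
(the measure with respect to which Mathlib's `UnitAddTorus.mFourierCoeff` is defined). -/
def vol (d : ℕ) : Measure (UnitAddTorus (Fin d)) :=
  Measure.pi fun _ => AddCircle.haarAddCircle

/-- Flat (Euclidean quotient) distance from a point of the torus to the topological boundary of `Ω`.
It is the infimum over `y ∈ ∂Ω` of `(∑ i, ‖x i - y i‖ ^ 2) ^ (1/2)`, where `‖·‖` on `ℝ/ℤ` is the
distance to the nearest integer; it equals `∞` when `∂Ω` is empty. -/
def distBdry {d : ℕ} (Ω : Set (UnitAddTorus (Fin d))) (x : UnitAddTorus (Fin d)) : ℝ≥0∞ :=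
  Metric.infEDist (WithLp.toLp 2 x : PiLp 2 fun _ : Fin d => UnitAddCircle)
    (WithLp.toLp 2 '' frontier Ω)

/-- Euclidean length of a frequency `k ∈ ℤ^d`. -/
def freqNorm {d : ℕ} (k : Fin d → ℤ) : ℝ := Real.sqrt (∑ i, (k i : ℝ) ^ 2)

/-- A smooth radial real function on `ℝ^d`, vanishing for `|ξ| ≥ 1/2`, with `∫ η² = 1`. -/
structure IsProfile {d : ℕ} (η : EuclideanSpace ℝ (Fin d) → ℝ) : Prop where
  smooth : ContDiff ℝ ∞ η
  radial : ∀ ξ ζ, ‖ξ‖ = ‖ζ‖ → η ξ = η ζ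
  support : ∀ ξ, 1 / 2 ≤ ‖ξ‖ → η ξ = 0
  norm_one : ∫ ξ, η ξ ^ 2 = 1

/-- `(1 + |ξ|²)^{-(d+1)/2} (η ∗ η)(ξ)`, the Fourier transform of the kernel. -/
def kernelHat {d : ℕ} (η : EuclideanSpace ℝ (Fin d) → ℝ) (ξ : EuclideanSpace ℝ (Fin d)) : ℝ :=
  (1 + ‖ξ‖ ^ 2) ^ (-((d : ℝ) + 1) / 2) * ∫ ζ, η ζ * η (ξ - ζ)

/-- The kernel `K(x) = ∫ (1 + |ξ|²)^{-(d+1)/2} (η ∗ η)(ξ) exp(2πi ξ·x) dξ`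
(the integral is real because `η` is radial). -/
def kernel {d : ℕ} (η : EuclideanSpace ℝ (Fin d) → ℝ) (x : EuclideanSpace ℝ (Fin d)) : ℝ :=
  (𝓕⁻ (fun ξ => (kernelHat η ξ : ℂ)) x).re

/-- `I(t) = ∫_{|x| ≥ t} K(x) dx`. -/
def tail {d : ℕ} (η : EuclideanSpace ℝ (Fin d) → ℝ) (t : ℝ) : ℝ :=
  ∫ x in {x | t ≤ ‖x‖}, kernel η x

/-- `ψ(t) = 4 γ I(t/2)`, where `γ⁻¹ = exp(-2π) ∫_{|y| ≤ 1} K(y) dy`. -/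
def psi {d : ℕ} (η : EuclideanSpace ℝ (Fin d) → ℝ) (t : ℝ) : ℝ :=
  4 * (Real.exp (-(2 * Real.pi)) * ∫ y in {y | ‖y‖ ≤ 1}, kernel η y)⁻¹ * tail η (t / 2)

/-- The function `x ↦ ψ(R dist(x, ∂Ω))` on the torus; since `ψ` vanishes at infinity, it is `0`
where the distance is infinite, that is, when `∂Ω` is empty. -/
def psiDist {d : ℕ} (η : EuclideanSpace ℝ (Fin d) → ℝ) (Ω : Set (UnitAddTorus (Fin d)))
    (R : ℝ) (x : UnitAddTorus (Fin d)) : ℝ :=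
  open Classical in
  if distBdry Ω x = ⊤ then 0 else psi η (R * (distBdry Ω x).toReal)

/-- The constant `C` bounds the Fourier decay of `χ_Ω` and of `ψ(R dist(x, ∂Ω))` for all `R > 0`. -/
def FourierDecayBound {d : ℕ} (η : EuclideanSpace ℝ (Fin d) → ℝ) (α β : ℝ)
    (Ω : Set (UnitAddTorus (Fin d))) (C : ℝ≥0∞) : Prop :=
  (∀ k : Fin d → ℤ, k ≠ 0 →
    ‖UnitAddTorus.mFourierCoeff (Ω.indicator fun _ => (1 : ℂ)) k‖ₑ
      ≤ C * ENNReal.ofReal (freqNorm k ^ (-α))) ∧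
  ∀ R : ℝ, 0 < R →
    (∀ k : Fin d → ℤ, k ≠ 0 → freqNorm k < R →
      ‖UnitAddTorus.mFourierCoeff (fun x => (psiDist η Ω R x : ℂ)) k‖ₑ
        ≤ C * ENNReal.ofReal (freqNorm k ^ (-α))) ∧
    ‖UnitAddTorus.mFourierCoeff (fun x => (psiDist η Ω R x : ℂ)) 0‖ₑ
      ≤ C * ENNReal.ofReal (R ^ (-β))

/-- `F(α, β, Ω)`: the smallest constant in the Fourier decay bounds (`∞` if there is none). -/
def decayConst {d : ℕ} (η : EuclideanSpace ℝ (Fin d) → ℝ) (α β : ℝ)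
    (Ω : Set (UnitAddTorus (Fin d))) : ℝ≥0∞ :=
  sInf {C : ℝ≥0∞ | FourierDecayBound η α β Ω C}

/-- `M(α, Ω) = sup_{t > 0} t^{-α} μ {x : dist(x, ∂Ω) < t}`. -/
def minkowskiConst {d : ℕ} (α : ℝ) (Ω : Set (UnitAddTorus (Fin d))) : ℝ≥0∞ :=
  ⨆ (t : ℝ) (_ : 0 < t), ENNReal.ofReal (t ^ (-α)) * vol d {x | distBdry Ω x < ENNReal.ofReal t}

/-- The point `n⁻¹ (g₁, …, g_d)` of the torus, `0 ≤ g_j ≤ n - 1`; for `m = n ^ d` these are the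
points of the lattice `L(m) = m^{-1/d} ℤ^d`. -/
def latticePoint {d n : ℕ} (g : Fin d → Fin n) : UnitAddTorus (Fin d) :=
  fun i => (((g i : ℕ) : ℝ) / (n : ℝ) : ℝ)

/-- `|μ(Ω) - m⁻¹ ∑_{x ∈ L(m)} χ_Ω(x)|` for `m = n ^ d`. -/
def latticeDiscrepancy (d n : ℕ) (Ω : Set (UnitAddTorus (Fin d))) : ℝ :=
  |(vol d).real Ω
    - ((n ^ d : ℕ) : ℝ)⁻¹ * ∑ g : Fin d → Fin n, Ω.indicator (fun _ => (1 : ℝ)) (latticePoint g)|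

end TorusDiscrepancy

end

/-! Part 1 smooths χ_Ω with K_R(x) = R^d K(Rx) and controls the error by a function that is itself
smoothed. The transform of K is a product of the Poisson weight, whose inverse transform is a
multiple of exp(-2π|x|), and of η∗η, whose inverse transform is a square. Hence K is a positive
superposition of translates of exp(-2π|x|) (`IsProfile.exists_kernel_eq`): it is a positive density
of mass 1, its transform vanishes outside the unit ball, and translation by p changes it by a factor
of at most exp(2π|p|).

Write I for `tail η` and H for `psiDist η Ω R`. Where the boundary is nonempty, the smoothing error
at x is at most I(R dist(x, ∂Ω)), since only displacements reaching ∂Ω contribute; without boundary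
there is no error. The constant in ψ is chosen so that this is at most (K_R ∗ H)(x)
(`IsProfile.tail_le_smoothing`). Both K_R ∗ χ_Ω and K_R ∗ H are trigonometric polynomials of degree
less than R, and averaging over the lattice kills every frequency outside nℤ^d. The discrepancy is
therefore at most the mean of H plus the coefficients of χ_Ω and H at nonzero frequencies of nℤ^d
below R (`IsProfile.latticeDiscrepancy_le_sum`). Decay makes this O(C(R^{-β} + R^{d-α}/m)), and R =
m^{1/(d+β-α)} balances the two terms. For β = 0 the trivial bound 1 is used instead, because a
nonempty boundary forces C to be bounded below.

The frequency sum gives a logarithm only for d = α = 1. There the boundary is shown to be finite: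
near each point followed by a gap, K_R ∗ H drops by a fixed amount over a distance of order 1/R,
while Parseval limits its L² variation under such a shift (`IsProfile.exists_card_gapPoints_le`). A
frequency k at which all characters on the boundary are nearly 1 then shows that the number of
boundary points is O(C) (`IsProfile.card_frontier_le`), and each of them costs O(1/n) in the
discrepancy.

Part 2 needs no Fourier analysis. Moving the lattice by at most its mesh changes the count only
through points near ∂Ω; averaging over all translates gives `latticeDiscrepancy_le_vol`. -/

namespace TorusDiscrepancy

/-! ### Fourier transform of the Poisson weight -/

section PoissonKernel

variable {V : Type*} [NormedAddCommGroup V] [InnerProductSpace ℝ V] [FiniteDimensional ℝ V]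
  [MeasurableSpace V] [BorelSpace V]

theorem integrable_poisson_weight :
    Integrable (fun ξ : V => (1 + ‖ξ‖ ^ 2) ^ (-((Module.finrank ℝ V : ℝ) + 1) / 2)) := by
  exact integrable_rpow_neg_one_add_norm_sq (by linarith)

/-- Subordination: the inverse Fourier transform of the Poisson weight as a Gaussian mixture. -/
theorem integral_poisson_weight_eq_subordination (x : V) :
    ∫ ξ : V, Complex.exp (2 * Real.pi * Complex.I * inner ℝ x ξ) *
        (((1 + ‖ξ‖ ^ 2) ^ (-((Module.finrank ℝ V : ℝ) + 1) / 2) : ℝ) : ℂ) =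
      ((Real.pi ^ ((Module.finrank ℝ V : ℝ) / 2) / Real.Gamma (((Module.finrank ℝ V : ℝ) + 1) / 2) *
        ∫ t in Ioi (0 : ℝ), t ^ (-(1 / 2) : ℝ) *
          Real.exp (-t - Real.pi ^ 2 * ‖x‖ ^ 2 / t) : ℝ) : ℂ) := by
  set n : ℝ := (Module.finrank ℝ V : ℝ) with hn
  have hn0 : 0 ≤ n := by positivity
  set s : ℝ := (n + 1) / 2 with hs
  have hs0 : 0 < s := by positivity
  have hG : 0 < Real.Gamma s := Real.Gamma_pos_of_pos hs0
  have hGc : (Real.Gamma s : ℂ) ≠ 0 := by exact_mod_cast hG.ne'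
  have key : ∀ ξ : V, ∫ t in Ioi (0 : ℝ), t ^ (s - 1) * Real.exp (-((1 + ‖ξ‖ ^ 2) * t)) =
      Real.Gamma s * (1 + ‖ξ‖ ^ 2) ^ (-(n + 1) / 2) := by
    intro ξ
    rw [Real.integral_rpow_mul_exp_neg_mul_Ioi hs0 (by positivity), one_div,
      Real.inv_rpow (by positivity), ← Real.rpow_neg (by positivity), mul_comm, hs]
    congr 2; ring
  let F : V → ℝ → ℂ := fun ξ t => Complex.exp (2 * Real.pi * Complex.I * inner ℝ x ξ) *
    ((t ^ (s - 1) * Real.exp (-((1 + ‖ξ‖ ^ 2) * t)) : ℝ) : ℂ)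
  have hphase : ∀ ξ : V, ‖Complex.exp (2 * Real.pi * Complex.I * inner ℝ x ξ)‖ = 1 := by
    intro ξ
    have := Complex.norm_exp_ofReal_mul_I (2 * Real.pi * inner ℝ x ξ)
    rw [← this]; congr 2; push_cast; ring
  have hFnorm : ∀ ξ : V, ∀ t ∈ Ioi (0 : ℝ), ‖F ξ t‖ =
      t ^ (s - 1) * Real.exp (-((1 + ‖ξ‖ ^ 2) * t)) := by
    intro ξ t ht
    have : (0 : ℝ) < t := ht
    simp only [F]
    rw [norm_mul, hphase, one_mul, Complex.norm_real, Real.norm_eq_abs, abs_of_nonneg (by positivity)]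
  have hF1 : ∀ ξ, ∫ t in Ioi (0 : ℝ), F ξ t =
      Complex.exp (2 * Real.pi * Complex.I * inner ℝ x ξ) *
        ((Real.Gamma s * (1 + ‖ξ‖ ^ 2) ^ (-(n + 1) / 2) : ℝ) : ℂ) := by
    intro ξ
    simp only [F]
    rw [integral_const_mul, integral_complex_ofReal, key]
  have hF2 : ∀ t ∈ Ioi (0 : ℝ), ∫ ξ : V, F ξ t =
      ((Real.pi ^ (n / 2) *
        (t ^ (-(1 / 2) : ℝ) * Real.exp (-t - Real.pi ^ 2 * ‖x‖ ^ 2 / t)) : ℝ) : ℂ) := by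
    intro t ht
    have ht0 : (0 : ℝ) < t := ht
    have h1 : ∀ ξ : V, F ξ t = ((t ^ (s - 1) * Real.exp (-t) : ℝ) : ℂ) *
        Complex.exp (-(t : ℂ) * ‖ξ‖ ^ 2 + (2 * Real.pi * Complex.I) * inner ℝ x ξ) := by
      intro ξ
      simp only [F]
      rw [Complex.exp_add]
      have : Real.exp (-((1 + ‖ξ‖ ^ 2) * t)) = Real.exp (-t) * Real.exp (-t * ‖ξ‖ ^ 2) := by
        rw [← Real.exp_add]; congr 1; ring
      rw [this]
      push_cast
      ring
    simp_rw [h1]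
    rw [integral_const_mul, GaussianFourier.integral_cexp_neg_mul_sq_norm_add (by simpa using ht0)]
    have h2 : ((Real.pi : ℂ) / t) ^ (Module.finrank ℝ V / 2 : ℂ) = (((Real.pi / t) ^ (n / 2) : ℝ) : ℂ) := by
      rw [Complex.ofReal_cpow (by positivity)]; simp [hn]
    have h3 : (2 * Real.pi * Complex.I) ^ 2 * (‖x‖ : ℂ) ^ 2 / (4 * t) =
        ((-(Real.pi ^ 2 * ‖x‖ ^ 2 / t) : ℝ) : ℂ) := by
      have : (t : ℂ) ≠ 0 := by exact_mod_cast ht0.ne'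
      push_cast
      rw [mul_pow, mul_pow, Complex.I_sq]
      field_simp
      ring
    rw [h2, h3, ← Complex.ofReal_exp, ← Complex.ofReal_mul, ← Complex.ofReal_mul]
    congr 1
    have h5 : t ^ (-(1 / 2) : ℝ) = t ^ (s - 1) / t ^ (n / 2) := by
      rw [← Real.rpow_sub ht0, hs]; congr 1; ring
    rw [sub_eq_add_neg (-t), Real.exp_add, Real.div_rpow (by positivity) ht0.le, h5]
    ring
  have hmeas : AEStronglyMeasurable (Function.uncurry F)
      ((volume : Measure V).prod (volume.restrict (Ioi (0 : ℝ)))) := by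
    apply Measurable.aestronglyMeasurable
    simp only [F]
    fun_prop
  have hint : Integrable (Function.uncurry F)
      ((volume : Measure V).prod (volume.restrict (Ioi (0 : ℝ)))) := by
    rw [integrable_prod_iff hmeas]
    constructor
    · refine Filter.Eventually.of_forall fun ξ => ?_
      have h0 : IntegrableOn (fun t : ℝ => t ^ (s - 1) * Real.exp (-((1 + ‖ξ‖ ^ 2) * t))) (Ioi 0) := by
        -- The integral of a non-integrable function is 0 by convention, so the nonzero value from
        -- `key` proves integrability.
        apply Integrable.of_integral_ne_zero
        rw [key]
        positivity
      refine (h0.ofReal (𝕜 := ℂ)).bdd_mul (c := 1)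
        (f := fun _ => Complex.exp (2 * Real.pi * Complex.I * inner ℝ x ξ)) ?_ ?_
      · exact aestronglyMeasurable_const
      · exact Filter.Eventually.of_forall fun t => (hphase ξ).le
    · have : ∀ ξ : V, ∫ t in Ioi (0 : ℝ), ‖Function.uncurry F (ξ, t)‖ =
          Real.Gamma s * (1 + ‖ξ‖ ^ 2) ^ (-(n + 1) / 2) := by
        intro ξ
        rw [← key]
        exact setIntegral_congr_fun measurableSet_Ioi fun t ht => hFnorm ξ t ht
      simp_rw [this]
      exact (integrable_poisson_weight (V := V)).const_mul _
  have swap := integral_integral_swap hint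
  simp_rw [hF1] at swap
  rw [setIntegral_congr_fun measurableSet_Ioi hF2, integral_complex_ofReal,
    integral_const_mul] at swap
  have h4 : ∀ ξ : V, Complex.exp (2 * Real.pi * Complex.I * inner ℝ x ξ) *
      ((Real.Gamma s * (1 + ‖ξ‖ ^ 2) ^ (-(n + 1) / 2) : ℝ) : ℂ) = (Real.Gamma s : ℂ) *
      (Complex.exp (2 * Real.pi * Complex.I * inner ℝ x ξ) *
        (((1 + ‖ξ‖ ^ 2) ^ (-(n + 1) / 2) : ℝ) : ℂ)) := by
    intro ξ; push_cast; ring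
  simp_rw [h4] at swap
  rw [integral_const_mul] at swap
  rw [eq_comm, div_mul_eq_mul_div, Complex.ofReal_div, div_eq_iff hGc, mul_comm (integral _ _), swap]

theorem fourier_exp_neg_abs (ξ : ℝ) :
    𝓕 (fun x : ℝ => (Real.exp (-(2 * Real.pi * |x|)) : ℂ)) ξ =
      ((1 / Real.pi * (1 + ‖ξ‖ ^ 2)⁻¹ : ℝ) : ℂ) := by
  rw [Real.fourier_real_eq_integral_exp_smul]
  have hpi := Real.pi_pos
  have hre1 : 0 < (2 * Real.pi * (1 + ξ * Complex.I) : ℂ).re := by simp [hpi]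
  have hre2 : 0 < (2 * Real.pi * (1 - ξ * Complex.I) : ℂ).re := by simp [hpi]
  have h1 : ∀ x ∈ Ioi (0 : ℝ), Complex.exp (↑(-2 * Real.pi * x * ξ) * Complex.I) •
      (Real.exp (-(2 * Real.pi * |x|)) : ℂ) =
      Complex.exp (-(2 * Real.pi * (1 + ξ * Complex.I)) * x) := by
    intro x hx
    rw [abs_of_pos hx, smul_eq_mul, Complex.ofReal_exp, ← Complex.exp_add]
    congr 1; push_cast; ring
  have h2 : ∀ x ∈ Iic (0 : ℝ), Complex.exp (↑(-2 * Real.pi * x * ξ) * Complex.I) •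
      (Real.exp (-(2 * Real.pi * |x|)) : ℂ) =
      Complex.exp ((2 * Real.pi * (1 - ξ * Complex.I)) * x) := by
    intro x hx
    rw [abs_of_nonpos hx, smul_eq_mul, Complex.ofReal_exp, ← Complex.exp_add]
    congr 1; push_cast; ring
  have i1 : IntegrableOn (fun x : ℝ => Complex.exp (↑(-2 * Real.pi * x * ξ) * Complex.I) •
      (Real.exp (-(2 * Real.pi * |x|)) : ℂ)) (Ioi 0) :=
    (integrableOn_exp_mul_complex_Ioi (by simpa using hre1) 0).congr_fun
      (fun x hx => (h1 x hx).symm) measurableSet_Ioi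
  have i2 : IntegrableOn (fun x : ℝ => Complex.exp (↑(-2 * Real.pi * x * ξ) * Complex.I) •
      (Real.exp (-(2 * Real.pi * |x|)) : ℂ)) (Iic 0) :=
    (integrableOn_exp_mul_complex_Iic hre2 0).congr_fun
      (fun x hx => (h2 x hx).symm) measurableSet_Iic
  rw [← intervalIntegral.integral_Iic_add_Ioi i2 i1, setIntegral_congr_fun measurableSet_Ioi h1,
    setIntegral_congr_fun measurableSet_Iic h2, integral_exp_mul_complex_Iic hre2,
    integral_exp_mul_complex_Ioi (by simpa using hre1)]
  simp only [Complex.ofReal_zero, mul_zero, Complex.exp_zero]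
  have hp : (Real.pi : ℂ) ≠ 0 := by exact_mod_cast hpi.ne'
  have ha : (1 + ξ * Complex.I : ℂ) ≠ 0 := by intro h; simpa using congrArg Complex.re h
  have hb : (1 - ξ * Complex.I : ℂ) ≠ 0 := by intro h; simpa using congrArg Complex.re h
  have hab : ((1 : ℂ) + (‖ξ‖ : ℂ) ^ 2) = (1 + ξ * Complex.I) * (1 - ξ * Complex.I) := by
    have : ((‖ξ‖ : ℂ)) ^ 2 = (ξ : ℂ) ^ 2 := by
      rw [← Complex.ofReal_pow, Real.norm_eq_abs, sq_abs, Complex.ofReal_pow]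
    rw [this]; ring_nf; rw [Complex.I_sq]; ring
  push_cast
  rw [hab]
  field_simp
  ring

/-- No dimension enters the integral, so its value can be read off on the line, where Fourier
inversion of `fourier_exp_neg_abs` gives the inverse transform of (1 + ξ²)^{-1}. -/
theorem integral_subordination (b : ℝ) (hb : 0 ≤ b) :
    ∫ t in Ioi (0 : ℝ), t ^ (-(1 / 2) : ℝ) * Real.exp (-t - Real.pi ^ 2 * b ^ 2 / t) =
      Real.sqrt Real.pi * Real.exp (-(2 * Real.pi * b)) := by
  have hpi := Real.pi_pos
  have h1 := integral_poisson_weight_eq_subordination (V := ℝ) b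
  simp only [Module.finrank_self, Nat.cast_one] at h1
  set f : ℝ → ℂ := fun x : ℝ => (Real.exp (-(2 * Real.pi * |x|)) : ℂ) with hf
  have hfi : Integrable f := by
    apply Integrable.of_integral_ne_zero
    have := fourier_exp_neg_abs 0
    rw [Real.fourier_real_eq_integral_exp_smul] at this
    simp only [mul_zero, Complex.ofReal_zero, zero_mul, Complex.exp_zero, one_smul] at this
    rw [hf, this]
    simp [hpi.ne']
  have hFf : 𝓕 f = fun ξ : ℝ => ((1 / Real.pi * (1 + ‖ξ‖ ^ 2)⁻¹ : ℝ) : ℂ) :=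
    funext fourier_exp_neg_abs
  have hFi : Integrable (𝓕 f) := by
    rw [hFf]
    simp only [Real.norm_eq_abs, sq_abs]
    exact (integrable_inv_one_add_sq.const_mul _).ofReal
  have hinv := congrFun (Continuous.fourierInv_fourier_eq (by rw [hf]; fun_prop) hfi hFi) b
  rw [hFf, Real.fourierInv_eq'] at hinv
  have h2 : ∀ v : ℝ, Complex.exp (↑(2 * Real.pi * inner ℝ v b) * Complex.I) •
      ((1 / Real.pi * (1 + ‖v‖ ^ 2)⁻¹ : ℝ) : ℂ) = ((1 / Real.pi : ℝ) : ℂ) *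
      (Complex.exp (2 * Real.pi * Complex.I * (↑v * ↑b)) * (((1 + v ^ 2)⁻¹ : ℝ) : ℂ)) := by
    intro v
    simp only [Real.norm_eq_abs, sq_abs, smul_eq_mul]
    rw [show (inner ℝ v b : ℝ) = v * b by simp [mul_comm],
      show ((2 * Real.pi * (v * b) : ℝ) : ℂ) * Complex.I = 2 * Real.pi * Complex.I * (↑v * ↑b) by
        push_cast; ring]
    push_cast
    ring
  simp_rw [h2] at hinv
  rw [integral_const_mul] at hinv
  have h3 : ∀ v : ℝ, Complex.exp (2 * Real.pi * Complex.I * inner ℝ b v) *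
      (((1 + ‖v‖ ^ 2) ^ (-((1 : ℝ) + 1) / 2) : ℝ) : ℂ) =
      Complex.exp (2 * Real.pi * Complex.I * (↑v * ↑b)) * (((1 + v ^ 2)⁻¹ : ℝ) : ℂ) := by
    intro v
    rw [show (-((1 : ℝ) + 1) / 2) = -1 by norm_num, Real.rpow_neg_one, Real.norm_eq_abs, sq_abs]
    simp [mul_comm]
  simp_rw [h3] at h1
  rw [h1, ← Complex.ofReal_mul] at hinv
  have h4 := Complex.ofReal_injective hinv
  rw [show ((1 : ℝ) + 1) / 2 = 1 by norm_num, Real.Gamma_one, div_one, ← Real.sqrt_eq_rpow,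
    abs_of_nonneg hb, Real.norm_eq_abs, sq_abs] at h4
  rw [← h4]
  have : Real.sqrt Real.pi * Real.sqrt Real.pi = Real.pi := Real.mul_self_sqrt hpi.le
  have hs : Real.sqrt Real.pi ≠ 0 := by positivity
  generalize (∫ t in Ioi (0 : ℝ), t ^ (-(1 / 2) : ℝ) *
    Real.exp (-t - Real.pi ^ 2 * b ^ 2 / t)) = J
  rw [show √Real.pi * (1 / Real.pi * (√Real.pi * J)) = (√Real.pi * √Real.pi) / Real.pi * J by ring,
    this, div_self hpi.ne', one_mul]

/-- The inverse Fourier transform of `(1 + |ξ|²)^{-(n+1)/2}` is a multiple of `exp (-2π |x|)`. -/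
theorem integral_poisson_weight (x : V) :
    ∫ ξ : V, Complex.exp (2 * Real.pi * Complex.I * inner ℝ x ξ) *
        (((1 + ‖ξ‖ ^ 2) ^ (-((Module.finrank ℝ V : ℝ) + 1) / 2) : ℝ) : ℂ) =
      ((Real.pi ^ ((Module.finrank ℝ V : ℝ) / 2) / Real.Gamma (((Module.finrank ℝ V : ℝ) + 1) / 2) *
        (Real.sqrt Real.pi * Real.exp (-(2 * Real.pi * ‖x‖))) : ℝ) : ℂ) := by
  rw [integral_poisson_weight_eq_subordination, integral_subordination _ (norm_nonneg x)]

end PoissonKernel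

/-! ### The kernel as a superposition of exponentials -/

section Kernel

variable {d : ℕ} {η : EuclideanSpace ℝ (Fin d) → ℝ}

theorem IsProfile.even (h : IsProfile η) (ξ : EuclideanSpace ℝ (Fin d)) : η (-ξ) = η ξ :=
  h.radial _ _ (norm_neg ξ)

theorem IsProfile.hasCompactSupport (h : IsProfile η) : HasCompactSupport η := by
  refine HasCompactSupport.of_support_subset_isCompact
    (isCompact_closedBall (0 : EuclideanSpace ℝ (Fin d)) (1 / 2)) fun x hx => ?_
  rw [mem_closedBall_zero_iff]
  by_contra hlt
  exact hx (h.support x (not_le.1 hlt).le)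

theorem IsProfile.integrable (h : IsProfile η) : Integrable η :=
  h.smooth.continuous.integrable_of_hasCompactSupport h.hasCompactSupport

/-- The self-convolution `η ∗ η`. -/
noncomputable def selfConv (η : EuclideanSpace ℝ (Fin d) → ℝ) (ξ : EuclideanSpace ℝ (Fin d)) : ℝ :=
  ∫ ζ, η ζ * η (ξ - ζ)

theorem IsProfile.selfConv_smooth (h : IsProfile η) : ContDiff ℝ ∞ (selfConv η) :=
  h.hasCompactSupport.contDiff_convolution_right (n := ⊤) (ContinuousLinearMap.mul ℝ ℝ)
    h.integrable.locallyIntegrable h.smooth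

theorem IsProfile.selfConv_eq_zero (h : IsProfile η) {ξ : EuclideanSpace ℝ (Fin d)}
    (hξ : 1 ≤ ‖ξ‖) : selfConv η ξ = 0 := by
  have : ∀ ζ, η ζ * η (ξ - ζ) = 0 := by
    intro ζ
    rcases le_or_gt (1 / 2) ‖ζ‖ with h1 | h1
    · rw [h.support _ h1, zero_mul]
    · rw [h.support (ξ - ζ), mul_zero]
      have := norm_sub_norm_le ξ ζ
      linarith
  simp [selfConv, this]

theorem IsProfile.selfConv_zero (h : IsProfile η) : selfConv η 0 = 1 := by
  rw [← h.norm_one]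
  simp only [selfConv, zero_sub, h.even, sq]

theorem IsProfile.kernelHat_smooth (h : IsProfile η) : ContDiff ℝ ∞ (kernelHat η) := by
  refine ContDiff.mul ?_ h.selfConv_smooth
  exact (contDiff_const.add (contDiff_norm_sq ℝ)).rpow_const_of_ne
    fun x => by positivity

theorem IsProfile.kernelHat_eq_zero (h : IsProfile η) {ξ : EuclideanSpace ℝ (Fin d)}
    (hξ : 1 ≤ ‖ξ‖) : kernelHat η ξ = 0 := by
  have := h.selfConv_eq_zero hξ
  rw [selfConv] at this
  rw [kernelHat, this, mul_zero]

theorem IsProfile.kernelHat_zero (h : IsProfile η) : kernelHat η 0 = 1 := by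
  have := h.selfConv_zero
  rw [selfConv] at this
  rw [kernelHat, this]
  simp

/-- The complexified transform of the kernel as a Schwartz function. -/
noncomputable def IsProfile.kernelHatSchwartz (h : IsProfile η) : SchwartzMap (EuclideanSpace ℝ (Fin d)) ℂ :=
  HasCompactSupport.toSchwartzMap (f := fun ξ => (kernelHat η ξ : ℂ))
    (HasCompactSupport.of_support_subset_isCompact
      (isCompact_closedBall (0 : EuclideanSpace ℝ (Fin d)) 1) fun x hx => by
        rw [mem_closedBall_zero_iff]
        by_contra hlt
        exact hx (by simp [h.kernelHat_eq_zero (not_le.1 hlt).le]))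
    (Complex.ofRealCLM.contDiff.comp h.kernelHat_smooth)

/-- Evenness of η makes its transform real, so that the transform of η ∗ η, being its square, is
nonnegative. -/
theorem IsProfile.fourier_im (h : IsProfile η) (y : EuclideanSpace ℝ (Fin d)) :
    ((𝓕 (fun ξ => (η ξ : ℂ)) y).re : ℂ) = 𝓕 (fun ξ => (η ξ : ℂ)) y := by
  rw [← Complex.conj_eq_iff_re, Real.fourier_eq', ← integral_conj]
  conv_rhs => rw [← integral_neg_eq_self]
  congr 1
  ext v
  simp only [smul_eq_mul, map_mul, Complex.conj_ofReal, h.even, ← Complex.exp_conj, Complex.conj_I,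
    inner_neg_left]
  congr 2
  push_cast
  ring

/-- The kernel is a positive superposition of translates of `exp (-2π |x|)`. -/
theorem IsProfile.exists_kernel_eq (h : IsProfile η) :
    ∃ (c : ℝ) (g : EuclideanSpace ℝ (Fin d) → ℝ), 0 < c ∧ (∀ y, 0 ≤ g y) ∧ Integrable g ∧
      ∀ x, 𝓕⁻ (fun ξ => (kernelHat η ξ : ℂ)) x =
        ((c * ∫ y, g y * Real.exp (-(2 * Real.pi * ‖x + y‖)) : ℝ) : ℂ) := by
  set ηc : SchwartzMap (EuclideanSpace ℝ (Fin d)) ℂ :=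
    HasCompactSupport.toSchwartzMap (f := fun ξ => (η ξ : ℂ))
      (h.hasCompactSupport.comp_left Complex.ofReal_zero)
      (Complex.ofRealCLM.contDiff.comp h.smooth) with hηc
  have hηc_coe : (ηc : EuclideanSpace ℝ (Fin d) → ℂ) = fun ξ => (η ξ : ℂ) := rfl
  set θ : EuclideanSpace ℝ (Fin d) → ℝ := fun y => (𝓕 (fun ξ => (η ξ : ℂ)) y).re with hθ
  have hθc : ∀ y, (θ y : ℂ) = 𝓕 (fun ξ => (η ξ : ℂ)) y := h.fourier_im
  have hsq : Integrable (fun y => ((θ y ^ 2 : ℝ) : ℂ)) := by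
    have h1 := ((𝓕 ηc : SchwartzMap (EuclideanSpace ℝ (Fin d)) ℂ).memLp 2
      volume).integrable_norm_pow two_ne_zero
    have h2 : ∀ y, (𝓕 ηc : SchwartzMap (EuclideanSpace ℝ (Fin d)) ℂ) y = (θ y : ℂ) := by
      intro y
      rw [hθc, SchwartzMap.fourier_coe]; rfl
    have h3 : Integrable (fun y => θ y ^ 2) := by
      refine h1.congr (Filter.Eventually.of_forall fun y => ?_)
      simp only [h2, Complex.norm_real, Real.norm_eq_abs, sq_abs]
    exact h3.ofReal
  have hfin : (Module.finrank ℝ (EuclideanSpace ℝ (Fin d)) : ℝ) = d := by simp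
  have hCF : 𝓕 (fun ξ => (selfConv η ξ : ℂ)) = fun y => ((θ y ^ 2 : ℝ) : ℂ) := by
    ext y
    have hconv : (fun ξ => (selfConv η ξ : ℂ)) = convolution (fun ξ => (η ξ : ℂ))
        (fun ξ => (η ξ : ℂ)) (ContinuousLinearMap.mul ℂ ℂ) volume := by
      funext ξ
      simp only [selfConv, convolution, ContinuousLinearMap.mul_apply']
      rw [← integral_complex_ofReal]
      simp
    have := Real.fourier_mul_convolution_eq (R := ℂ) ηc.integrable ηc.integrable y
    rw [hηc_coe, ← hθc] at this
    push_cast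
    rw [sq, ← this, hconv]
  have hCi : Integrable (fun ξ => (selfConv η ξ : ℂ)) := by
    refine Integrable.ofReal (h.selfConv_smooth.continuous.integrable_of_hasCompactSupport ?_)
    refine HasCompactSupport.of_support_subset_isCompact
      (isCompact_closedBall (0 : EuclideanSpace ℝ (Fin d)) 1) fun x hx => ?_
    rw [mem_closedBall_zero_iff]
    by_contra hlt
    exact hx (h.selfConv_eq_zero (not_le.1 hlt).le)
  have hinv := Continuous.fourierInv_fourier_eq
    (Complex.continuous_ofReal.comp h.selfConv_smooth.continuous) hCi (by
      change Integrable (𝓕 (fun ξ => (selfConv η ξ : ℂ)))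
      rw [hCF]; exact hsq)
  change 𝓕⁻ (𝓕 (fun ξ => (selfConv η ξ : ℂ))) = (fun ξ => (selfConv η ξ : ℂ)) at hinv
  rw [hCF] at hinv
  set c : ℝ := Real.pi ^ ((d : ℝ) / 2) / Real.Gamma (((d : ℝ) + 1) / 2) * Real.sqrt Real.pi with hc
  have hc0 : 0 < c := by
    have : 0 < Real.Gamma (((d : ℝ) + 1) / 2) := Real.Gamma_pos_of_pos (by positivity)
    have := Real.pi_pos
    positivity
  refine ⟨c, fun y => θ y ^ 2, hc0, fun y => sq_nonneg _, ?_, fun x => ?_⟩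
  · simpa only [RCLike.re_to_complex, Complex.ofReal_re] using hsq.re
  set w : EuclideanSpace ℝ (Fin d) → ℝ := fun ξ => (1 + ‖ξ‖ ^ 2) ^ (-((d : ℝ) + 1) / 2) with hw
  have hwi : Integrable w := by
    have := integrable_poisson_weight (V := EuclideanSpace ℝ (Fin d))
    rwa [hfin] at this
  have hwE : ∀ z : EuclideanSpace ℝ (Fin d),
      ∫ ξ, Complex.exp (2 * Real.pi * Complex.I * inner ℝ z ξ) * (w ξ : ℂ) =
      ((c * Real.exp (-(2 * Real.pi * ‖z‖)) : ℝ) : ℂ) := by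
    intro z
    have := integral_poisson_weight z
    rw [hfin] at this
    rw [this, hc, ← mul_assoc]
  -- With η ∗ η expressed as the inverse transform of θ², Fubini leaves, for each y, the inverse
  -- transform of the Poisson weight at x + y, with the nonnegative coefficient θ(y)².
  let F : EuclideanSpace ℝ (Fin d) → EuclideanSpace ℝ (Fin d) → ℂ := fun ξ y =>
    Complex.exp (((2 * Real.pi * inner ℝ (x + y) ξ : ℝ) : ℂ) * Complex.I) *
      ((w ξ : ℂ) * ((θ y ^ 2 : ℝ) : ℂ))
  have hF : Integrable (Function.uncurry F)
      ((volume : Measure (EuclideanSpace ℝ (Fin d))).prod volume) := by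
    refine (hwi.ofReal.mul_prod hsq).bdd_mul (c := 1) ?_ ?_
    · apply Continuous.aestronglyMeasurable
      fun_prop
    · exact Filter.Eventually.of_forall fun p => (Complex.norm_exp_ofReal_mul_I _).le
  have swap := integral_integral_swap hF
  rw [Real.fourierInv_eq']
  calc ∫ v, Complex.exp (↑(2 * Real.pi * inner ℝ v x) * Complex.I) • (kernelHat η v : ℂ)
      = ∫ ξ, ∫ y, F ξ y := by
        congr 1
        ext ξ
        have h1 : (kernelHat η ξ : ℂ) = (w ξ : ℂ) * 𝓕⁻ (fun y => ((θ y ^ 2 : ℝ) : ℂ)) ξ := by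
          rw [hinv, ← Complex.ofReal_mul]; rfl
        rw [h1, Real.fourierInv_eq', smul_eq_mul, ← mul_assoc, ← integral_const_mul]
        congr 1
        ext y
        simp only [F, smul_eq_mul]
        rw [inner_add_left, mul_add, Complex.ofReal_add, add_mul, Complex.exp_add,
          real_inner_comm ξ x]
        ring
    _ = ∫ y, ∫ ξ, F ξ y := swap
    _ = _ := by
        rw [← integral_const_mul, ← integral_complex_ofReal]
        congr 1
        ext y
        have h2 : ∀ ξ, F ξ y = ((θ y ^ 2 : ℝ) : ℂ) *
            (Complex.exp (2 * Real.pi * Complex.I * inner ℝ (x + y) ξ) * (w ξ : ℂ)) := by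
          intro ξ
          simp only [F]
          rw [show ((2 * Real.pi * inner ℝ (x + y) ξ : ℝ) : ℂ) * Complex.I =
            2 * Real.pi * Complex.I * inner ℝ (x + y) ξ by push_cast; ring]
          ring
        simp_rw [h2]
        rw [integral_const_mul, hwE]
        push_cast
        ring

end Kernel

/-! ### Positivity, translation bounds and tails of the kernel -/

section KernelProperties

variable {d : ℕ} {η : EuclideanSpace ℝ (Fin d) → ℝ}

theorem IsProfile.fourierInv_kernelHat (h : IsProfile η) (x : EuclideanSpace ℝ (Fin d)) :
    𝓕⁻ (fun ξ => (kernelHat η ξ : ℂ)) x = (kernel η x : ℂ) := by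
  obtain ⟨c, g, -, -, -, hK⟩ := h.exists_kernel_eq
  rw [kernel, hK, Complex.ofReal_re]

theorem IsProfile.ofReal_kernel (h : IsProfile η) (x : EuclideanSpace ℝ (Fin d)) :
    (kernel η x : ℂ) =
      (𝓕⁻ h.kernelHatSchwartz : SchwartzMap (EuclideanSpace ℝ (Fin d)) ℂ) x := by
  rw [← h.fourierInv_kernelHat, SchwartzMap.fourierInv_coe]
  rfl

theorem IsProfile.kernel_eq_re (h : IsProfile η) : kernel η =
    fun x => ((𝓕⁻ h.kernelHatSchwartz : SchwartzMap (EuclideanSpace ℝ (Fin d)) ℂ) x).re := by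
  ext x
  rw [← h.ofReal_kernel, Complex.ofReal_re]

theorem IsProfile.kernel_continuous (h : IsProfile η) : Continuous (kernel η) := by
  rw [h.kernel_eq_re]
  exact Complex.continuous_re.comp (SchwartzMap.continuous _)

theorem IsProfile.kernel_integrable (h : IsProfile η) : Integrable (kernel η) := by
  rw [h.kernel_eq_re]
  exact (SchwartzMap.integrable (μ := volume) (𝓕⁻ h.kernelHatSchwartz :
    SchwartzMap (EuclideanSpace ℝ (Fin d)) ℂ)).re

theorem IsProfile.kernel_nonneg (h : IsProfile η) (x : EuclideanSpace ℝ (Fin d)) :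
    0 ≤ kernel η x := by
  obtain ⟨c, g, hc, hg, -, hK⟩ := h.exists_kernel_eq
  rw [kernel, hK, Complex.ofReal_re]
  exact mul_nonneg hc.le (integral_nonneg fun y => mul_nonneg (hg y) (Real.exp_pos _).le)

/-- Translating the kernel by `p` costs at most a factor `exp (2π |p|)`. -/
theorem IsProfile.exp_mul_kernel_le (h : IsProfile η) (x p : EuclideanSpace ℝ (Fin d)) :
    Real.exp (-(2 * Real.pi * ‖p‖)) * kernel η x ≤ kernel η (x + p) := by
  obtain ⟨c, g, hc, hg, hgi, hK⟩ := h.exists_kernel_eq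
  have hint : ∀ z : EuclideanSpace ℝ (Fin d),
      Integrable fun y => g y * Real.exp (-(2 * Real.pi * ‖z + y‖)) := by
    intro z
    refine hgi.mul_bdd (c := 1) ?_ (Filter.Eventually.of_forall fun y => ?_)
    · apply Continuous.aestronglyMeasurable
      fun_prop
    · rw [Real.norm_eq_abs, abs_of_pos (Real.exp_pos _), Real.exp_le_one_iff]
      have := Real.pi_pos
      have := norm_nonneg (z + y)
      nlinarith [mul_nonneg Real.pi_pos.le this]
  rw [kernel, kernel, hK, hK, Complex.ofReal_re, Complex.ofReal_re, mul_left_comm,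
    ← integral_const_mul]
  refine mul_le_mul_of_nonneg_left ?_ hc.le
  refine integral_mono ((hint x).const_mul _) (hint (x + p)) fun y => ?_
  simp only
  rw [mul_left_comm, ← Real.exp_add]
  refine mul_le_mul_of_nonneg_left (Real.exp_le_exp.2 ?_) (hg y)
  have h1 : ‖x + p + y‖ ≤ ‖x + y‖ + ‖p‖ := by
    rw [show x + p + y = (x + y) + p by abel]; exact norm_add_le _ _
  nlinarith [Real.pi_pos]

theorem IsProfile.kernel_add_le (h : IsProfile η) (x p : EuclideanSpace ℝ (Fin d)) :
    kernel η (x + p) ≤ Real.exp (2 * Real.pi * ‖p‖) * kernel η x := by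
  have := h.exp_mul_kernel_le (x + p) (-p)
  rw [norm_neg, add_neg_cancel_right, Real.exp_neg] at this
  rwa [inv_mul_le_iff₀ (Real.exp_pos _)] at this

theorem IsProfile.fourier_kernel (h : IsProfile η) (ξ : EuclideanSpace ℝ (Fin d)) :
    𝓕 (fun x => (kernel η x : ℂ)) ξ = (kernelHat η ξ : ℂ) := by
  have h1 : (fun x => (kernel η x : ℂ)) =
      (𝓕⁻ h.kernelHatSchwartz : SchwartzMap (EuclideanSpace ℝ (Fin d)) ℂ) :=
    funext h.ofReal_kernel
  rw [h1, ← SchwartzMap.fourier_coe, FourierTransform.fourier_fourierInv_eq]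
  rfl

theorem IsProfile.integral_kernel (h : IsProfile η) : ∫ x, kernel η x = 1 := by
  have h1 := h.fourier_kernel 0
  rw [Real.fourier_eq', h.kernelHat_zero] at h1
  simp only [inner_zero_right, mul_zero, Complex.ofReal_zero, zero_mul, Complex.exp_zero,
    one_smul] at h1
  rw [integral_complex_ofReal] at h1
  exact_mod_cast h1

/-- This is the transform of a probability density. -/
theorem IsProfile.abs_kernelHat_le (h : IsProfile η) (ξ : EuclideanSpace ℝ (Fin d)) :
    |kernelHat η ξ| ≤ 1 := by
  have h1 := VectorFourier.norm_fourierIntegral_le_integral_norm Real.fourierChar volume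
    (innerₗ (EuclideanSpace ℝ (Fin d))) (fun x => (kernel η x : ℂ)) ξ
  have h2 := h.fourier_kernel ξ
  rw [Real.fourier_eq] at h2
  rw [VectorFourier.fourierIntegral] at h1
  simp only [innerₗ_apply_apply] at h1
  rw [h2] at h1
  simp only [Complex.norm_real, Real.norm_eq_abs, abs_of_nonneg (h.kernel_nonneg _)] at h1
  rwa [h.integral_kernel] at h1

/-- By the translation bound a single zero would force the kernel to vanish everywhere, against
total mass 1. -/
theorem IsProfile.kernel_pos (h : IsProfile η) (x : EuclideanSpace ℝ (Fin d)) :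
    0 < kernel η x := by
  by_contra hx
  have hx0 : kernel η x = 0 := le_antisymm (not_lt.1 hx) (h.kernel_nonneg x)
  have : ∀ z, kernel η z = 0 := by
    intro z
    refine le_antisymm ?_ (h.kernel_nonneg z)
    have := h.kernel_add_le x (z - x)
    rwa [hx0, mul_zero, add_sub_cancel] at this
  have h1 := h.integral_kernel
  simp [this] at h1

theorem IsProfile.integrable_norm_sq_mul_kernel (h : IsProfile η) :
    Integrable fun x => ‖x‖ ^ 2 * kernel η x := by
  have := (𝓕⁻ h.kernelHatSchwartz :
    SchwartzMap (EuclideanSpace ℝ (Fin d)) ℂ).integrable_pow_mul volume 2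
  refine this.congr (Filter.Eventually.of_forall fun x => ?_)
  simp only
  rw [← h.ofReal_kernel, Complex.norm_real, Real.norm_eq_abs, abs_of_nonneg (h.kernel_nonneg x)]

theorem measurableSet_le_norm (t : ℝ) : MeasurableSet {x : EuclideanSpace ℝ (Fin d) | t ≤ ‖x‖} :=
  measurableSet_le measurable_const measurable_norm

theorem measurableSet_norm_le (t : ℝ) : MeasurableSet {x : EuclideanSpace ℝ (Fin d) | ‖x‖ ≤ t} :=
  measurableSet_le measurable_norm measurable_const

theorem IsProfile.tail_antitone (h : IsProfile η) : Antitone (tail η) := fun _ _ hst =>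
  setIntegral_mono_set h.kernel_integrable.integrableOn
    (Filter.Eventually.of_forall h.kernel_nonneg)
    (Filter.Eventually.of_forall fun _ hx => le_trans hst hx)

theorem IsProfile.tail_le_one (h : IsProfile η) (t : ℝ) : tail η t ≤ 1 := by
  rw [← h.integral_kernel]
  exact setIntegral_le_integral h.kernel_integrable (Filter.Eventually.of_forall h.kernel_nonneg)

theorem IsProfile.tail_nonneg (h : IsProfile η) (t : ℝ) : 0 ≤ tail η t :=
  integral_nonneg h.kernel_nonneg

theorem setIntegral_pos_of_pos {s : Set (EuclideanSpace ℝ (Fin d))}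
    {f : EuclideanSpace ℝ (Fin d) → ℝ} (hf : Integrable f) (hpos : ∀ x, 0 < f x)
    (hs : volume s ≠ 0) : 0 < ∫ x in s, f x := by
  rw [integral_pos_iff_support_of_nonneg (fun x => (hpos x).le) hf.integrableOn]
  have : Function.support f = univ := eq_univ_of_forall fun x => (hpos x).ne'
  rw [this, Measure.restrict_apply_univ]
  exact pos_iff_ne_zero.2 hs

theorem IsProfile.tail_pos (h : IsProfile η) (hd : 0 < d) (t : ℝ) : 0 < tail η t := by
  refine setIntegral_pos_of_pos h.kernel_integrable h.kernel_pos ?_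
  have hne : {x : EuclideanSpace ℝ (Fin d) | t < ‖x‖}.Nonempty := by
    refine ⟨PiLp.single 2 ⟨0, hd⟩ (|t| + 1), ?_⟩
    simp only [mem_ofPred_eq, PiLp.norm_single, Real.norm_eq_abs]
    rw [abs_of_pos (by positivity)]
    linarith [le_abs_self t]
  have ho : IsOpen {x : EuclideanSpace ℝ (Fin d) | t < ‖x‖} :=
    isOpen_lt continuous_const continuous_norm
  have := ho.measure_pos volume hne
  exact (this.trans_le (measure_mono fun x (hx : t < ‖x‖) => show t ≤ ‖x‖ from hx.le)).ne'

theorem IsProfile.integral_kernel_ball_pos (h : IsProfile η) :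
    0 < ∫ y in {y : EuclideanSpace ℝ (Fin d) | ‖y‖ ≤ 1}, kernel η y := by
  refine setIntegral_pos_of_pos h.kernel_integrable h.kernel_pos ?_
  have : {y : EuclideanSpace ℝ (Fin d) | ‖y‖ ≤ 1} = Metric.closedBall 0 1 := by ext; simp
  rw [this]
  exact (Metric.measure_closedBall_pos volume _ one_pos).ne'

theorem IsProfile.integral_kernel_ball_le_one (h : IsProfile η) :
    ∫ y in {y : EuclideanSpace ℝ (Fin d) | ‖y‖ ≤ 1}, kernel η y ≤ 1 := by
  rw [← h.integral_kernel]
  exact setIntegral_le_integral h.kernel_integrable (Filter.Eventually.of_forall h.kernel_nonneg)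

/-- Chebyshev's inequality; the second moment is finite because the kernel is a Schwartz function.
-/
theorem IsProfile.tail_le_div_sq (h : IsProfile η) {t : ℝ} (ht : 0 < t) :
    tail η t ≤ (∫ x, ‖x‖ ^ 2 * kernel η x) / t ^ 2 := by
  rw [le_div_iff₀ (by positivity), tail, ← integral_mul_const]
  refine le_trans ?_ (setIntegral_le_integral (s := {x | t ≤ ‖x‖}) h.integrable_norm_sq_mul_kernel
    (Filter.Eventually.of_forall fun x => mul_nonneg (sq_nonneg _) (h.kernel_nonneg x)))
  refine setIntegral_mono_on (h.kernel_integrable.integrableOn.mul_const _)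
    h.integrable_norm_sq_mul_kernel.integrableOn (measurableSet_le_norm t) fun x hx => ?_
  rw [mul_comm]
  exact mul_le_mul_of_nonneg_right (pow_le_pow_left₀ ht.le hx 2) (h.kernel_nonneg x)

/-- The factor `4γ` in the definition of `psi`. -/
noncomputable def psiFactor (η : EuclideanSpace ℝ (Fin d) → ℝ) : ℝ :=
  4 * (Real.exp (-(2 * Real.pi)) * ∫ y in {y | ‖y‖ ≤ 1}, kernel η y)⁻¹

theorem psi_eq (t : ℝ) : psi η t = psiFactor η * tail η (t / 2) := rfl

theorem IsProfile.psiFactor_pos (h : IsProfile η) : 0 < psiFactor η := by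
  have := h.integral_kernel_ball_pos
  have := Real.exp_pos (-(2 * Real.pi))
  rw [psiFactor]
  positivity

theorem IsProfile.psi_antitone (h : IsProfile η) : Antitone (psi η) := fun s t hst => by
  rw [psi_eq, psi_eq]
  exact mul_le_mul_of_nonneg_left (h.tail_antitone (by linarith)) h.psiFactor_pos.le

theorem IsProfile.psi_nonneg (h : IsProfile η) (t : ℝ) : 0 ≤ psi η t :=
  mul_nonneg h.psiFactor_pos.le (h.tail_nonneg _)

theorem IsProfile.psi_pos (h : IsProfile η) (hd : 0 < d) (t : ℝ) : 0 < psi η t :=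
  mul_pos h.psiFactor_pos (h.tail_pos hd _)

theorem IsProfile.psi_le (h : IsProfile η) (t : ℝ) : psi η t ≤ psiFactor η := by
  rw [psi_eq]
  exact mul_le_of_le_one_right h.psiFactor_pos.le (h.tail_le_one _)

/-- For independent `Y`, `Z` with the same law, `N Y ≤ N Z` has probability at least `1/2`. -/
theorem half_sq_integral_le {X : Type*} [MeasurableSpace X] {μ : Measure X} [SFinite μ]
    {k N : X → ℝ} (hk : Integrable k μ) (hk0 : ∀ x, 0 ≤ k x) (hN : Measurable N) :
    (∫ x, k x ∂μ) * (∫ x, k x ∂μ) / 2 ≤ ∫ y, k y * ∫ z in {z | N y ≤ N z}, k z ∂μ ∂μ := by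
  have hprod := hk.mul_prod hk
  let S : Set (X × X) := {p | N p.1 ≤ N p.2}
  have hSm : MeasurableSet S := measurableSet_le (hN.comp measurable_fst) (hN.comp measurable_snd)
  let f : X × X → ℝ := fun p => k p.1 * k p.2
  have hf0 : ∀ p, 0 ≤ f p := fun p => mul_nonneg (hk0 _) (hk0 _)
  have hfS : Integrable (S.indicator f) (μ.prod μ) := hprod.indicator hSm
  have e1 : ∫ y, k y * ∫ z in {z | N y ≤ N z}, k z ∂μ ∂μ = ∫ p, S.indicator f p ∂(μ.prod μ) := by
    rw [integral_prod _ hfS]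
    congr 1
    ext y
    rw [← integral_indicator (measurableSet_le measurable_const hN), ← integral_const_mul]
    congr 1
    ext z
    by_cases hz : N y ≤ N z
    · simp [S, f, indicator, hz]
    · simp [S, f, indicator, hz]
  have e2 : ∫ p, S.indicator f p.swap ∂(μ.prod μ) = ∫ p, S.indicator f p ∂(μ.prod μ) :=
    integral_prod_swap _
  have e3 : ∫ p, f p ∂(μ.prod μ) = (∫ x, k x ∂μ) * ∫ x, k x ∂μ := integral_prod_mul _ _
  have hfS' : Integrable (fun p => S.indicator f p.swap) (μ.prod μ) := hfS.swap
  -- Every pair lies in S or in its reflection, and the two have the same weight by symmetry, so S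
  -- carries at least half.
  have e4 : ∫ p, f p ∂(μ.prod μ) ≤ ∫ p, (S.indicator f p + S.indicator f p.swap) ∂(μ.prod μ) := by
    refine integral_mono hprod (hfS.add hfS') fun p => ?_
    have hsw : f p.swap = f p := mul_comm _ _
    simp only [indicator]
    rcases le_total (N p.1) (N p.2) with hp | hp
    · have : p ∈ S := hp
      rw [if_pos this]
      have := hf0 p.swap
      split_ifs <;> linarith
    · have : p.swap ∈ S := hp
      rw [if_pos this, hsw]
      have := hf0 p
      split_ifs <;> linarith
  rw [integral_add hfS hfS', e3, e2] at e4
  rw [e1]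
  linarith

theorem IsProfile.half_le_integral_kernel_mul_tail (h : IsProfile η) :
    1 / 2 ≤ ∫ y, kernel η y * tail η ‖y‖ := by
  have := half_sq_integral_le h.kernel_integrable h.kernel_nonneg
    (continuous_norm.measurable : Measurable fun x : EuclideanSpace ℝ (Fin d) => ‖x‖)
  rwa [h.integral_kernel, one_mul] at this

end KernelProperties

/-! ### Distance to the boundary on the torus -/

section Geometry

variable {d : ℕ}

/-- The covering map `ℝ^d → 𝕋^d`. -/
def toTorus (v : EuclideanSpace ℝ (Fin d)) : UnitAddTorus (Fin d) := fun i => (v i : UnitAddCircle)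

theorem toTorus_add (v w : EuclideanSpace ℝ (Fin d)) : toTorus (v + w) = toTorus v + toTorus w := by
  ext i; simp [toTorus]

theorem toTorus_sub (v w : EuclideanSpace ℝ (Fin d)) : toTorus (v - w) = toTorus v - toTorus w := by
  ext i; simp [toTorus]

theorem toTorus_zero : toTorus (0 : EuclideanSpace ℝ (Fin d)) = 0 := by
  ext i; simp [toTorus]

theorem isOpenQuotientMap_toTorus : IsOpenQuotientMap (toTorus (d := d)) := by
  have h1 : IsOpenQuotientMap
      (Pi.map fun (_ : Fin d) (r : ℝ) => (r : UnitAddCircle)) :=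
    IsOpenQuotientMap.piMap fun _ => QuotientAddGroup.isOpenQuotientMap_mk
  exact h1.comp (PiLp.homeomorph 2 fun _ : Fin d => ℝ).isOpenQuotientMap

theorem continuous_toTorus : Continuous (toTorus (d := d)) := isOpenQuotientMap_toTorus.continuous

/-- The Euclidean quotient distance on the torus. -/
theorem dist_toLp_sub_toTorus_le (x : UnitAddTorus (Fin d)) (v : EuclideanSpace ℝ (Fin d)) :
    dist (WithLp.toLp 2 (x - toTorus v) : PiLp 2 fun _ : Fin d => UnitAddCircle)
      (WithLp.toLp 2 x) ≤ ‖v‖ := by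
  rw [PiLp.dist_eq_of_L2, EuclideanSpace.norm_eq]
  refine Real.sqrt_le_sqrt (Finset.sum_le_sum fun i _ => ?_)
  refine pow_le_pow_left₀ dist_nonneg ?_ 2
  rw [dist_eq_norm]
  simp only [Pi.sub_apply, sub_sub_cancel_left, norm_neg, toTorus]
  exact QuotientAddGroup.norm_mk_le_norm

/-- In each coordinate r - round r represents the difference and has absolute value equal to its
quotient norm; together they lift the displacement with the right Euclidean length. -/
theorem exists_sub_toTorus_eq (x y : UnitAddTorus (Fin d)) :
    ∃ v : EuclideanSpace ℝ (Fin d), y = x - toTorus v ∧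
      ‖v‖ = dist (WithLp.toLp 2 x : PiLp 2 fun _ : Fin d => UnitAddCircle) (WithLp.toLp 2 y) := by
  have h1 : ∀ u : UnitAddCircle, ∃ r : ℝ, (r : UnitAddCircle) = u ∧ |r| = ‖u‖ := by
    intro u
    induction u using QuotientAddGroup.induction_on with
    | H z =>
      refine ⟨z - round z, ?_, ?_⟩
      · have h0 : (((round z : ℤ) : ℝ) : UnitAddCircle) = 0 :=
          (AddCircle.coe_eq_zero_iff (p := (1 : ℝ))).2 ⟨round z, by simp⟩
        rw [AddCircle.coe_sub, h0, sub_zero]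
      · exact UnitAddCircle.norm_eq.symm
  choose r hr1 hr2 using fun i => h1 (x i - y i)
  refine ⟨WithLp.toLp 2 r, ?_, ?_⟩
  · ext i
    simp [toTorus, hr1]
  · rw [PiLp.dist_eq_of_L2, EuclideanSpace.norm_eq]
    congr 1
    refine Finset.sum_congr rfl fun i _ => ?_
    simp only [Real.norm_eq_abs, hr2, dist_eq_norm]

theorem continuous_distBdry (Ω : Set (UnitAddTorus (Fin d))) : Continuous (distBdry Ω) :=
  Metric.continuous_infEDist.comp (PiLp.continuous_toLp 2 _)

theorem distBdry_eq_top_iff {Ω : Set (UnitAddTorus (Fin d))} {x : UnitAddTorus (Fin d)} :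
    distBdry Ω x = ⊤ ↔ frontier Ω = ∅ := by
  rw [distBdry, Metric.infEDist_eq_top_iff, image_eq_empty]

theorem distBdry_sub_toTorus_le (Ω : Set (UnitAddTorus (Fin d))) (x : UnitAddTorus (Fin d))
    (v : EuclideanSpace ℝ (Fin d)) :
    distBdry Ω (x - toTorus v) ≤ distBdry Ω x + ENNReal.ofReal ‖v‖ := by
  refine (Metric.infEDist_le_infEDist_add_edist (y := WithLp.toLp 2 x)).trans ?_
  refine add_le_add le_rfl ?_
  rw [edist_dist]
  exact ENNReal.ofReal_le_ofReal (dist_toLp_sub_toTorus_le x v)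

theorem distBdry_le_sub_toTorus (Ω : Set (UnitAddTorus (Fin d))) (x : UnitAddTorus (Fin d))
    (v : EuclideanSpace ℝ (Fin d)) :
    distBdry Ω x ≤ distBdry Ω (x - toTorus v) + ENNReal.ofReal ‖v‖ := by
  have := distBdry_sub_toTorus_le Ω (x - toTorus v) (-v)
  rwa [norm_neg, sub_sub, ← toTorus_add, add_neg_cancel, toTorus_zero, sub_zero] at this

theorem distBdry_le_of_mem (Ω : Set (UnitAddTorus (Fin d))) {x : UnitAddTorus (Fin d)}
    {v : EuclideanSpace ℝ (Fin d)} (hv : x - toTorus v ∈ frontier Ω) :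
    distBdry Ω x ≤ ENNReal.ofReal ‖v‖ := by
  refine (Metric.infEDist_le_edist_of_mem (mem_image_of_mem _ hv)).trans ?_
  rw [edist_comm, edist_dist]
  exact ENNReal.ofReal_le_ofReal (dist_toLp_sub_toTorus_le x v)

theorem distBdry_eq_zero {Ω : Set (UnitAddTorus (Fin d))} {x : UnitAddTorus (Fin d)}
    (hx : x ∈ frontier Ω) : distBdry Ω x = 0 := by
  have := distBdry_le_of_mem Ω (x := x) (v := 0) (by rwa [toTorus_zero, sub_zero])
  simpa using this

theorem exists_mem_frontier_distBdry_eq {Ω : Set (UnitAddTorus (Fin d))}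
    (hΩ : (frontier Ω).Nonempty) (x : UnitAddTorus (Fin d)) :
    ∃ v : EuclideanSpace ℝ (Fin d), x - toTorus v ∈ frontier Ω ∧
      distBdry Ω x = ENNReal.ofReal ‖v‖ := by
  have hc : IsCompact (WithLp.toLp 2 '' frontier Ω : Set (PiLp 2 fun _ : Fin d => UnitAddCircle)) :=
    isClosed_frontier.isCompact.image (PiLp.continuous_toLp 2 _)
  obtain ⟨_, ⟨y, hy, rfl⟩, hxy⟩ := hc.exists_infEDist_eq_edist (hΩ.image _) (WithLp.toLp 2 x)
  obtain ⟨v, rfl, hv⟩ := exists_sub_toTorus_eq x y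
  exact ⟨v, hy, by rw [distBdry, hxy, edist_dist, hv]⟩

/-- Off the frontier the space is the disjoint union of two open sets, the interior and the exterior
of Ω; a connected set stays in one of them. -/
theorem mem_iff_of_isPreconnected {X : Type*} [TopologicalSpace X] {S Ω : Set X}
    (hS : IsPreconnected S) (hd : Disjoint S (frontier Ω)) {x y : X} (hx : x ∈ S) (hy : y ∈ S) :
    x ∈ Ω ↔ y ∈ Ω := by
  have key : ∀ {x y : X}, x ∈ S → y ∈ S → x ∈ Ω → y ∈ Ω := by
    intro x y hx hy hxΩ
    have hcov : S ⊆ interior Ω ∪ (closure Ω)ᶜ := by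
      intro z hz
      by_cases hzi : z ∈ interior Ω
      · exact Or.inl hzi
      · exact Or.inr fun hzc => disjoint_left.1 hd hz ⟨hzc, hzi⟩
    have hsub := hS.subset_left_of_subset_union isOpen_interior isClosed_closure.isOpen_compl
      (disjoint_compl_right.mono_left (interior_subset.trans subset_closure)) hcov
      ⟨x, hx, by
        rcases hcov hx with h | h
        · exact h
        · exact absurd (subset_closure hxΩ) h⟩
    exact interior_subset (hsub hy)
  exact ⟨key hx hy, key hy hx⟩

/-- Moving by less than the distance to the boundary does not change membership in `Ω`. -/
theorem sub_toTorus_mem_iff {Ω : Set (UnitAddTorus (Fin d))} {x : UnitAddTorus (Fin d)}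
    {v : EuclideanSpace ℝ (Fin d)} (hv : ENNReal.ofReal ‖v‖ < distBdry Ω x) :
    x - toTorus v ∈ Ω ↔ x ∈ Ω := by
  -- The segment from x to x - v stays within |v| of x, hence misses the frontier.
  set S : Set (UnitAddTorus (Fin d)) := (fun t : ℝ => x - toTorus (t • v)) '' Icc 0 1 with hS
  have hSc : IsPreconnected S := by
    refine isPreconnected_Icc.image _ (Continuous.continuousOn ?_)
    exact continuous_const.sub (continuous_toTorus.comp (continuous_id.smul continuous_const))
  refine mem_iff_of_isPreconnected hSc ?_ ⟨1, by simp, by simp⟩ ⟨0, by simp, by simp [toTorus_zero]⟩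
  rw [disjoint_left]
  rintro _ ⟨t, ht, rfl⟩ hf
  refine (distBdry_le_of_mem Ω hf).not_gt (lt_of_le_of_lt (ENNReal.ofReal_le_ofReal ?_) hv)
  rw [norm_smul, Real.norm_eq_abs, abs_of_nonneg ht.1]
  exact mul_le_of_le_one_left (norm_nonneg _) ht.2

theorem distBdry_le_sqrt {Ω : Set (UnitAddTorus (Fin d))} (hΩ : (frontier Ω).Nonempty)
    (x : UnitAddTorus (Fin d)) : distBdry Ω x ≤ ENNReal.ofReal (Real.sqrt d) := by
  obtain ⟨y, hy⟩ := hΩ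
  refine (Metric.infEDist_le_edist_of_mem (mem_image_of_mem _ hy)).trans ?_
  rw [edist_dist]
  refine ENNReal.ofReal_le_ofReal ?_
  rw [PiLp.dist_eq_of_L2]
  refine Real.sqrt_le_sqrt ?_
  calc ∑ i, dist (x i) (y i) ^ 2 ≤ ∑ _i : Fin d, (1 : ℝ) := by
        refine Finset.sum_le_sum fun i _ => ?_
        have h1 : dist (x i) (y i) ≤ 1 / 2 := by
          rw [dist_eq_norm]
          simpa using AddCircle.norm_le_half_period (p := (1 : ℝ)) (x := x i - y i) one_ne_zero
        have h0 : 0 ≤ dist (x i) (y i) := dist_nonneg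
        nlinarith
    _ = d := by simp

end Geometry

/-! ### Smoothing and the pointwise majorant -/

section Smoothing

variable {d : ℕ} {η : EuclideanSpace ℝ (Fin d) → ℝ}

/-- Convolution of a function on the torus with the kernel `R^d K(R ·)`. -/
noncomputable def smoothing (η : EuclideanSpace ℝ (Fin d) → ℝ) (R : ℝ)
    (f : UnitAddTorus (Fin d) → ℝ) (x : UnitAddTorus (Fin d)) : ℝ :=
  ∫ y, kernel η y * f (x - toTorus (R⁻¹ • y))

theorem measurable_sub_toTorus (x : UnitAddTorus (Fin d)) (R : ℝ) :
    Measurable fun y : EuclideanSpace ℝ (Fin d) => x - toTorus (R⁻¹ • y) :=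
  (continuous_const.sub (continuous_toTorus.comp (continuous_const_smul _))).measurable

theorem IsProfile.integrable_kernel_mul (h : IsProfile η) {f : EuclideanSpace ℝ (Fin d) → ℝ}
    (hf : Measurable f) {B : ℝ} (hB : ∀ y, |f y| ≤ B) : Integrable fun y => kernel η y * f y :=
  h.kernel_integrable.mul_bdd (c := B) hf.aestronglyMeasurable
    (Filter.Eventually.of_forall fun y => by simpa using hB y)

theorem IsProfile.measurable_psiDist (h : IsProfile η) (Ω : Set (UnitAddTorus (Fin d))) (R : ℝ) :
    Measurable (psiDist η Ω R) := by
  have hm : Measurable (distBdry Ω) := (continuous_distBdry Ω).measurable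
  refine Measurable.ite (hm (measurableSet_singleton ⊤)) measurable_const ?_
  exact h.psi_antitone.measurable.comp (hm.ennreal_toReal.const_mul R)

theorem IsProfile.psiDist_nonneg (h : IsProfile η) (Ω : Set (UnitAddTorus (Fin d))) (R : ℝ)
    (x : UnitAddTorus (Fin d)) : 0 ≤ psiDist η Ω R x := by
  rw [psiDist]; split_ifs
  · exact le_rfl
  · exact h.psi_nonneg _

theorem IsProfile.psiDist_le (h : IsProfile η) (Ω : Set (UnitAddTorus (Fin d))) (R : ℝ)
    (x : UnitAddTorus (Fin d)) : psiDist η Ω R x ≤ psiFactor η := by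
  rw [psiDist]; split_ifs
  · exact h.psiFactor_pos.le
  · exact h.psi_le _

theorem IsProfile.abs_psiDist_le (h : IsProfile η) (Ω : Set (UnitAddTorus (Fin d))) (R : ℝ)
    (x : UnitAddTorus (Fin d)) : |psiDist η Ω R x| ≤ psiFactor η := by
  rw [abs_of_nonneg (h.psiDist_nonneg Ω R x)]
  exact h.psiDist_le Ω R x

theorem IsProfile.psi_le_psiDist (h : IsProfile η) {Ω : Set (UnitAddTorus (Fin d))} {R : ℝ}
    (hR : 0 < R) {x : UnitAddTorus (Fin d)} {s : ℝ} (hs : 0 ≤ s)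
    (hx : distBdry Ω x ≤ ENNReal.ofReal s) : psi η (R * s) ≤ psiDist η Ω R x := by
  have hne : distBdry Ω x ≠ ⊤ := ne_top_of_le_ne_top ENNReal.ofReal_ne_top hx
  rw [psiDist, if_neg hne]
  refine h.psi_antitone (mul_le_mul_of_nonneg_left ?_ hR.le)
  exact ENNReal.toReal_le_of_le_ofReal hs hx

/-- The majorant inequality for a boundary consisting of one point, at displacement q; it dictates
the constant in ψ. -/
theorem IsProfile.tail_le_integral_kernel_mul_psi (h : IsProfile η)
    (q : EuclideanSpace ℝ (Fin d)) :
    tail η ‖q‖ ≤ ∫ y, kernel η y * psi η ‖q - y‖ := by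
  have hmeas : ∀ a : EuclideanSpace ℝ (Fin d), Measurable fun y => psi η ‖a - y‖ := fun a =>
    h.psi_antitone.measurable.comp (by fun_prop)
  have habs : ∀ t, |psi η t| ≤ psiFactor η := fun t => by
    rw [abs_of_nonneg (h.psi_nonneg t)]; exact h.psi_le t
  have hint := h.integrable_kernel_mul (hmeas q) (fun y => habs _)
  set b := ∫ y in {y : EuclideanSpace ℝ (Fin d) | ‖y‖ ≤ 1}, kernel η y with hb
  have hb0 : 0 < b := h.integral_kernel_ball_pos
  have hb1 : b ≤ 1 := h.integral_kernel_ball_le_one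
  have hfac : psiFactor η * b = 4 * Real.exp (2 * Real.pi) := by
    rw [psiFactor, ← hb, Real.exp_neg]
    have := Real.exp_pos (2 * Real.pi)
    field_simp
  -- For |q| ≥ 1 the ball |y| ≤ 1 is enough: there |q - y| ≤ 2|q|, and ψ(2|q|) is a multiple of the
  -- required tail. The factor left over is 4 exp(2π).
  rcases le_or_gt 1 ‖q‖ with hq | hq
  · have h1 : ∫ y in {y : EuclideanSpace ℝ (Fin d) | ‖y‖ ≤ 1}, kernel η y * psi η (2 * ‖q‖) ≤
        ∫ y in {y : EuclideanSpace ℝ (Fin d) | ‖y‖ ≤ 1}, kernel η y * psi η ‖q - y‖ := by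
      refine setIntegral_mono_on (h.kernel_integrable.integrableOn.mul_const _) hint.integrableOn
        (measurableSet_norm_le 1) fun y (hy : ‖y‖ ≤ 1) => ?_
      refine mul_le_mul_of_nonneg_left (h.psi_antitone ?_) (h.kernel_nonneg y)
      linarith [norm_sub_le q y]
    have h2 : ∫ y in {y : EuclideanSpace ℝ (Fin d) | ‖y‖ ≤ 1}, kernel η y * psi η ‖q - y‖ ≤
        ∫ y, kernel η y * psi η ‖q - y‖ :=
      setIntegral_le_integral hint (Filter.Eventually.of_forall fun y =>
        mul_nonneg (h.kernel_nonneg y) (h.psi_nonneg _))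
    refine le_trans ?_ (h1.trans h2)
    rw [integral_mul_const, ← hb, psi_eq, mul_div_cancel_left₀ _ two_ne_zero, ← mul_assoc,
      mul_comm b, hfac]
    have h3 : 1 ≤ Real.exp (2 * Real.pi) := Real.one_le_exp (by positivity)
    have h4 := h.tail_nonneg ‖q‖
    nlinarith
  -- For |q| < 1 recentre at q, losing at most exp(-2π) by the translation bound. The median
  -- estimate contributes 1/2 and the constant 4, so the right side is at least 2, while a tail is
  -- at most 1.
  · have h1 : ∫ y, kernel η y * psi η ‖q - y‖ = ∫ z, kernel η (z + q) * psi η ‖z‖ := by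
      rw [← integral_add_right_eq_self _ q]
      congr 1; ext z
      rw [show q - (z + q) = -z by abel, norm_neg]
    have hmeas0 : Measurable fun z : EuclideanSpace ℝ (Fin d) => psi η ‖z‖ :=
      h.psi_antitone.measurable.comp measurable_norm
    have hmt : Measurable fun z : EuclideanSpace ℝ (Fin d) => tail η ‖z‖ :=
      h.tail_antitone.measurable.comp measurable_norm
    have hint2 : Integrable fun z => kernel η (z + q) * psi η ‖z‖ :=
      (h.kernel_integrable.comp_add_right q).mul_bdd (c := psiFactor η)
        hmeas0.aestronglyMeasurable (Filter.Eventually.of_forall fun y => by simpa using habs _)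
    have hint3 : Integrable fun z => kernel η z * tail η ‖z‖ :=
      h.integrable_kernel_mul hmt (B := 1) fun y => by
        rw [abs_of_nonneg (h.tail_nonneg _)]; exact h.tail_le_one _
    have h2 : ∫ z, (Real.exp (-(2 * Real.pi)) * psiFactor η) * (kernel η z * tail η ‖z‖) ≤
        ∫ z, kernel η (z + q) * psi η ‖z‖ := by
      refine integral_mono (hint3.const_mul _) hint2 fun z => ?_
      have e1 : Real.exp (-(2 * Real.pi)) * kernel η z ≤ kernel η (z + q) := by
        refine le_trans ?_ (h.exp_mul_kernel_le z q)
        refine mul_le_mul_of_nonneg_right (Real.exp_le_exp.2 ?_) (h.kernel_nonneg z)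
        nlinarith [Real.pi_pos]
      have e2 : psiFactor η * tail η ‖z‖ ≤ psi η ‖z‖ := by
        rw [psi_eq]
        refine mul_le_mul_of_nonneg_left (h.tail_antitone ?_) h.psiFactor_pos.le
        linarith [norm_nonneg z]
      calc (Real.exp (-(2 * Real.pi)) * psiFactor η) * (kernel η z * tail η ‖z‖)
          = (Real.exp (-(2 * Real.pi)) * kernel η z) * (psiFactor η * tail η ‖z‖) := by ring
        _ ≤ _ := mul_le_mul e1 e2 (mul_nonneg h.psiFactor_pos.le (h.tail_nonneg _))
            (h.kernel_nonneg _)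
    rw [h1]
    refine le_trans ?_ h2
    rw [integral_const_mul]
    have h3 := h.half_le_integral_kernel_mul_tail
    have h4 : 4 ≤ Real.exp (-(2 * Real.pi)) * psiFactor η := by
      have : Real.exp (-(2 * Real.pi)) * psiFactor η * b = 4 := by
        rw [mul_assoc, hfac, Real.exp_neg]
        field_simp
      have h5 : 0 < Real.exp (-(2 * Real.pi)) * psiFactor η :=
        mul_pos (Real.exp_pos _) h.psiFactor_pos
      nlinarith
    have h5 := h.tail_le_one ‖q‖
    nlinarith

/-- The tail of the kernel at the scaled distance to the boundary is dominated by the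
smoothed `psiDist`. -/
theorem IsProfile.tail_le_smoothing (h : IsProfile η) {Ω : Set (UnitAddTorus (Fin d))} {R : ℝ}
    (hR : 0 < R) {x : UnitAddTorus (Fin d)} (hx : distBdry Ω x ≠ ⊤) :
    tail η (R * (distBdry Ω x).toReal) ≤ smoothing η R (psiDist η Ω R) x := by
  have hne : (frontier Ω).Nonempty := by
    rw [nonempty_iff_ne_empty]; exact fun h0 => hx (distBdry_eq_top_iff.2 h0)
  -- A nearest boundary point suffices: the distance to ∂Ω is at most the distance to it, and ψ is
  -- decreasing.
  obtain ⟨p, hp, hxp⟩ := exists_mem_frontier_distBdry_eq hne x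
  have h1 : R * (distBdry Ω x).toReal = ‖R • p‖ := by
    rw [hxp, ENNReal.toReal_ofReal (norm_nonneg _), norm_smul, Real.norm_eq_abs, abs_of_pos hR]
  rw [h1]
  refine (h.tail_le_integral_kernel_mul_psi (R • p)).trans ?_
  refine integral_mono ?_ ?_ fun y => ?_
  · refine h.integrable_kernel_mul (B := psiFactor η)
      (h.psi_antitone.measurable.comp (by fun_prop)) fun y => ?_
    rw [abs_of_nonneg (h.psi_nonneg _)]; exact h.psi_le _
  · exact h.integrable_kernel_mul ((h.measurable_psiDist Ω R).comp (measurable_sub_toTorus x R))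
      fun y => h.abs_psiDist_le Ω R _
  · refine mul_le_mul_of_nonneg_left ?_ (h.kernel_nonneg y)
    have h2 : ‖R • p - y‖ = R * ‖p - R⁻¹ • y‖ := by
      rw [← abs_of_pos hR, ← Real.norm_eq_abs, ← norm_smul, smul_sub, smul_smul, Real.norm_eq_abs,
        abs_of_pos hR, mul_inv_cancel₀ hR.ne', one_smul]
    rw [h2]
    refine h.psi_le_psiDist hR (norm_nonneg _) (distBdry_le_of_mem Ω ?_)
    rwa [sub_sub, ← toTorus_add, add_sub_cancel]

/-- Pointwise comparison of a characteristic function with its smoothing. -/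
theorem IsProfile.abs_indicator_sub_smoothing_le (h : IsProfile η)
    {Ω : Set (UnitAddTorus (Fin d))} {R : ℝ} (hR : 0 < R) {χ : UnitAddTorus (Fin d) → ℝ}
    (hχm : Measurable χ) (hχ0 : ∀ x, 0 ≤ χ x) (hχ1 : ∀ x, χ x ≤ 1)
    (hχ : ∀ x v, ENNReal.ofReal ‖v‖ < distBdry Ω x →
      χ (x - toTorus v) = Ω.indicator (fun _ => (1 : ℝ)) x)
    (x : UnitAddTorus (Fin d)) :
    |Ω.indicator (fun _ => (1 : ℝ)) x - smoothing η R χ x| ≤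
      smoothing η R (psiDist η Ω R) x := by
  set a : ℝ := Ω.indicator (fun _ => (1 : ℝ)) x with ha
  have ha0 : 0 ≤ a := indicator_nonneg (fun _ _ => zero_le_one) _
  have ha1 : a ≤ 1 := indicator_le' (fun _ _ => le_rfl) (fun _ _ => zero_le_one) x
  have hint := h.integrable_kernel_mul (hχm.comp (measurable_sub_toTorus x R)) (B := 1)
    fun y => by simp only [Function.comp]; rw [abs_of_nonneg (hχ0 _)]; exact hχ1 _
  have h1 : a - smoothing η R χ x = ∫ y, kernel η y * (a - χ (x - toTorus (R⁻¹ • y))) := by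
    simp only [Function.comp_def] at hint
    simp_rw [mul_sub]
    rw [integral_sub (h.kernel_integrable.mul_const a) hint, integral_mul_const,
      h.integral_kernel, one_mul, smoothing]
  have hnorm : ∀ y : EuclideanSpace ℝ (Fin d), ‖R⁻¹ • y‖ = R⁻¹ * ‖y‖ := fun y => by
    rw [norm_smul, Real.norm_eq_abs, abs_of_pos (inv_pos.2 hR)]
  by_cases hx : distBdry Ω x = ⊤
  · have h2 : ∀ y, kernel η y * (a - χ (x - toTorus (R⁻¹ • y))) = 0 := fun y => by
      rw [hχ x _ (by rw [hx]; exact ENNReal.ofReal_lt_top), sub_self, mul_zero]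
    rw [h1]
    simp only [h2, integral_zero, abs_zero]
    exact integral_nonneg fun y => mul_nonneg (h.kernel_nonneg y) (h.psiDist_nonneg _ _ _)
  · refine le_trans ?_ (h.tail_le_smoothing hR hx)
    set δ := R * (distBdry Ω x).toReal with hδ
    rw [h1, ← Real.norm_eq_abs, tail, ← integral_indicator (measurableSet_le_norm δ)]
    refine norm_integral_le_of_norm_le
      (h.kernel_integrable.indicator (measurableSet_le_norm δ))
      (Filter.Eventually.of_forall fun y => ?_)
    rw [norm_mul, Real.norm_eq_abs, Real.norm_eq_abs, abs_of_nonneg (h.kernel_nonneg y)]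
    -- Displacements shorter than the distance to the boundary contribute nothing; for the others
    -- the difference is at most 1, which leaves exactly the tail.
    by_cases hy : δ ≤ ‖y‖
    · rw [indicator_of_mem (show y ∈ {x : EuclideanSpace ℝ (Fin d) | δ ≤ ‖x‖} from hy)]
      refine mul_le_of_le_one_right (h.kernel_nonneg y) ?_
      rw [abs_le]
      constructor <;> linarith [hχ0 (x - toTorus (R⁻¹ • y)), hχ1 (x - toTorus (R⁻¹ • y))]
    · rw [hχ x, sub_self, abs_zero, mul_zero]
      · exact indicator_nonneg (fun z _ => h.kernel_nonneg z) y
      · rw [← ENNReal.ofReal_toReal hx]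
        refine (ENNReal.ofReal_lt_ofReal_iff_of_nonneg (norm_nonneg _)).2 ?_
        rw [hnorm, inv_mul_lt_iff₀ hR]
        exact not_le.1 hy

/-- The interior is Borel whatever Ω is, as a convolution evaluated at individual points requires,
and it differs from Ω only on the frontier. -/
theorem indicator_interior_sub_toTorus {Ω : Set (UnitAddTorus (Fin d))}
    (x : UnitAddTorus (Fin d)) (v : EuclideanSpace ℝ (Fin d))
    (hv : ENNReal.ofReal ‖v‖ < distBdry Ω x) :
    (interior Ω).indicator (fun _ => (1 : ℝ)) (x - toTorus v) =
      Ω.indicator (fun _ => (1 : ℝ)) x := by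
  have h1 := sub_toTorus_mem_iff hv
  have h2 : x - toTorus v ∉ frontier Ω := fun hf => (distBdry_le_of_mem Ω hf).not_gt hv
  by_cases hx : x ∈ Ω
  · have h3 : x - toTorus v ∈ interior Ω := by
      by_contra h4
      exact h2 ⟨subset_closure (h1.2 hx), h4⟩
    rw [indicator_of_mem hx, indicator_of_mem h3]
  · rw [indicator_of_notMem hx, indicator_of_notMem fun h4 => hx (h1.1 (interior_subset h4))]

end Smoothing

/-! ### Fourier expansion of smoothed functions -/

section FourierExpansion

variable {d : ℕ} {η : EuclideanSpace ℝ (Fin d) → ℝ}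

instance isProbabilityMeasure_vol : IsProbabilityMeasure (vol d) := by
  unfold vol; infer_instance

instance isAddHaarMeasure_vol : (vol d).IsAddHaarMeasure := by
  unfold vol; infer_instance

/-- An integer frequency as a vector of `ℝ^d`. -/
noncomputable def freqVec (k : Fin d → ℤ) : EuclideanSpace ℝ (Fin d) :=
  WithLp.toLp 2 fun i => (k i : ℝ)

theorem norm_freqVec (k : Fin d → ℤ) : ‖freqVec k‖ = freqNorm k := by
  simp [EuclideanSpace.norm_eq, freqVec, freqNorm]

theorem freqNorm_nonneg (k : Fin d → ℤ) : 0 ≤ freqNorm k := Real.sqrt_nonneg _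

theorem abs_le_freqNorm (k : Fin d → ℤ) (i : Fin d) : |(k i : ℝ)| ≤ freqNorm k := by
  refine Real.abs_le_sqrt ?_
  exact Finset.single_le_sum (f := fun i => (k i : ℝ) ^ 2) (fun j _ => sq_nonneg _)
    (Finset.mem_univ i)

theorem mFourier_toTorus (k : Fin d → ℤ) (v : EuclideanSpace ℝ (Fin d)) :
    UnitAddTorus.mFourier k (toTorus v) =
      Complex.exp (((2 * Real.pi * inner ℝ v (freqVec k) : ℝ) : ℂ) * Complex.I) := by
  simp only [UnitAddTorus.mFourier, ContinuousMap.coe_mk, toTorus, fourier_coe_apply]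
  rw [← Complex.exp_sum]
  congr 1
  simp only [PiLp.inner_apply, freqVec, RCLike.inner_apply, conj_trivial]
  push_cast
  rw [Finset.mul_sum, Finset.sum_mul]
  refine Finset.sum_congr rfl fun i _ => ?_
  ring

theorem mFourier_add_apply (k : Fin d → ℤ) (x y : UnitAddTorus (Fin d)) :
    UnitAddTorus.mFourier k (x + y) = UnitAddTorus.mFourier k x * UnitAddTorus.mFourier k y := by
  simp [UnitAddTorus.mFourier, ← Finset.prod_mul_distrib, fourier_apply, smul_add,
    AddCircle.toCircle_add]

theorem norm_mFourier_apply (k : Fin d → ℤ) (x : UnitAddTorus (Fin d)) :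
    ‖UnitAddTorus.mFourier k x‖ = 1 := by
  simp only [UnitAddTorus.mFourier, ContinuousMap.coe_mk, fourier_apply, norm_prod]
  exact Finset.prod_eq_one fun i _ => Circle.norm_coe _

theorem mFourierCoeff_eq (f : UnitAddTorus (Fin d) → ℂ) (k : Fin d → ℤ) :
    UnitAddTorus.mFourierCoeff f k = ∫ x, UnitAddTorus.mFourier (-k) x * f x ∂(vol d) := rfl

/-- Lifted to ℝ^d and after a change of variables, the base point enters only through the kernel;
the translation bound then supplies an integrable majorant near each point. -/
theorem IsProfile.smoothing_continuous (h : IsProfile η) {f : UnitAddTorus (Fin d) → ℝ}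
    (hf : Measurable f) {B : ℝ} (hB : ∀ x, |f x| ≤ B) {R : ℝ} (hR : 0 < R) :
    Continuous (smoothing η R f) := by
  rw [isOpenQuotientMap_toTorus.isQuotientMap.continuous_iff]
  have hB0 : 0 ≤ B := (abs_nonneg _).trans (hB 0)
  have h1 : smoothing η R f ∘ toTorus =
      fun v => ∫ z, kernel η (R • v - z) * f (toTorus (R⁻¹ • z)) := by
    ext v
    simp only [Function.comp, smoothing]
    rw [← integral_sub_left_eq_self _ volume (R • v)]
    congr 1; ext z
    rw [← toTorus_sub, smul_sub, smul_smul, inv_mul_cancel₀ hR.ne', one_smul, sub_sub_cancel]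
  rw [h1, continuous_iff_continuousAt]
  intro v₀
  have hfm : Measurable fun z : EuclideanSpace ℝ (Fin d) => f (toTorus (R⁻¹ • z)) :=
    hf.comp (continuous_toTorus.comp (continuous_const_smul _)).measurable
  refine continuousAt_of_dominated
    (bound := fun z => Real.exp (2 * Real.pi * R) * kernel η (R • v₀ - z) * B) ?_ ?_ ?_ ?_
  · refine Filter.Eventually.of_forall fun v => ?_
    exact ((h.kernel_continuous.comp (by fun_prop)).measurable.mul hfm).aestronglyMeasurable
  · filter_upwards [Metric.ball_mem_nhds v₀ one_pos] with v hv
    refine Filter.Eventually.of_forall fun z => ?_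
    rw [norm_mul, Real.norm_eq_abs, Real.norm_eq_abs, abs_of_nonneg (h.kernel_nonneg _)]
    refine mul_le_mul ?_ (hB _) (abs_nonneg _)
      (mul_nonneg (Real.exp_pos _).le (h.kernel_nonneg _))
    have h2 := h.kernel_add_le (R • v₀ - z) (R • (v - v₀))
    rw [show R • v₀ - z + R • (v - v₀) = R • v - z by rw [smul_sub]; abel] at h2
    refine h2.trans (mul_le_mul_of_nonneg_right (Real.exp_le_exp.2 ?_) (h.kernel_nonneg _))
    refine mul_le_mul_of_nonneg_left ?_ (by positivity)
    rw [norm_smul, Real.norm_eq_abs, abs_of_pos hR]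
    rw [Metric.mem_ball, dist_eq_norm] at hv
    nlinarith
  · exact (((h.kernel_integrable.comp_sub_left (R • v₀)).const_mul _).mul_const B)
  · refine Filter.Eventually.of_forall fun z => ?_
    exact ((h.kernel_continuous.comp (by fun_prop)).mul continuous_const).continuousAt

theorem integral_integral_swap_of_bounded {X Y : Type*} [MeasurableSpace X] [MeasurableSpace Y]
    {μ : Measure X} {ν : Measure Y} [IsFiniteMeasure μ] [SFinite ν] {k : Y → ℂ}
    (hk : Integrable k ν) {g : X → Y → ℂ} (hg : Measurable (Function.uncurry g)) {B : ℝ}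
    (hB : ∀ x y, ‖g x y‖ ≤ B) :
    ∫ x, ∫ y, k y * g x y ∂ν ∂μ = ∫ y, ∫ x, k y * g x y ∂μ ∂ν := by
  refine integral_integral_swap (f := fun x y => k y * g x y) ?_
  have h1 : Integrable (fun p : X × Y => (1 : ℂ) * k p.2) (μ.prod ν) :=
    (integrable_const (1 : ℂ)).mul_prod hk
  simp only [one_mul] at h1
  exact h1.mul_bdd (c := B) hg.aestronglyMeasurable (Filter.Eventually.of_forall fun p => hB _ _)

theorem IsProfile.mFourierCoeff_smoothing (h : IsProfile η) {f : UnitAddTorus (Fin d) → ℝ}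
    (hf : Measurable f) {B : ℝ} (hB : ∀ x, |f x| ≤ B) (R : ℝ) (k : Fin d → ℤ) :
    UnitAddTorus.mFourierCoeff (fun x => (smoothing η R f x : ℂ)) k =
      (kernelHat η (R⁻¹ • freqVec k) : ℂ) * UnitAddTorus.mFourierCoeff (fun x => (f x : ℂ)) k := by
  have hmeas : Measurable fun p : UnitAddTorus (Fin d) × EuclideanSpace ℝ (Fin d) =>
      f (p.1 - toTorus (R⁻¹ • p.2)) := by
    have h1 : Measurable (toTorus (d := d)) := continuous_toTorus.measurable
    fun_prop
  have hmeas' : Measurable fun p : UnitAddTorus (Fin d) × EuclideanSpace ℝ (Fin d) =>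
      UnitAddTorus.mFourier (-k) p.1 := by
    have h1 : Measurable (UnitAddTorus.mFourier (-k)) :=
      (UnitAddTorus.mFourier (-k)).continuous.measurable
    fun_prop
  have swap := integral_integral_swap_of_bounded (μ := vol d) (ν := volume)
    (k := fun y => (kernel η y : ℂ)) h.kernel_integrable.ofReal
    (g := fun x y => UnitAddTorus.mFourier (-k) x * (f (x - toTorus (R⁻¹ • y)) : ℂ))
    (hmeas'.mul (Complex.measurable_ofReal.comp hmeas)) (B := B) (fun x y => by
        rw [norm_mul, norm_mFourier_apply, one_mul, Complex.norm_real]; exact hB _)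
  have e1 : ∀ x, ∫ y, (kernel η y : ℂ) * (UnitAddTorus.mFourier (-k) x *
      (f (x - toTorus (R⁻¹ • y)) : ℂ)) =
      UnitAddTorus.mFourier (-k) x * (smoothing η R f x : ℂ) := by
    intro x
    rw [smoothing, ← integral_complex_ofReal, ← integral_const_mul]
    congr 1
    ext y
    push_cast
    ring
  have e2 : ∀ y, ∫ x, (kernel η y : ℂ) * (UnitAddTorus.mFourier (-k) x *
      (f (x - toTorus (R⁻¹ • y)) : ℂ)) ∂(vol d) =
      (Complex.exp (↑(-2 * Real.pi * inner ℝ y (R⁻¹ • freqVec k)) * Complex.I) •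
        (kernel η y : ℂ)) * UnitAddTorus.mFourierCoeff (fun x => (f x : ℂ)) k := by
    intro y
    rw [← integral_add_right_eq_self _ (toTorus (R⁻¹ • y)), mFourierCoeff_eq, ← integral_const_mul]
    congr 1
    ext x
    have h1 : inner ℝ (R⁻¹ • y) (freqVec (-k)) = -inner ℝ y (R⁻¹ • freqVec k) := by
      rw [real_inner_smul_left, real_inner_smul_right, ← mul_neg, ← inner_neg_right]
      congr 2
      ext i; simp [freqVec]
    rw [add_sub_cancel_right, mFourier_add_apply, mFourier_toTorus, smul_eq_mul, h1,
      show (2 * Real.pi * -inner ℝ y (R⁻¹ • freqVec k) : ℝ) =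
        -2 * Real.pi * inner ℝ y (R⁻¹ • freqVec k) by ring]
    ring
  simp_rw [e1, e2] at swap
  rw [mFourierCoeff_eq, swap, integral_mul_const, ← h.fourier_kernel, Real.fourier_eq']

/-- The integer frequencies of length less than `R`. -/
noncomputable def freqBall (d : ℕ) (R : ℝ) : Finset (Fin d → ℤ) :=
  {k ∈ Fintype.piFinset fun _ : Fin d => Finset.Icc (-⌈R⌉) ⌈R⌉ | freqNorm k < R}

theorem mem_freqBall {R : ℝ} {k : Fin d → ℤ} : k ∈ freqBall d R ↔ freqNorm k < R := by
  simp only [freqBall, Finset.mem_filter, Fintype.mem_piFinset, Finset.mem_Icc, and_iff_right_iff_imp]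
  intro hk i
  have h1 := (abs_le_freqNorm k i).trans hk.le
  have h2 := (abs_le.1 (h1.trans (Int.le_ceil R)))
  exact ⟨by exact_mod_cast h2.1, by exact_mod_cast h2.2⟩

theorem IsProfile.kernelHat_smul_freqVec (h : IsProfile η) {R : ℝ} (hR : 0 < R) {k : Fin d → ℤ}
    (hk : R ≤ freqNorm k) : kernelHat η (R⁻¹ • freqVec k) = 0 := by
  refine h.kernelHat_eq_zero ?_
  rw [norm_smul, norm_freqVec, Real.norm_eq_abs, abs_of_pos (inv_pos.2 hR), inv_mul_eq_div,
    one_le_div hR]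
  exact hk

/-- The smoothing of a bounded function is a trigonometric polynomial. -/
theorem IsProfile.smoothing_eq_sum (h : IsProfile η) {f : UnitAddTorus (Fin d) → ℝ}
    (hf : Measurable f) {B : ℝ} (hB : ∀ x, |f x| ≤ B) {R : ℝ} (hR : 0 < R)
    (x : UnitAddTorus (Fin d)) :
    (smoothing η R f x : ℂ) = ∑ k ∈ freqBall d R, (kernelHat η (R⁻¹ • freqVec k) : ℂ) *
      UnitAddTorus.mFourierCoeff (fun x => (f x : ℂ)) k * UnitAddTorus.mFourier k x := by
  let G : C(UnitAddTorus (Fin d), ℂ) :=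
    ⟨fun x => (smoothing η R f x : ℂ), Complex.continuous_ofReal.comp (h.smoothing_continuous hf hB hR)⟩
  have hG : ∀ k, UnitAddTorus.mFourierCoeff G k = (kernelHat η (R⁻¹ • freqVec k) : ℂ) *
      UnitAddTorus.mFourierCoeff (fun x => (f x : ℂ)) k := h.mFourierCoeff_smoothing hf hB R
  have h0 : ∀ k ∉ freqBall d R, UnitAddTorus.mFourierCoeff G k = 0 := by
    intro k hk
    rw [mem_freqBall, not_lt] at hk
    rw [hG, h.kernelHat_smul_freqVec hR hk, Complex.ofReal_zero, zero_mul]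
  -- Continuity and finitely many nonzero coefficients give the expansion at every point, not just
  -- almost everywhere; lattice points form a null set when d ≥ 1.
  have h1 := UnitAddTorus.hasSum_mFourier_series_apply_of_summable
    (summable_of_ne_finset_zero h0) x
  have h2 := h1.unique (hasSum_sum_of_ne_finset_zero (s := freqBall d R) fun k hk => by
    rw [h0 k hk, zero_smul])
  change (smoothing η R f x : ℂ) = _ at h2
  rw [h2]
  exact Finset.sum_congr rfl fun k _ => by rw [hG, smul_eq_mul]

end FourierExpansion

/-! ### Lattice averages and the discrepancy inequality -/

section Lattice

variable {d : ℕ} {η : EuclideanSpace ℝ (Fin d) → ℝ}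

/-- A full geometric sum of powers of an n-th root of unity other than 1. -/
theorem sum_fourier_div_eq_zero {n : ℕ} (hn : 0 < n) {k : ℤ} (hk : ¬(n : ℤ) ∣ k) :
    ∑ a : Fin n, fourier k (((((a : ℕ) : ℝ) / (n : ℝ) : ℝ)) : UnitAddCircle) = 0 := by
  have hn0 : (n : ℂ) ≠ 0 := by exact_mod_cast hn.ne'
  set w : ℂ := Complex.exp (2 * Real.pi * Complex.I * k / n) with hw
  have h1 : ∀ a : Fin n, fourier k (((((a : ℕ) : ℝ) / (n : ℝ) : ℝ)) : UnitAddCircle) =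
      w ^ (a : ℕ) := by
    intro a
    rw [fourier_coe_apply, hw, ← Complex.exp_nat_mul]
    congr 1
    push_cast
    field_simp
  have hw1 : w ≠ 1 := by
    intro h
    rw [hw, Complex.exp_eq_one_iff] at h
    obtain ⟨j, hj⟩ := h
    apply hk
    refine ⟨j, ?_⟩
    have h2 : (2 * Real.pi * Complex.I : ℂ) ≠ 0 := Complex.two_pi_I_ne_zero
    have h3 : (k : ℂ) = n * j := by
      field_simp at hj
      linear_combination hj
    exact_mod_cast h3
  have hwn : w ^ n = 1 := by
    rw [hw, ← Complex.exp_nat_mul, Complex.exp_eq_one_iff]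
    exact ⟨k, by field_simp⟩
  simp_rw [h1]
  rw [Fin.sum_univ_eq_sum_range (fun a => w ^ a), geom_sum_eq hw1, hwn, sub_self, zero_div]

theorem sum_mFourier_latticePoint_eq_zero {n : ℕ} (hn : 0 < n) {k : Fin d → ℤ} {i : Fin d}
    (hk : ¬(n : ℤ) ∣ k i) :
    ∑ g : Fin d → Fin n, UnitAddTorus.mFourier k (latticePoint g) = 0 := by
  simp only [UnitAddTorus.mFourier, ContinuousMap.coe_mk, latticePoint]
  rw [← Fintype.prod_sum fun (i : Fin d) (a : Fin n) =>
    fourier (k i) (((((a : ℕ) : ℝ) / (n : ℝ) : ℝ)) : UnitAddCircle)]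
  exact Finset.prod_eq_zero (Finset.mem_univ i) (sum_fourier_div_eq_zero hn hk)

/-- The nonzero frequencies in `n ℤ^d` of length less than `R`. -/
noncomputable def dualFreq (d n : ℕ) (R : ℝ) : Finset (Fin d → ℤ) :=
  {k ∈ freqBall d R | k ≠ 0 ∧ ∀ i, (n : ℤ) ∣ k i}

theorem mFourierCoeff_zero (f : UnitAddTorus (Fin d) → ℝ) :
    UnitAddTorus.mFourierCoeff (fun x => (f x : ℂ)) 0 = ((∫ x, f x ∂(vol d) : ℝ) : ℂ) := by
  rw [mFourierCoeff_eq, ← integral_complex_ofReal]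
  congr 1
  ext x
  rw [neg_zero, UnitAddTorus.mFourier_zero, ContinuousMap.one_apply, one_mul]

theorem freqNorm_zero : freqNorm (0 : Fin d → ℤ) = 0 := by simp [freqNorm]

/-- Lattice averages of a smoothed function are close to its mean. -/
theorem IsProfile.abs_average_smoothing_sub_le (h : IsProfile η) {f : UnitAddTorus (Fin d) → ℝ}
    (hf : Measurable f) {B : ℝ} (hB : ∀ x, |f x| ≤ B) {R : ℝ} (hR : 0 < R) {n : ℕ} (hn : 0 < n) :
    |((n ^ d : ℕ) : ℝ)⁻¹ * ∑ g : Fin d → Fin n, smoothing η R f (latticePoint g) -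
        ∫ x, f x ∂(vol d)| ≤
      ∑ k ∈ dualFreq d n R, ‖UnitAddTorus.mFourierCoeff (fun x => (f x : ℂ)) k‖ := by
  have hcard : Fintype.card (Fin d → Fin n) = n ^ d := by simp
  have hnd : ((n ^ d : ℕ) : ℝ) ≠ 0 := by positivity
  have hndc : ((n ^ d : ℕ) : ℂ) ≠ 0 := by exact_mod_cast hnd
  set A : (Fin d → ℤ) → ℂ := fun k =>
    ((n ^ d : ℕ) : ℂ)⁻¹ * ∑ g : Fin d → Fin n, UnitAddTorus.mFourier k (latticePoint g) with hA
  have hA0 : A 0 = 1 := by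
    simp only [hA, UnitAddTorus.mFourier_zero, ContinuousMap.one_apply, Finset.sum_const,
      Finset.card_univ, hcard, nsmul_eq_mul, mul_one]
    exact inv_mul_cancel₀ hndc
  have hA1 : ∀ k, ‖A k‖ ≤ 1 := by
    intro k
    rw [hA, norm_mul, norm_inv, Complex.norm_natCast, inv_mul_le_one₀ (by positivity)]
    refine (norm_sum_le _ _).trans ?_
    simp [norm_mFourier_apply, hcard]
  set c : (Fin d → ℤ) → ℂ := fun k => (kernelHat η (R⁻¹ • freqVec k) : ℂ) *
    UnitAddTorus.mFourierCoeff (fun x => (f x : ℂ)) k with hc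
  have h1 : ((((n ^ d : ℕ) : ℝ)⁻¹ * ∑ g : Fin d → Fin n, smoothing η R f (latticePoint g) : ℝ) : ℂ)
      = ∑ k ∈ freqBall d R, c k * A k := by
    push_cast
    simp_rw [h.smoothing_eq_sum hf hB hR]
    rw [Finset.sum_comm, Finset.mul_sum]
    refine Finset.sum_congr rfl fun k _ => ?_
    rw [hA, ← Finset.mul_sum]
    push_cast
    ring
  have h0mem : (0 : Fin d → ℤ) ∈ freqBall d R := by rw [mem_freqBall, freqNorm_zero]; exact hR
  have hc0 : c 0 * A 0 = ((∫ x, f x ∂(vol d) : ℝ) : ℂ) := by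
    have : freqVec (0 : Fin d → ℤ) = 0 := by ext i; simp [freqVec]
    rw [hA0, mul_one, hc]
    simp only [this, smul_zero, h.kernelHat_zero, Complex.ofReal_one, one_mul, mFourierCoeff_zero]
  rw [← Real.norm_eq_abs, ← Complex.norm_real, Complex.ofReal_sub, h1,
    ← Finset.add_sum_erase _ _ h0mem, hc0, add_sub_cancel_left]
  refine (norm_sum_le _ _).trans ?_
  rw [dualFreq]
  -- The lattice average of a character vanishes unless n divides every coordinate of its frequency.
  have h2 : ∀ k ∈ (freqBall d R).erase 0,
      k ∉ ({k ∈ freqBall d R | k ≠ 0 ∧ ∀ i, (n : ℤ) ∣ k i} : Finset (Fin d → ℤ)) →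
        ‖c k * A k‖ = 0 := by
    intro k hk hk'
    rw [Finset.mem_erase] at hk
    rw [Finset.mem_filter] at hk'
    push Not at hk'
    obtain ⟨i, hi⟩ := hk' hk.2 hk.1
    simp only [hA, sum_mFourier_latticePoint_eq_zero hn hi, mul_zero, norm_zero]
  rw [← Finset.sum_subset (fun k hk => ?_) h2]
  · refine Finset.sum_le_sum fun k _ => ?_
    rw [norm_mul]
    refine (mul_le_of_le_one_right (norm_nonneg _) (hA1 k)).trans ?_
    rw [hc, norm_mul, Complex.norm_real, Real.norm_eq_abs]
    exact mul_le_of_le_one_left (norm_nonneg _) (h.abs_kernelHat_le _)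
  · rw [Finset.mem_filter] at hk
    exact Finset.mem_erase.2 ⟨hk.2.1, hk.1⟩

theorem indicator_interior_ae_eq {Ω : Set (UnitAddTorus (Fin d))}
    (hΩ : vol d (frontier Ω) = 0) : interior Ω =ᵐ[vol d] Ω := by
  have h1 : ∀ᵐ x ∂(vol d), x ∉ frontier Ω := measure_eq_zero_iff_ae_notMem.1 hΩ
  filter_upwards [h1] with x hx
  refine propext ⟨fun h => interior_subset h, fun h => ?_⟩
  by_contra h2
  exact hx ⟨subset_closure h, h2⟩

/-- The discrepancy is controlled by the Fourier coefficients of `χ_Ω` and of `psiDist` along the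
dual lattice. -/
theorem IsProfile.latticeDiscrepancy_le_sum (h : IsProfile η) {Ω : Set (UnitAddTorus (Fin d))}
    (hΩ : vol d (frontier Ω) = 0) {R : ℝ} (hR : 0 < R) {n : ℕ} (hn : 0 < n) :
    latticeDiscrepancy d n Ω ≤
      ‖UnitAddTorus.mFourierCoeff (fun x => (psiDist η Ω R x : ℂ)) 0‖ +
      ∑ k ∈ dualFreq d n R, (‖UnitAddTorus.mFourierCoeff (Ω.indicator fun _ => (1 : ℂ)) k‖ +
        ‖UnitAddTorus.mFourierCoeff (fun x => (psiDist η Ω R x : ℂ)) k‖) := by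
  set χ : UnitAddTorus (Fin d) → ℝ := (interior Ω).indicator fun _ => (1 : ℝ) with hχ
  have hχm : Measurable χ := measurable_const.indicator isOpen_interior.measurableSet
  have hχ0 : ∀ x, 0 ≤ χ x := fun x => indicator_nonneg (fun _ _ => zero_le_one) x
  have hχ1 : ∀ x, χ x ≤ 1 := fun x => indicator_le' (fun _ _ => le_rfl) (fun _ _ => zero_le_one) x
  have hχB : ∀ x, |χ x| ≤ 1 := fun x => by rw [abs_of_nonneg (hχ0 x)]; exact hχ1 x
  have hae := indicator_interior_ae_eq hΩ
  have hcoef : ∀ k, UnitAddTorus.mFourierCoeff (fun x => (χ x : ℂ)) k =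
      UnitAddTorus.mFourierCoeff (Ω.indicator fun _ => (1 : ℂ)) k := by
    intro k
    rw [mFourierCoeff_eq, mFourierCoeff_eq]
    refine integral_congr_ae ?_
    filter_upwards [hae] with x hx
    have hx' : x ∈ interior Ω ↔ x ∈ Ω := iff_of_eq hx
    by_cases h1 : x ∈ Ω
    · simp [hχ, h1, hx'.2 h1]
    · simp [hχ, h1, mt hx'.1 h1]
  have hint : ∫ x, χ x ∂(vol d) = (vol d).real Ω := by
    rw [hχ, integral_indicator isOpen_interior.measurableSet, setIntegral_const, smul_eq_mul,
      mul_one, measureReal_congr hae]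
  have hA := h.abs_average_smoothing_sub_le hχm hχB hR hn
  have hH := h.abs_average_smoothing_sub_le (h.measurable_psiDist Ω R) (h.abs_psiDist_le Ω R) hR hn
  simp_rw [hcoef] at hA
  rw [hint] at hA
  -- The majorant is used at the lattice points, with the indicator of Ω itself outside the
  -- convolution and that of the interior inside. Null frontier makes the coefficients of the two
  -- agree.
  have hpt : ∀ g : Fin d → Fin n, |Ω.indicator (fun _ => (1 : ℝ)) (latticePoint g) -
      smoothing η R χ (latticePoint g)| ≤ smoothing η R (psiDist η Ω R) (latticePoint g) :=
    fun g => h.abs_indicator_sub_smoothing_le hR hχm hχ0 hχ1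
      (fun x v hv => indicator_interior_sub_toTorus x v hv) _
  have havg : |((n ^ d : ℕ) : ℝ)⁻¹ * ∑ g : Fin d → Fin n, smoothing η R χ (latticePoint g) -
      ((n ^ d : ℕ) : ℝ)⁻¹ * ∑ g : Fin d → Fin n, Ω.indicator (fun _ => (1 : ℝ)) (latticePoint g)| ≤
      ((n ^ d : ℕ) : ℝ)⁻¹ * ∑ g : Fin d → Fin n,
        smoothing η R (psiDist η Ω R) (latticePoint g) := by
    rw [← mul_sub, ← Finset.sum_sub_distrib, abs_mul, abs_of_nonneg (by positivity)]
    refine mul_le_mul_of_nonneg_left ((Finset.abs_sum_le_sum_abs _ _).trans ?_) (by positivity)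
    refine Finset.sum_le_sum fun g _ => ?_
    rw [abs_sub_comm]; exact hpt g
  rw [mFourierCoeff_zero, Complex.norm_real, Real.norm_eq_abs,
    abs_of_nonneg (integral_nonneg (h.psiDist_nonneg Ω R)), Finset.sum_add_distrib,
    latticeDiscrepancy]
  rw [abs_le] at *
  constructor <;> linarith [hA.1, hA.2, hH.1, hH.2, havg.1, havg.2]

end Lattice

/-! ### Power sums over the dual lattice -/

section LatticeSum

/-- The sum is compared with an integral by induction; the increment is Bernoulli's inequality for
the concave power 1 - σ. -/
theorem sum_Icc_rpow_neg_le {σ : ℝ} (h0 : 0 ≤ σ) (h1 : σ < 1) (M : ℕ) :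
    ∑ a ∈ Finset.Icc 1 M, (a : ℝ) ^ (-σ) ≤ (M : ℝ) ^ (1 - σ) / (1 - σ) := by
  have hσ : 0 < 1 - σ := by linarith
  induction M with
  | zero => simp [Real.zero_rpow hσ.ne']
  | succ M ih =>
    rw [Finset.sum_Icc_succ_top (by omega)]
    have hM : (0 : ℝ) < (M : ℝ) + 1 := by positivity
    have h2 : (1 + -(1 / ((M : ℝ) + 1))) ^ (1 - σ) ≤ 1 + (1 - σ) * -(1 / ((M : ℝ) + 1)) := by
      refine rpow_one_add_le_one_add_mul_self ?_ hσ.le (by linarith)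
      rw [neg_le_neg_iff, div_le_one hM]; linarith [Nat.cast_nonneg (α := ℝ) M]
    have h3 : (1 + -(1 / ((M : ℝ) + 1))) = (M : ℝ) / (M + 1) := by field_simp; ring
    rw [h3, Real.div_rpow (Nat.cast_nonneg _) hM.le, div_le_iff₀ (by positivity)] at h2
    have h4 : ((M : ℝ) + 1) ^ (1 - σ) = (M + 1) * ((M : ℝ) + 1) ^ (-σ) := by
      rw [sub_eq_add_neg, Real.rpow_add hM, Real.rpow_one]
    push_cast
    rw [le_div_iff₀ hσ] at ih ⊢
    rw [h4] at h2 ⊢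
    have h5 : (1 + (1 - σ) * -(1 / ((M : ℝ) + 1))) * ((M + 1) * ((M : ℝ) + 1) ^ (-σ)) =
        (M + 1) * ((M : ℝ) + 1) ^ (-σ) - (1 - σ) * ((M : ℝ) + 1) ^ (-σ) := by
      field_simp
      ring
    rw [h5] at h2
    linarith

variable {d : ℕ}

/-- The sup norm of an integer frequency. -/
def freqSup (k : Fin d → ℤ) : ℕ := Finset.univ.sup fun i => (k i).natAbs

theorem freqSup_le_freqNorm (k : Fin d → ℤ) : (freqSup k : ℝ) ≤ freqNorm k := by
  rcases isEmpty_or_nonempty (Fin d) with hd | hd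
  · simp [freqSup, freqNorm]
  · obtain ⟨i, -, hi⟩ := Finset.exists_mem_eq_sup (Finset.univ : Finset (Fin d))
      Finset.univ_nonempty fun i => (k i).natAbs
    rw [freqSup, hi]
    have := abs_le_freqNorm k i
    rwa [← Int.cast_abs, Int.abs_eq_natAbs, Int.cast_natCast] at this

theorem natAbs_le_freqSup (k : Fin d → ℤ) (i : Fin d) : (k i).natAbs ≤ freqSup k :=
  Finset.le_sup (f := fun i => (k i).natAbs) (Finset.mem_univ i)

theorem one_le_freqSup {k : Fin d → ℤ} (hk : k ≠ 0) : 1 ≤ freqSup k := by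
  obtain ⟨i, hi⟩ := Function.ne_iff.1 hk
  exact (Nat.one_le_iff_ne_zero.2 (Int.natAbs_ne_zero.2 hi)).trans (natAbs_le_freqSup k i)

/-- The shell is a difference of cubes with (2a+1)^d - (2a-1)^d points. Bernoulli bounds this by
2d(2a+1)^{d-1}, and 2a+1 ≤ 3a. -/
theorem card_freqSup_eq_le (hd : 0 < d) (S : Finset (Fin d → ℤ)) {a : ℕ} (ha : 1 ≤ a) :
    (({k ∈ S | freqSup k = a} : Finset (Fin d → ℤ)).card : ℝ) ≤
      2 * d * 3 ^ (d - 1) * (a : ℝ) ^ ((d : ℝ) - 1) := by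
  set box : ℕ → Finset (Fin d → ℤ) := fun b =>
    Fintype.piFinset fun _ => Finset.Icc (-(b : ℤ)) b with hbox
  have hcard : ∀ b : ℕ, (box b).card = (2 * b + 1) ^ d := by
    intro b
    simp only [hbox, Fintype.card_piFinset, Int.card_Icc, Finset.prod_const, Finset.card_univ,
      Fintype.card_fin]
    congr 1; omega
  have hsub : ({k ∈ S | freqSup k = a} : Finset (Fin d → ℤ)) ⊆ box a \ box (a - 1) := by
    intro k hk
    rw [Finset.mem_filter] at hk
    simp only [hbox, Finset.mem_sdiff, Fintype.mem_piFinset, Finset.mem_Icc]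
    refine ⟨fun i => ?_, fun hcon => ?_⟩
    · have := natAbs_le_freqSup k i
      omega
    · have : freqSup k ≤ a - 1 := Finset.sup_le fun i _ => by
        have := hcon i
        omega
      omega
  have hss : box (a - 1) ⊆ box a := by
    intro k hk
    simp only [hbox, Fintype.mem_piFinset, Finset.mem_Icc] at hk ⊢
    intro i
    have := hk i
    omega
  have h1 := Finset.card_le_card hsub
  rw [Finset.card_sdiff_of_subset hss, hcard, hcard] at h1
  have h2 : (({k ∈ S | freqSup k = a} : Finset (Fin d → ℤ)).card : ℝ) ≤
      (2 * a + 1 : ℝ) ^ d - (2 * a - 1 : ℝ) ^ d := by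
    have h3 : (2 * (a - 1) + 1) ^ d ≤ (2 * a + 1) ^ d := Nat.pow_le_pow_left (by omega) d
    have h4 : ((((2 * a + 1) ^ d - (2 * (a - 1) + 1) ^ d : ℕ)) : ℝ) =
        (2 * a + 1 : ℝ) ^ d - (2 * a - 1 : ℝ) ^ d := by
      rw [Nat.cast_sub h3]
      push_cast [Nat.cast_sub ha]
      congr 2; ring
    rw [← h4]
    exact_mod_cast h1
  refine h2.trans ?_
  have ha' : (1 : ℝ) ≤ a := by exact_mod_cast ha
  set x : ℝ := 2 * a + 1 with hx
  have hx0 : 0 < x := by positivity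
  have h5 : 1 + (d : ℝ) * (-(2 / x)) ≤ (1 + -(2 / x)) ^ d := by
    refine one_add_mul_le_pow ?_ d
    rw [neg_le_neg_iff, div_le_iff₀ hx0]; linarith
  have h6 : (1 + -(2 / x)) = (2 * a - 1) / x := by
    field_simp; rw [hx]; ring
  rw [h6, div_pow, le_div_iff₀ (by positivity)] at h5
  obtain ⟨e, rfl⟩ : ∃ e, d = e + 1 := ⟨d - 1, by omega⟩
  have h7 : (1 + ((e + 1 : ℕ) : ℝ) * -(2 / x)) * x ^ (e + 1) =
      x ^ (e + 1) - 2 * ((e + 1 : ℕ) : ℝ) * x ^ e := by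
    field_simp; ring
  rw [h7] at h5
  have h8 : x ^ e ≤ 3 ^ e * (a : ℝ) ^ e := by
    rw [← mul_pow]; exact pow_le_pow_left₀ hx0.le (by rw [hx]; linarith) e
  have h9 : (a : ℝ) ^ (((e + 1 : ℕ) : ℝ) - 1) = (a : ℝ) ^ e := by
    rw [← Real.rpow_natCast]; congr 1; push_cast; ring
  rw [h9, add_tsub_cancel_right]
  have h10 : 2 * ((e + 1 : ℕ) : ℝ) * x ^ e ≤ 2 * ((e + 1 : ℕ) : ℝ) * (3 ^ e * (a : ℝ) ^ e) :=
    mul_le_mul_of_nonneg_left h8 (by positivity)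
  linarith

/-- Shell by shell the sum is of a^{d-1-α} over a ≤ T. Splitting off a^{-σ} leaves a nonnegative
power of a, which is bounded by the same power of T. The constant depends on σ but not on α, whence
uniformity in α when one σ serves all. -/
theorem sum_freqNorm_rpow_le (hd : 0 < d) {α σ : ℝ} (hα : 0 ≤ α) (hσ0 : 0 ≤ σ) (hσ1 : σ < 1)
    (hασ : 0 ≤ d - 1 - α + σ) {T : ℝ} (hT : 0 < T) :
    ∑ k ∈ (freqBall d T).erase 0, freqNorm k ^ (-α) ≤
      2 * d * 3 ^ (d - 1) / (1 - σ) * T ^ (d - α) := by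
  have hσ : 0 < 1 - σ := by linarith
  calc ∑ k ∈ (freqBall d T).erase 0, freqNorm k ^ (-α)
      ≤ ∑ k ∈ (freqBall d T).erase 0, (freqSup k : ℝ) ^ (-α) := by
        refine Finset.sum_le_sum fun k hk => ?_
        rw [Finset.mem_erase] at hk
        have h1 : 0 < (freqSup k : ℝ) := by exact_mod_cast one_le_freqSup hk.1
        exact Real.rpow_le_rpow_of_nonpos h1 (freqSup_le_freqNorm k) (by linarith)
    _ = ∑ a ∈ Finset.Icc 1 ⌊T⌋₊, ∑ k ∈ ((freqBall d T).erase 0).filter (fun k => freqSup k = a),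
          (freqSup k : ℝ) ^ (-α) := by
        refine (Finset.sum_fiberwise_of_maps_to (fun k hk => ?_) _).symm
        rw [Finset.mem_erase, mem_freqBall] at hk
        rw [Finset.mem_Icc]
        exact ⟨one_le_freqSup hk.1, Nat.le_floor ((freqSup_le_freqNorm k).trans hk.2.le)⟩
    _ ≤ ∑ a ∈ Finset.Icc 1 ⌊T⌋₊, 2 * d * 3 ^ (d - 1) * T ^ (d - 1 - α + σ) * (a : ℝ) ^ (-σ) := by
        refine Finset.sum_le_sum fun a ha => ?_
        rw [Finset.mem_Icc] at ha
        have ha0 : (0 : ℝ) < a := by exact_mod_cast ha.1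
        have haT : (a : ℝ) ≤ T := (Nat.le_floor_iff hT.le).1 ha.2
        have h1 : ∑ k ∈ ((freqBall d T).erase 0).filter (fun k => freqSup k = a), (freqSup k : ℝ) ^ (-α) =
            ((((freqBall d T).erase 0).filter (fun k => freqSup k = a) : Finset (Fin d → ℤ)).card : ℝ) *
              (a : ℝ) ^ (-α) := by
          rw [Finset.sum_congr rfl (g := fun _ => (a : ℝ) ^ (-α)), Finset.sum_const, nsmul_eq_mul]
          intro k hk
          rw [(Finset.mem_filter.1 hk).2]
        rw [h1]
        refine (mul_le_mul_of_nonneg_right (card_freqSup_eq_le hd _ ha.1) (by positivity)).trans ?_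
        have h2 : (a : ℝ) ^ ((d : ℝ) - 1) * (a : ℝ) ^ (-α) =
            (a : ℝ) ^ (d - 1 - α + σ) * (a : ℝ) ^ (-σ) := by
          rw [← Real.rpow_add ha0, ← Real.rpow_add ha0]; congr 1; ring
        rw [mul_assoc _ ((a : ℝ) ^ ((d : ℝ) - 1)), h2, mul_assoc _ (T ^ (d - 1 - α + σ))]
        have h3 := mul_le_mul_of_nonneg_right (Real.rpow_le_rpow ha0.le haT hασ)
          (Real.rpow_nonneg ha0.le (-σ))
        exact mul_le_mul_of_nonneg_left h3 (by positivity)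
    _ ≤ 2 * d * 3 ^ (d - 1) * T ^ (d - 1 - α + σ) * (T ^ (1 - σ) / (1 - σ)) := by
        rw [← Finset.mul_sum]
        refine mul_le_mul_of_nonneg_left ((sum_Icc_rpow_neg_le hσ0 hσ1 _).trans ?_) (by positivity)
        have := Real.rpow_le_rpow (Nat.cast_nonneg _) (Nat.floor_le hT.le) hσ.le
        gcongr
    _ = _ := by
        have : T ^ ((d : ℝ) - α) = T ^ (d - 1 - α + σ) * T ^ (1 - σ) := by
          rw [← Real.rpow_add hT]; congr 1; ring
        rw [this]; ring

theorem freqNorm_smul (n : ℕ) (j : Fin d → ℤ) :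
    freqNorm (fun i => (n : ℤ) * j i) = n * freqNorm j := by
  simp only [freqNorm]
  push_cast
  simp_rw [mul_pow]
  rw [← Finset.mul_sum, Real.sqrt_mul (by positivity), Real.sqrt_sq (by positivity)]

/-- Substituting k = nj reduces to radius R/n, and n^{-α}(R/n)^{d-α} = R^{d-α}/n^d. -/
theorem sum_dualFreq_le (hd : 0 < d) {α σ : ℝ} (hα : 0 ≤ α) (hσ0 : 0 ≤ σ) (hσ1 : σ < 1)
    (hασ : 0 ≤ d - 1 - α + σ) {R : ℝ} (hR : 0 < R) {n : ℕ} (hn : 0 < n) :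
    ∑ k ∈ dualFreq d n R, freqNorm k ^ (-α) ≤
      2 * d * 3 ^ (d - 1) / (1 - σ) * (R ^ (d - α) / ((n ^ d : ℕ) : ℝ)) := by
  have hn0 : (0 : ℝ) < n := by exact_mod_cast hn
  have himg : dualFreq d n R ⊆ ((freqBall d (R / n)).erase 0).image
      (fun (j : Fin d → ℤ) (i : Fin d) => (n : ℤ) * j i) := by
    intro k hk
    rw [dualFreq, Finset.mem_filter, mem_freqBall] at hk
    obtain ⟨hkR, hk0, hdiv⟩ := hk
    choose j hj using hdiv
    have hkj : k = fun i => (n : ℤ) * j i := funext hj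
    rw [Finset.mem_image]
    refine ⟨j, ?_, hkj.symm⟩
    rw [Finset.mem_erase, mem_freqBall]
    constructor
    · rintro rfl
      exact hk0 (by rw [hkj]; ext i; simp)
    · rw [hkj, freqNorm_smul] at hkR
      rw [lt_div_iff₀ hn0, mul_comm]; exact hkR
  have hinj : Set.InjOn (fun (j : Fin d → ℤ) (i : Fin d) => (n : ℤ) * j i)
      ((freqBall d (R / n)).erase 0 : Finset (Fin d → ℤ)) := by
    intro j _ j' _ hjj
    ext i
    have := congrFun hjj i
    simp only at this
    exact mul_left_cancel₀ (by exact_mod_cast hn.ne') this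
  calc ∑ k ∈ dualFreq d n R, freqNorm k ^ (-α)
      ≤ ∑ k ∈ ((freqBall d (R / n)).erase 0).image
          (fun (j : Fin d → ℤ) (i : Fin d) => (n : ℤ) * j i), freqNorm k ^ (-α) :=
        Finset.sum_le_sum_of_subset_of_nonneg himg fun k _ _ =>
          Real.rpow_nonneg (freqNorm_nonneg k) _
    _ = ∑ j ∈ (freqBall d (R / n)).erase 0, (n : ℝ) ^ (-α) * freqNorm j ^ (-α) := by
        rw [Finset.sum_image hinj]
        refine Finset.sum_congr rfl fun j _ => ?_
        rw [freqNorm_smul, Real.mul_rpow hn0.le (freqNorm_nonneg j)]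
    _ ≤ (n : ℝ) ^ (-α) * (2 * d * 3 ^ (d - 1) / (1 - σ) * (R / n) ^ (d - α)) := by
        rw [← Finset.mul_sum]
        exact mul_le_mul_of_nonneg_left
          (sum_freqNorm_rpow_le hd hα hσ0 hσ1 hασ (div_pos hR hn0)) (by positivity)
    _ = _ := by
        rw [Real.div_rpow hR.le hn0.le]
        have h1 : (n : ℝ) ^ ((d : ℝ) - α) = (n : ℝ) ^ d * (n : ℝ) ^ (-α) := by
          rw [sub_eq_add_neg, Real.rpow_add hn0, Real.rpow_natCast]
        rw [h1]
        push_cast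
        have : (n : ℝ) ^ (-α) ≠ 0 := by positivity
        field_simp

end LatticeSum

/-! ### From Fourier decay to discrepancy -/

section DecayBound

variable {d : ℕ} {η : EuclideanSpace ℝ (Fin d) → ℝ}

theorem norm_le_of_enorm_le_mul {z : ℂ} {C : ℝ≥0∞} (hC : C ≠ ⊤) {x : ℝ} (hx : 0 ≤ x)
    (h : ‖z‖ₑ ≤ C * ENNReal.ofReal x) : ‖z‖ ≤ C.toReal * x := by
  have h1 := ENNReal.toReal_mono (ENNReal.mul_ne_top hC ENNReal.ofReal_ne_top) h
  rwa [toReal_enorm, ENNReal.toReal_mul, ENNReal.toReal_ofReal hx] at h1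

theorem FourierDecayBound.norm_indicator_le {α β : ℝ} {Ω : Set (UnitAddTorus (Fin d))} {C : ℝ≥0∞}
    (h : FourierDecayBound η α β Ω C) (hC : C ≠ ⊤) {k : Fin d → ℤ} (hk : k ≠ 0) :
    ‖UnitAddTorus.mFourierCoeff (Ω.indicator fun _ => (1 : ℂ)) k‖ ≤
      C.toReal * freqNorm k ^ (-α) :=
  norm_le_of_enorm_le_mul hC (Real.rpow_nonneg (freqNorm_nonneg k) _) (h.1 k hk)

theorem FourierDecayBound.norm_psiDist_le {α β : ℝ} {Ω : Set (UnitAddTorus (Fin d))} {C : ℝ≥0∞}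
    (h : FourierDecayBound η α β Ω C) (hC : C ≠ ⊤) {R : ℝ} (hR : 0 < R) {k : Fin d → ℤ}
    (hk : k ≠ 0) (hkR : freqNorm k < R) :
    ‖UnitAddTorus.mFourierCoeff (fun x => (psiDist η Ω R x : ℂ)) k‖ ≤
      C.toReal * freqNorm k ^ (-α) :=
  norm_le_of_enorm_le_mul hC (Real.rpow_nonneg (freqNorm_nonneg k) _) ((h.2 R hR).1 k hk hkR)

theorem FourierDecayBound.norm_psiDist_zero_le {α β : ℝ} {Ω : Set (UnitAddTorus (Fin d))}
    {C : ℝ≥0∞} (h : FourierDecayBound η α β Ω C) (hC : C ≠ ⊤) {R : ℝ} (hR : 0 < R) :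
    ‖UnitAddTorus.mFourierCoeff (fun x => (psiDist η Ω R x : ℂ)) 0‖ ≤ C.toReal * R ^ (-β) :=
  norm_le_of_enorm_le_mul hC (Real.rpow_nonneg hR.le _) (h.2 R hR).2

theorem IsProfile.integrable_psiDist (h : IsProfile η) (Ω : Set (UnitAddTorus (Fin d))) (R : ℝ) :
    Integrable (psiDist η Ω R) (vol d) :=
  Integrable.of_bound (h.measurable_psiDist Ω R).aestronglyMeasurable (psiFactor η)
    (Filter.Eventually.of_forall fun x => h.abs_psiDist_le Ω R x)

theorem FourierDecayBound.integral_psiDist_le {α β : ℝ}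
    {Ω : Set (UnitAddTorus (Fin d))} {C : ℝ≥0∞}
    (hb : FourierDecayBound η α β Ω C) (hC : C ≠ ⊤) {R : ℝ} (hR : 0 < R) :
    ∫ x, psiDist η Ω R x ∂(vol d) ≤ C.toReal * R ^ (-β) := by
  have h1 := hb.norm_psiDist_zero_le hC hR
  rw [mFourierCoeff_zero, Complex.norm_real, Real.norm_eq_abs] at h1
  exact (le_abs_self _).trans h1

/-- Decay of the mean of `psiDist` forces the boundary to be a null set. -/
theorem IsProfile.vol_frontier_eq_zero (h : IsProfile η) (hd : 0 < d) {α β : ℝ} (hβ : 0 < β)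
    {Ω : Set (UnitAddTorus (Fin d))} {C : ℝ≥0∞}
    (hb : FourierDecayBound η α β Ω C) (hC : C ≠ ⊤) : vol d (frontier Ω) = 0 := by
  -- On the frontier the integrand equals ψ(0) > 0 for every R, so letting R → ∞ forces measure
  -- zero.
  have h1 : ∀ R : ℝ, 0 < R → psi η 0 * (vol d).real (frontier Ω) ≤ C.toReal * R ^ (-β) := by
    intro R hR
    refine le_trans ?_ (hb.integral_psiDist_le hC hR)
    have h2 : ∫ x in frontier Ω, psi η 0 ∂(vol d) ≤ ∫ x in frontier Ω, psiDist η Ω R x ∂(vol d) := by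
      refine setIntegral_mono_on (integrable_const _) (h.integrable_psiDist Ω R).integrableOn
        isClosed_frontier.measurableSet fun x hx => ?_
      have := h.psi_le_psiDist hR le_rfl (Ω := Ω) (x := x) (by rw [distBdry_eq_zero hx]; simp)
      rwa [mul_zero] at this
    rw [setIntegral_const, smul_eq_mul, mul_comm] at h2
    exact h2.trans (setIntegral_le_integral (h.integrable_psiDist Ω R)
      (Filter.Eventually.of_forall (h.psiDist_nonneg Ω R)))
  have h2 : Filter.Tendsto (fun R : ℝ => C.toReal * R ^ (-β)) Filter.atTop (nhds (C.toReal * 0)) :=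
    (tendsto_rpow_neg_atTop hβ).const_mul _
  rw [mul_zero] at h2
  have h3 : psi η 0 * (vol d).real (frontier Ω) ≤ 0 :=
    ge_of_tendsto h2 ((Filter.eventually_gt_atTop 0).mono h1)
  have h4 := h.psi_pos hd 0
  have h5 : (vol d).real (frontier Ω) = 0 := by
    refine le_antisymm ?_ measureReal_nonneg
    by_contra h6
    exact (mul_pos h4 (not_le.1 h6)).not_ge h3
  exact (measureReal_eq_zero_iff).1 h5

/-- The discrepancy bound when the sum over the dual lattice is controlled by a convergent
one-dimensional sum of exponent `σ < 1`. -/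
theorem IsProfile.latticeDiscrepancy_le_of_pos (h : IsProfile η) (hd : 0 < d) {α β σ : ℝ}
    (hα : 0 ≤ α) (hβ : 0 < β) (hαβ : α < d + β) (hσ0 : 0 ≤ σ) (hσ1 : σ < 1)
    (hασ : 0 ≤ d - 1 - α + σ) {Ω : Set (UnitAddTorus (Fin d))} {C : ℝ≥0∞}
    (hb : FourierDecayBound η α β Ω C) (hC : C ≠ ⊤) {n : ℕ} (hn : 0 < n) :
    latticeDiscrepancy d n Ω ≤ (1 + 2 * (2 * d * 3 ^ (d - 1) / (1 - σ))) * C.toReal *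
      ((n ^ d : ℕ) : ℝ) ^ (-(β / (d + β - α))) := by
  set m : ℝ := ((n ^ d : ℕ) : ℝ) with hm
  have hm0 : 0 < m := by positivity
  have hs : 0 < d + β - α := by linarith
  -- This choice equates the mean term R^{-β} with the frequency sum R^{d-α}/m.
  set R : ℝ := m ^ (1 / (d + β - α)) with hR
  have hR0 : 0 < R := Real.rpow_pos_of_pos hm0 _
  have hRβ : R ^ (-β) = m ^ (-(β / (d + β - α))) := by
    rw [hR, ← Real.rpow_mul hm0.le]; congr 1; ring
  have hRm : R ^ ((d : ℝ) - α) / m = R ^ (-β) := by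
    have h1 : R ^ (d + β - α) = m := by
      rw [hR, ← Real.rpow_mul hm0.le, one_div_mul_cancel hs.ne', Real.rpow_one]
    rw [div_eq_iff hm0.ne', ← h1, ← Real.rpow_add hR0]; congr 1; ring
  have h1 := h.latticeDiscrepancy_le_sum (h.vol_frontier_eq_zero hd hβ hb hC) hR0 hn
  have h2 := hb.norm_psiDist_zero_le hC hR0
  have h3 : ∑ k ∈ dualFreq d n R, (‖UnitAddTorus.mFourierCoeff (Ω.indicator fun _ => (1 : ℂ)) k‖ +
        ‖UnitAddTorus.mFourierCoeff (fun x => (psiDist η Ω R x : ℂ)) k‖) ≤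
      ∑ k ∈ dualFreq d n R, 2 * C.toReal * freqNorm k ^ (-α) := by
    refine Finset.sum_le_sum fun k hk => ?_
    rw [dualFreq, Finset.mem_filter, mem_freqBall] at hk
    have e1 := hb.norm_indicator_le hC hk.2.1
    have e2 := hb.norm_psiDist_le hC hR0 hk.2.1 hk.1
    linarith
  rw [← Finset.mul_sum] at h3
  have h4 := mul_le_mul_of_nonneg_left (sum_dualFreq_le hd hα hσ0 hσ1 hασ hR0 hn)
    (show 0 ≤ 2 * C.toReal by positivity)
  rw [hRm] at h4
  rw [← hRβ]
  linarith

theorem latticeDiscrepancy_le_one {n : ℕ} (Ω : Set (UnitAddTorus (Fin d))) :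
    latticeDiscrepancy d n Ω ≤ 1 := by
  have h1 : 0 ≤ (vol d).real Ω := measureReal_nonneg
  have h2 : (vol d).real Ω ≤ 1 := measureReal_le_one
  have h3 : 0 ≤ ∑ g : Fin d → Fin n, Ω.indicator (fun _ => (1 : ℝ)) (latticePoint g) :=
    Finset.sum_nonneg fun g _ => indicator_nonneg (fun _ _ => zero_le_one) _
  have h4 : ∑ g : Fin d → Fin n, Ω.indicator (fun _ => (1 : ℝ)) (latticePoint g) ≤
      ((n ^ d : ℕ) : ℝ) := by
    refine (Finset.sum_le_sum fun g _ => indicator_le' (fun _ _ => le_rfl)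
      (fun _ _ => zero_le_one) (latticePoint g)).trans ?_
    simp
  have h5 : ((n ^ d : ℕ) : ℝ)⁻¹ *
      ∑ g : Fin d → Fin n, Ω.indicator (fun _ => (1 : ℝ)) (latticePoint g) ≤ 1 := by
    rcases eq_or_ne ((n ^ d : ℕ) : ℝ) 0 with h0 | h0
    · rw [h0, inv_zero, zero_mul]; exact zero_le_one
    · rw [inv_mul_le_one₀ (lt_of_le_of_ne (Nat.cast_nonneg _) h0.symm)]; exact h4
  have h6 : 0 ≤ ((n ^ d : ℕ) : ℝ)⁻¹ *
      ∑ g : Fin d → Fin n, Ω.indicator (fun _ => (1 : ℝ)) (latticePoint g) := by positivity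
  rw [latticeDiscrepancy, abs_le]
  constructor <;> linarith

/-- The torus is connected, so Ω is empty or everything. -/
theorem latticeDiscrepancy_eq_zero {n : ℕ} (hn : 0 < n) {Ω : Set (UnitAddTorus (Fin d))}
    (hΩ : frontier Ω = ∅) : latticeDiscrepancy d n Ω = 0 := by
  have hconn : ∀ x y : UnitAddTorus (Fin d), x ∈ Ω ↔ y ∈ Ω := by
    intro x y
    obtain ⟨v, rfl, -⟩ := exists_sub_toTorus_eq x y
    refine (sub_toTorus_mem_iff ?_).symm
    rw [distBdry_eq_top_iff.2 hΩ]
    exact ENNReal.ofReal_lt_top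
  have hnd : ((n ^ d : ℕ) : ℝ) ≠ 0 := by positivity
  by_cases h0 : (0 : UnitAddTorus (Fin d)) ∈ Ω
  · have : Ω = univ := eq_univ_of_forall fun x => (hconn 0 x).1 h0
    subst this
    simp only [latticeDiscrepancy, probReal_univ, indicator_univ, Finset.sum_const,
      Finset.card_univ, Fintype.card_pi_const, Fintype.card_fin, nsmul_eq_mul, mul_one]
    rw [inv_mul_cancel₀ hnd, sub_self, abs_zero]
  · have : Ω = ∅ := eq_empty_of_forall_notMem fun x hx => h0 ((hconn x 0).1 hx)
    subst this
    simp [latticeDiscrepancy]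

/-- For β = 0 decay need not make the frontier null. Instead, the torus having diameter at most √d,
the mean at R = 1 is at least ψ(√d); this bounds C below, and the trivial discrepancy bound 1
suffices. -/
theorem IsProfile.one_le_of_frontier_nonempty (h : IsProfile η) (hd : 0 < d) {α : ℝ}
    {Ω : Set (UnitAddTorus (Fin d))} (hΩ : (frontier Ω).Nonempty) {C : ℝ≥0∞}
    (hb : FourierDecayBound η α 0 Ω C) (hC : C ≠ ⊤) : 1 ≤ (psi η (Real.sqrt d))⁻¹ * C.toReal := by
  have hp := h.psi_pos hd (Real.sqrt d)
  have h1 := hb.integral_psiDist_le hC one_pos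
  rw [neg_zero, Real.rpow_zero, mul_one] at h1
  have h2 : ∫ _x, psi η (Real.sqrt d) ∂(vol d) ≤ ∫ x, psiDist η Ω 1 x ∂(vol d) := by
    refine integral_mono (integrable_const _) (h.integrable_psiDist Ω 1) fun x => ?_
    have := h.psi_le_psiDist one_pos (Real.sqrt_nonneg d) (distBdry_le_sqrt hΩ x)
    rwa [one_mul] at this
  rw [integral_const, probReal_univ, one_smul] at h2
  rw [inv_mul_eq_div, one_le_div hp]
  exact h2.trans h1

/-- The discrepancy bound outside the critical case `d = α = 1`. -/
theorem IsProfile.latticeDiscrepancy_le (h : IsProfile η) (hd : 0 < d) {α β σ : ℝ}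
    (hα : 0 ≤ α) (hβ : 0 ≤ β) (hαβ : α < d + β) (hσ0 : 0 ≤ σ) (hσ1 : σ < 1)
    (hασ : 0 ≤ d - 1 - α + σ) {Ω : Set (UnitAddTorus (Fin d))} {C : ℝ≥0∞}
    (hb : FourierDecayBound η α β Ω C) (hC : C ≠ ⊤) {n : ℕ} (hn : 0 < n) :
    latticeDiscrepancy d n Ω ≤
      (1 + 2 * (2 * d * 3 ^ (d - 1) / (1 - σ)) + (psi η (Real.sqrt d))⁻¹) * C.toReal *
        ((n ^ d : ℕ) : ℝ) ^ (-(β / (d + β - α))) := by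
  have hσ : 0 < 1 - σ := by linarith
  have hp := h.psi_pos hd (Real.sqrt d)
  have hm : (0 : ℝ) ≤ ((n ^ d : ℕ) : ℝ) ^ (-(β / (d + β - α))) := by positivity
  have hA : 0 ≤ 1 + 2 * (2 * d * 3 ^ (d - 1) / (1 - σ)) := by positivity
  rcases hβ.eq_or_lt with rfl | hβ'
  · rcases (frontier Ω).eq_empty_or_nonempty with h0 | h0
    · rw [latticeDiscrepancy_eq_zero hn h0]; positivity
    · have h1 := h.one_le_of_frontier_nonempty hd h0 hb hC
      rw [zero_div, neg_zero, Real.rpow_zero, mul_one]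
      have h2 := latticeDiscrepancy_le_one (n := n) Ω
      have h3 : 0 ≤ (1 + 2 * (2 * d * 3 ^ (d - 1) / (1 - σ))) * C.toReal := by positivity
      linarith
  · refine (h.latticeDiscrepancy_le_of_pos hd hα hβ' hαβ hσ0 hσ1 hασ hb hC hn).trans ?_
    refine mul_le_mul_of_nonneg_right (mul_le_mul_of_nonneg_right ?_ ENNReal.toReal_nonneg) hm
    have : 0 ≤ (psi η (Real.sqrt d))⁻¹ := by positivity
    linarith

/-- Passing from all admissible constants to the smallest one. -/
theorem ofReal_le_mul_decayConst {α β x X : ℝ} {A : ℝ≥0} (hA : 0 < A) (hX : 0 < X)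
    {Ω : Set (UnitAddTorus (Fin d))}
    (H : ∀ C, FourierDecayBound η α β Ω C → C ≠ ⊤ → x ≤ A * C.toReal * X) :
    ENNReal.ofReal x ≤ (A : ℝ≥0∞) * decayConst η α β Ω * ENNReal.ofReal X := by
  have hAX0 : (A : ℝ≥0∞) * ENNReal.ofReal X ≠ 0 :=
    mul_ne_zero (by exact_mod_cast hA.ne') (by simpa using hX)
  have hAXt : (A : ℝ≥0∞) * ENNReal.ofReal X ≠ ⊤ :=
    ENNReal.mul_ne_top ENNReal.coe_ne_top ENNReal.ofReal_ne_top
  rw [mul_right_comm, mul_comm, ← ENNReal.div_le_iff hAX0 hAXt]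
  refine le_sInf fun C hC => ?_
  rw [ENNReal.div_le_iff hAX0 hAXt]
  by_cases hCt : C = ⊤
  · rw [hCt, ENNReal.top_mul hAX0]; exact le_top
  · have h1 := ENNReal.ofReal_le_ofReal (H C hC hCt)
    refine h1.trans (le_of_eq ?_)
    rw [ENNReal.ofReal_mul (by positivity), ENNReal.ofReal_mul (by positivity),
      ENNReal.ofReal_coe_nnreal, ENNReal.ofReal_toReal hCt]
    ring

end DecayBound

/-! ### Discrepancy and neighbourhoods of the boundary -/

section Minkowski

variable {d : ℕ}

theorem latticePoint_add {n : ℕ} [NeZero n] (g h : Fin d → Fin n) :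
    latticePoint (g + h) = latticePoint g + latticePoint h := by
  ext i
  have hn : (n : ℝ) ≠ 0 := by exact_mod_cast NeZero.ne n
  simp only [latticePoint, Pi.add_apply]
  rw [← AddCircle.coe_add, ← sub_eq_zero, ← AddCircle.coe_sub, AddCircle.coe_eq_zero_iff]
  have h1 := Nat.div_add_mod ((g i : ℕ) + (h i : ℕ)) n
  have h2 : ((g i + h i : Fin n) : ℕ) = ((g i : ℕ) + (h i : ℕ)) % n := Fin.val_add _ _
  generalize ((g i : ℕ) + (h i : ℕ)) / n = q at h1
  rw [h2]
  generalize ((g i : ℕ) + (h i : ℕ)) % n = r at h1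
  have h3 : (n : ℝ) * q + r = (g i : ℕ) + (h i : ℕ) := by exact_mod_cast h1
  refine ⟨-(q : ℤ), ?_⟩
  rw [zsmul_eq_mul, mul_one]
  push_cast
  field_simp
  linarith

/-- Every point of the torus is within `√d / n` of the lattice. -/
theorem exists_latticePoint_add {n : ℕ} (hn : 0 < n) (x : UnitAddTorus (Fin d)) :
    ∃ (h : Fin d → Fin n) (v : EuclideanSpace ℝ (Fin d)),
      x = latticePoint h + toTorus v ∧ ‖v‖ ≤ Real.sqrt d / n := by
  have hn0 : (0 : ℝ) < n := by exact_mod_cast hn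
  have key : ∀ u : UnitAddCircle, ∃ (a : Fin n) (s : ℝ),
      u = ((((a : ℕ) : ℝ) / (n : ℝ) : ℝ) : UnitAddCircle) + (s : UnitAddCircle) ∧ |s| ≤ 1 / n := by
    intro u
    obtain ⟨r, hr, rfl⟩ := AddCircle.coe_image_Ico_eq (1 : ℝ) 0 ▸ mem_univ u
    rw [zero_add] at hr
    have h0 : 0 ≤ (n : ℝ) * r := mul_nonneg hn0.le hr.1
    have h1 : ⌊(n : ℝ) * r⌋₊ < n := by
      rw [Nat.floor_lt h0]
      nlinarith [hr.2]
    refine ⟨⟨_, h1⟩, r - (⌊(n : ℝ) * r⌋₊ : ℝ) / n, ?_, ?_⟩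
    · rw [← AddCircle.coe_add]
      congr 1
      ring
    · have h2 := Nat.floor_le h0
      have h3 := Nat.lt_floor_add_one ((n : ℝ) * r)
      rw [show r - (⌊(n : ℝ) * r⌋₊ : ℝ) / n = ((n : ℝ) * r - ⌊(n : ℝ) * r⌋₊) / n by field_simp,
        abs_of_nonneg (div_nonneg (by linarith) hn0.le)]
      gcongr
      linarith
  choose a s h1 h2 using fun i => key (x i)
  refine ⟨a, WithLp.toLp 2 s, ?_, ?_⟩
  · ext i
    rw [h1 i]; rfl
  · rw [EuclideanSpace.norm_eq]
    have h3 : ∑ i, ‖(WithLp.toLp 2 s : EuclideanSpace ℝ (Fin d)) i‖ ^ 2 ≤ d * (1 / (n : ℝ)) ^ 2 := by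
      refine (Finset.sum_le_sum fun i _ => pow_le_pow_left₀ (norm_nonneg _) (h2 i) 2).trans ?_
      simp
    refine (Real.sqrt_le_sqrt h3).trans ?_
    rw [Real.sqrt_mul (by positivity), Real.sqrt_sq (by positivity)]
    exact le_of_eq (by ring)

/-- The discrepancy is at most the measure of a neighbourhood of the boundary of radius
comparable to the mesh. -/
theorem latticeDiscrepancy_le_vol {n : ℕ} (hn : 0 < n) {Ω : Set (UnitAddTorus (Fin d))}
    (hΩ : NullMeasurableSet Ω (vol d)) {t : ℝ} (ht : Real.sqrt d / n < t) :
    latticeDiscrepancy d n Ω ≤ (vol d).real {x | distBdry Ω x < ENNReal.ofReal t} := by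
  have : NeZero n := ⟨hn.ne'⟩
  set D : Set (UnitAddTorus (Fin d)) := {x | distBdry Ω x < ENNReal.ofReal t} with hD
  have hDm : MeasurableSet D := measurableSet_lt (continuous_distBdry Ω).measurable measurable_const
  set m : ℝ := ((n ^ d : ℕ) : ℝ) with hm
  have hm0 : 0 < m := by positivity
  have hcard : Fintype.card (Fin d → Fin n) = n ^ d := by simp
  -- The proportion of the lattice shifted by x that lies in S: it is lattice-periodic, its value at
  -- 0 is the count in the discrepancy, and its mean is the measure of S.
  let avg : Set (UnitAddTorus (Fin d)) → UnitAddTorus (Fin d) → ℝ := fun S x =>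
    m⁻¹ * ∑ g : Fin d → Fin n, S.indicator (fun _ => (1 : ℝ)) (x + latticePoint g)
  have hinv : ∀ (S : Set (UnitAddTorus (Fin d))) (h : Fin d → Fin n) x,
      avg S (latticePoint h + x) = avg S x := by
    intro S h x
    simp only [avg]
    congr 1
    refine Fintype.sum_equiv (Equiv.addRight h) _ _ fun g => ?_
    rw [Equiv.coe_addRight, latticePoint_add]
    congr 1
    abel
  have hind : ∀ {S : Set (UnitAddTorus (Fin d))}, NullMeasurableSet S (vol d) →
      Integrable (S.indicator fun _ => (1 : ℝ)) (vol d) := fun hS =>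
    (integrable_const (1 : ℝ)).indicator₀ hS
  have hint : ∀ {S : Set (UnitAddTorus (Fin d))}, NullMeasurableSet S (vol d) →
      Integrable (avg S) (vol d) := fun hS =>
    (integrable_finsetSum _ fun g _ => (hind hS).comp_add_right _).const_mul _
  have hmean : ∀ {S : Set (UnitAddTorus (Fin d))}, NullMeasurableSet S (vol d) →
      ∫ x, avg S x ∂(vol d) = (vol d).real S := by
    intro S hS
    simp only [avg]
    rw [integral_const_mul, integral_finsetSum _ fun g _ => (hind hS).comp_add_right _]
    have h1 : ∀ g : Fin d → Fin n,
        ∫ x, S.indicator (fun _ => (1 : ℝ)) (x + latticePoint g) ∂(vol d) = (vol d).real S := by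
      intro g
      rw [integral_add_right_eq_self (fun x => S.indicator (fun _ => (1 : ℝ)) x),
        integral_indicator₀ hS, setIntegral_const, smul_eq_mul, mul_one]
    simp only [h1, Finset.sum_const, Finset.card_univ, hcard, nsmul_eq_mul]
    rw [← mul_assoc, inv_mul_cancel₀ hm0.ne', one_mul]
  -- By periodicity the shift may be taken of length at most √d/n; a term then changes only if its
  -- shifted point is within t of the boundary.
  have hpt : ∀ x, |avg Ω x - avg Ω 0| ≤ avg D x := by
    intro x
    obtain ⟨h, v, rfl, hv⟩ := exists_latticePoint_add hn x
    rw [hinv, hinv]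
    simp only [avg]
    rw [← mul_sub, ← Finset.sum_sub_distrib, abs_mul, abs_of_pos (inv_pos.2 hm0)]
    refine mul_le_mul_of_nonneg_left ((Finset.abs_sum_le_sum_abs _ _).trans ?_) (by positivity)
    refine Finset.sum_le_sum fun g _ => ?_
    set y := toTorus v + latticePoint g with hy
    rw [show (0 : UnitAddTorus (Fin d)) + latticePoint g = y - toTorus v by rw [hy]; abel]
    by_cases hyD : y ∈ D
    · rw [indicator_of_mem hyD]
      have a0 : ∀ z, 0 ≤ Ω.indicator (fun _ => (1 : ℝ)) z := fun z =>
        indicator_nonneg (fun _ _ => zero_le_one) z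
      have a1 : ∀ z, Ω.indicator (fun _ => (1 : ℝ)) z ≤ 1 := fun z =>
        indicator_le' (fun _ _ => le_rfl) (fun _ _ => zero_le_one) z
      rw [abs_le]
      constructor <;> linarith [a0 y, a1 y, a0 (y - toTorus v), a1 (y - toTorus v)]
    · have h1 : ENNReal.ofReal ‖v‖ < distBdry Ω y := by
        have h2 : ENNReal.ofReal t ≤ distBdry Ω y := not_lt.1 hyD
        refine lt_of_lt_of_le ?_ h2
        exact (ENNReal.ofReal_lt_ofReal_iff_of_nonneg (norm_nonneg v)).2 (hv.trans_lt ht)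
      have h2 := sub_toTorus_mem_iff h1
      rw [indicator_of_notMem hyD]
      by_cases hyΩ : y ∈ Ω
      · simp [hyΩ, h2.2 hyΩ]
      · simp [hyΩ, mt h2.1 hyΩ]
  have h0 : latticeDiscrepancy d n Ω = |∫ x, (avg Ω x - avg Ω 0) ∂(vol d)| := by
    rw [integral_sub (hint hΩ) (integrable_const _), hmean hΩ, integral_const, probReal_univ,
      one_smul, latticeDiscrepancy]
    simp only [avg, zero_add, hm]
  rw [h0, ← hmean hDm.nullMeasurableSet, ← Real.norm_eq_abs]
  exact norm_integral_le_of_norm_le (hint hDm.nullMeasurableSet)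
    (Filter.Eventually.of_forall fun x => hpt x)

/-- The discrepancy bound in terms of the Minkowski content of the boundary. -/
theorem latticeDiscrepancy_le_minkowski (hd : 0 < d) {α : ℝ} (hα1 : α ≤ 1) {n : ℕ}
    (hn : 0 < n) {γ : ℝ} {Ω : Set (UnitAddTorus (Fin d))} (hΩ : NullMeasurableSet Ω (vol d))
    (hM : minkowskiConst α Ω < ENNReal.ofReal γ) :
    latticeDiscrepancy d n Ω ≤ (Real.sqrt d + 1) * γ * ((n ^ d : ℕ) : ℝ) ^ (-(α / d)) := by
  have hn0 : (0 : ℝ) < n := by exact_mod_cast hn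
  have hd0 : (d : ℝ) ≠ 0 := by exact_mod_cast hd.ne'
  -- The added 1 gives strict inequality with the mesh radius √d/n; as the numerator is at least 1,
  -- its power α ≤ 1 is bounded by itself, uniformly in α.
  set t : ℝ := (Real.sqrt d + 1) / n with ht
  have ht0 : 0 < t := by positivity
  have hγ : 0 < γ := ENNReal.ofReal_pos.1 ((bot_le).trans_lt hM)
  have h1 : ENNReal.ofReal (t ^ (-α)) * vol d {x | distBdry Ω x < ENNReal.ofReal t} ≤
      ENNReal.ofReal γ :=
    (le_iSup₂ (f := fun (t : ℝ) (_ : 0 < t) => ENNReal.ofReal (t ^ (-α)) *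
      vol d {x | distBdry Ω x < ENNReal.ofReal t}) t ht0).trans hM.le
  have h2 := ENNReal.toReal_mono ENNReal.ofReal_ne_top h1
  rw [ENNReal.toReal_mul, ENNReal.toReal_ofReal (by positivity), ENNReal.toReal_ofReal hγ.le,
    Real.rpow_neg ht0.le, inv_mul_le_iff₀ (by positivity)] at h2
  refine (latticeDiscrepancy_le_vol hn hΩ (t := t) ?_).trans (h2.trans ?_)
  · rw [ht]; gcongr; linarith
  · have h3 : ((n ^ d : ℕ) : ℝ) ^ (-(α / d)) = (n : ℝ) ^ (-α) := by
      push_cast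
      rw [← Real.rpow_natCast, ← Real.rpow_mul hn0.le]
      congr 1; field_simp
    have h4 : t ^ α ≤ (Real.sqrt d + 1) * (n : ℝ) ^ (-α) := by
      rw [ht, Real.div_rpow (by positivity) hn0.le, Real.rpow_neg hn0.le, div_eq_mul_inv]
      refine mul_le_mul_of_nonneg_right ?_ (by positivity)
      have : (1 : ℝ) ≤ Real.sqrt d + 1 := by linarith [Real.sqrt_nonneg (d : ℝ)]
      simpa using Real.rpow_le_rpow_of_exponent_le this hα1
    rw [h3]
    nlinarith

end Minkowski

/-! ### Smallness of the smoothed ψ far from the boundary -/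

section SmoothingUpper

variable {d : ℕ} {η : EuclideanSpace ℝ (Fin d) → ℝ}

/-- Far from the boundary the smoothed `psiDist` is small. -/
theorem IsProfile.smoothing_psiDist_le (h : IsProfile η) {Ω : Set (UnitAddTorus (Fin d))}
    {R A : ℝ} (hR : 0 < R) (hA : 0 < A) {x : UnitAddTorus (Fin d)}
    (hx : ENNReal.ofReal (A / R) ≤ distBdry Ω x) :
    smoothing η R (psiDist η Ω R) x ≤ 2 * psiFactor η * tail η (A / 4) := by
  have hF := h.psiFactor_pos
  have hpt : ∀ y, kernel η y * psiDist η Ω R (x - toTorus (R⁻¹ • y)) ≤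
      kernel η y * psi η (A / 2) +
        psiFactor η * {z : EuclideanSpace ℝ (Fin d) | A / 2 ≤ ‖z‖}.indicator (kernel η) y := by
    intro y
    -- Long displacements are paid for by the kernel's tail; short ones leave the point at distance
    -- at least A/(2R) from the boundary.
    by_cases hy : A / 2 ≤ ‖y‖
    · rw [indicator_of_mem (show y ∈ {z : EuclideanSpace ℝ (Fin d) | A / 2 ≤ ‖z‖} from hy)]
      have h1 := mul_le_mul_of_nonneg_left (h.psiDist_le Ω R (x - toTorus (R⁻¹ • y)))
        (h.kernel_nonneg y)
      have h2 := mul_nonneg (h.kernel_nonneg y) (h.psi_nonneg (A / 2))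
      linarith
    · rw [indicator_of_notMem (show y ∉ {z : EuclideanSpace ℝ (Fin d) | A / 2 ≤ ‖z‖} from hy),
        mul_zero, add_zero]
      refine mul_le_mul_of_nonneg_left ?_ (h.kernel_nonneg y)
      rw [psiDist]
      split_ifs with htop
      · exact h.psi_nonneg _
      · refine h.psi_antitone ?_
        have h1 := hx.trans (distBdry_le_sub_toTorus Ω x (R⁻¹ • y))
        rw [← ENNReal.ofReal_toReal htop, ← ENNReal.ofReal_add ENNReal.toReal_nonneg (norm_nonneg _),
          ENNReal.ofReal_le_ofReal_iff (by positivity), norm_smul, Real.norm_eq_abs,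
          abs_of_pos (inv_pos.2 hR)] at h1
        have h2 : R * (A / R) ≤ R * ((distBdry Ω (x - toTorus (R⁻¹ • y))).toReal + R⁻¹ * ‖y‖) :=
          mul_le_mul_of_nonneg_left h1 hR.le
        rw [mul_div_cancel₀ _ hR.ne', mul_add, mul_inv_cancel_left₀ hR.ne'] at h2
        linarith [not_le.1 hy]
  have h1 := integral_mono (h.integrable_kernel_mul
    ((h.measurable_psiDist Ω R).comp (measurable_sub_toTorus x R)) fun y => h.abs_psiDist_le Ω R _)
    ((h.kernel_integrable.mul_const (psi η (A / 2))).add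
      ((h.kernel_integrable.indicator (measurableSet_le_norm (A / 2))).const_mul (psiFactor η))) hpt
  simp only [Pi.add_apply] at h1
  rw [integral_add (h.kernel_integrable.mul_const (psi η (A / 2)))
      ((h.kernel_integrable.indicator (measurableSet_le_norm (A / 2))).const_mul (psiFactor η)),
    integral_mul_const, h.integral_kernel, one_mul, integral_const_mul,
    integral_indicator (measurableSet_le_norm _), psi_eq] at h1
  refine le_trans h1 ?_
  have h2 : tail η (A / 2) ≤ tail η (A / 4) := h.tail_antitone (by linarith)
  have h3 : tail η (A / 2 / 2) = tail η (A / 4) := by congr 1; ring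
  rw [h3]
  change psiFactor η * tail η (A / 4) + psiFactor η * tail η (A / 2) ≤ _
  have := mul_le_mul_of_nonneg_left h2 hF.le
  linarith

theorem IsProfile.exists_tail_le (h : IsProfile η) {ε : ℝ} (hε : 0 < ε) :
    ∃ t : ℝ, 0 < t ∧ tail η t ≤ ε := by
  set D := ∫ x, ‖x‖ ^ 2 * kernel η x with hD
  have hD0 : 0 ≤ D := integral_nonneg fun x => mul_nonneg (sq_nonneg _) (h.kernel_nonneg x)
  refine ⟨Real.sqrt ((D + 1) / ε), Real.sqrt_pos.2 (by positivity), ?_⟩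
  refine (h.tail_le_div_sq (Real.sqrt_pos.2 (by positivity))).trans ?_
  rw [Real.sq_sqrt (by positivity), ← hD, div_div_eq_mul_div, div_le_iff₀ (by positivity)]
  nlinarith

end SmoothingUpper

/-! ### Arcs and gap points on the circle -/

section Circle

/-- The point of `𝕋^1` with coordinate `s`. -/
noncomputable def linePoint (s : ℝ) : UnitAddTorus (Fin 1) := toTorus (WithLp.toLp 2 fun _ => s)

theorem linePoint_apply (s : ℝ) (i : Fin 1) : linePoint s i = (s : UnitAddCircle) := rfl

theorem linePoint_add (s t : ℝ) : linePoint (s + t) = linePoint s + linePoint t := by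
  ext i; simp [linePoint_apply]

theorem linePoint_sub (s t : ℝ) : linePoint (s - t) = linePoint s - linePoint t := by
  ext i; simp [linePoint_apply]

theorem linePoint_zero : linePoint 0 = 0 := by
  ext i; simp [linePoint_apply]

theorem continuous_linePoint : Continuous linePoint :=
  continuous_toTorus.comp (by fun_prop)

theorem norm_toLp_const (s : ℝ) :
    ‖(WithLp.toLp 2 fun _ => s : EuclideanSpace ℝ (Fin 1))‖ = |s| := by
  simp [EuclideanSpace.norm_eq, Real.sqrt_sq_eq_abs]

theorem eq_toLp_const (v : EuclideanSpace ℝ (Fin 1)) : v = WithLp.toLp 2 fun _ => v 0 := by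
  ext i; rw [Subsingleton.elim i 0]

theorem toTorus_eq_linePoint (v : EuclideanSpace ℝ (Fin 1)) : toTorus v = linePoint (v 0) := by
  rw [linePoint, ← eq_toLp_const]

theorem norm_eq_abs_apply_zero (v : EuclideanSpace ℝ (Fin 1)) : ‖v‖ = |v 0| := by
  rw [← norm_toLp_const, ← eq_toLp_const]

theorem integral_vol_one (f : UnitAddTorus (Fin 1) → ℝ) :
    ∫ x, f x ∂(vol 1) = ∫ s in Ioc (-(1 / 2) : ℝ) (1 / 2), f (linePoint s) := by
  have h1 := UnitAddTorus.integral_preimage f (fun _ => (-(1 / 2) : ℝ))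
  change ∫ x, f x ∂(vol 1) = _ at h1
  rw [h1]
  have h2 := (volume_preserving_funUnique (Fin 1) ℝ).setIntegral_preimage_emb
    (MeasurableEquiv.measurableEmbedding _) (fun s => f (linePoint s)) (Ioc (-(1 / 2) : ℝ) (1 / 2))
  rw [← h2]
  have hset : {x : Fin 1 → ℝ | ∀ i, x i ∈ Ioc (-(1 / 2) : ℝ) (-(1 / 2) + 1)} =
      (MeasurableEquiv.funUnique (Fin 1) ℝ) ⁻¹' Ioc (-(1 / 2) : ℝ) (1 / 2) := by
    ext x
    simp only [mem_ofPred_eq, mem_preimage, Fin.forall_fin_one]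
    norm_num
  rw [hset]
  congr 1
  ext x
  congr 1
  ext i
  rw [Subsingleton.elim i 0]
  rfl

/-- The open arc `(0, δ)` of the circle. -/
def arc (δ : ℝ) : Set (UnitAddTorus (Fin 1)) := linePoint '' Ioo 0 δ

theorem isOpen_arc (δ : ℝ) : IsOpen (arc δ) := by
  have h1 : arc δ = toTorus '' {v : EuclideanSpace ℝ (Fin 1) | v 0 ∈ Ioo 0 δ} := by
    ext x
    constructor
    · rintro ⟨s, hs, rfl⟩
      exact ⟨_, hs, rfl⟩
    · rintro ⟨v, hv, rfl⟩
      exact ⟨v 0, hv, (toTorus_eq_linePoint v).symm⟩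
  rw [h1]
  refine isOpenQuotientMap_toTorus.isOpenMap _ (isOpen_Ioo.preimage ?_)
  fun_prop

theorem integral_indicator_const_one {d : ℕ} {S : Set (UnitAddTorus (Fin d))}
    (hS : MeasurableSet S) : ∫ x, S.indicator (fun _ => (1 : ℝ)) x ∂(vol d) = (vol d).real S := by
  rw [integral_indicator hS, setIntegral_const, smul_eq_mul, mul_one]

theorem le_vol_arc {δ : ℝ} (h0 : 0 ≤ δ) (h1 : δ ≤ 1 / 2) : δ ≤ (vol 1).real (arc δ) := by
  rw [← integral_indicator_const_one (isOpen_arc δ).measurableSet, integral_vol_one]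
  have h2 : ∫ s in Ioc (-(1 / 2) : ℝ) (1 / 2), (Ioo 0 δ).indicator (fun _ => (1 : ℝ)) s = δ := by
    rw [setIntegral_indicator measurableSet_Ioo, inter_eq_right.2, setIntegral_const]
    · simp [h0]
    · exact fun s hs => ⟨by linarith [hs.1], by linarith [hs.2]⟩
  conv_lhs => rw [← h2]
  refine integral_mono ?_ ?_ fun s => ?_
  · exact (integrable_const _).indicator measurableSet_Ioo
  · refine Integrable.of_bound (C := 1) ?_ (Filter.Eventually.of_forall fun s => ?_)
    · exact ((measurable_const.indicator (isOpen_arc δ).measurableSet).comp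
        continuous_linePoint.measurable).aestronglyMeasurable
    · rw [Real.norm_eq_abs, abs_of_nonneg (indicator_nonneg (fun _ _ => zero_le_one) _)]
      exact indicator_le' (fun _ _ => le_rfl) (fun _ _ => zero_le_one) _
  · by_cases hs : s ∈ Ioo 0 δ
    · rw [indicator_of_mem hs, indicator_of_mem (show linePoint s ∈ arc δ from ⟨s, hs, rfl⟩)]
    · rw [indicator_of_notMem hs]
      exact indicator_nonneg (fun _ _ => zero_le_one) _

/-- `b` is followed by a gap of length `ρ` in `B`. -/
def IsGapPoint (B : Set (UnitAddTorus (Fin 1))) (ρ : ℝ) (b : UnitAddTorus (Fin 1)) : Prop :=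
  b ∈ B ∧ ∀ s ∈ Ioo 0 ρ, b + linePoint s ∉ B

theorem IsGapPoint.mono {B : Set (UnitAddTorus (Fin 1))} {ρ ρ' : ℝ} {b : UnitAddTorus (Fin 1)}
    (h : IsGapPoint B ρ b) (hρ : ρ' ≤ ρ) : IsGapPoint B ρ' b :=
  ⟨h.1, fun s hs => h.2 s ⟨hs.1, hs.2.trans_le hρ⟩⟩

/-- The gap arcs of distinct points are disjoint: if two met, one base point would lie inside the
gap following the other. -/
theorem IsGapPoint.eq_of_mem_arc {B : Set (UnitAddTorus (Fin 1))} {ρ : ℝ}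
    {b b' x : UnitAddTorus (Fin 1)} (hb : IsGapPoint B ρ b) (hb' : IsGapPoint B ρ b')
    (hx : x - b ∈ arc ρ) (hx' : x - b' ∈ arc ρ) : b = b' := by
  obtain ⟨s, hs, hsx⟩ := hx
  obtain ⟨s', hs', hsx'⟩ := hx'
  have e1 : x = b + linePoint s := by rw [hsx]; abel
  have e2 : x = b' + linePoint s' := by rw [hsx']; abel
  rcases lt_trichotomy s s' with hlt | heq | hlt
  · exfalso
    refine hb'.2 (s' - s) ⟨by linarith, by linarith [hs.1, hs'.2]⟩ ?_
    have : b' + linePoint (s' - s) = b := by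
      rw [linePoint_sub, ← add_sub_assoc, ← e2, e1, add_sub_cancel_right]
    rw [this]; exact hb.1
  · rw [heq] at e1
    exact add_right_cancel (e1.symm.trans e2)
  · exfalso
    refine hb.2 (s - s') ⟨by linarith, by linarith [hs'.1, hs.2]⟩ ?_
    have : b + linePoint (s - s') = b' := by
      rw [linePoint_sub, ← add_sub_assoc, ← e1, e2, add_sub_cancel_right]
    rw [this]; exact hb'.1

/-- A function bounded below by `a` on the disjoint arcs following gap points has integral at
least `a` times the total length of the arcs. -/
theorem card_mul_le_integral {B : Set (UnitAddTorus (Fin 1))} {ρ : ℝ} (hρ0 : 0 ≤ ρ)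
    (hρ1 : ρ ≤ 1 / 2) {F : Finset (UnitAddTorus (Fin 1))} (hF : ∀ b ∈ F, IsGapPoint B ρ b)
    {f : UnitAddTorus (Fin 1) → ℝ} (hf : Integrable f (vol 1)) (hf0 : ∀ x, 0 ≤ f x) {a : ℝ}
    (ha : 0 ≤ a) (hfa : ∀ b ∈ F, ∀ s ∈ Ioo 0 ρ, a ≤ f (b + linePoint s)) :
    F.card * (a * ρ) ≤ ∫ x, f x ∂(vol 1) := by
  have hm : ∀ b : UnitAddTorus (Fin 1), MeasurableSet ((fun x => x - b) ⁻¹' arc ρ) := fun b =>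
    ((isOpen_arc ρ).preimage (by fun_prop)).measurableSet
  have hi : ∀ b : UnitAddTorus (Fin 1), Integrable (fun x =>
      a * ((fun x => x - b) ⁻¹' arc ρ).indicator (fun _ => (1 : ℝ)) x) (vol 1) := fun b =>
    ((integrable_const (1 : ℝ)).indicator (hm b)).const_mul a
  have h1 : ∀ b ∈ F, a * ρ ≤
      ∫ x, a * ((fun x => x - b) ⁻¹' arc ρ).indicator (fun _ => (1 : ℝ)) x ∂(vol 1) := by
    intro b _
    rw [integral_const_mul]
    refine mul_le_mul_of_nonneg_left ((le_vol_arc hρ0 hρ1).trans (le_of_eq ?_)) ha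
    rw [← integral_indicator_const_one (isOpen_arc ρ).measurableSet,
      ← integral_sub_right_eq_self _ b]
    rfl
  calc (F.card : ℝ) * (a * ρ) = ∑ b ∈ F, a * ρ := by rw [Finset.sum_const, nsmul_eq_mul]
    _ ≤ ∑ b ∈ F, ∫ x, a * ((fun x => x - b) ⁻¹' arc ρ).indicator (fun _ => (1 : ℝ)) x ∂(vol 1) :=
        Finset.sum_le_sum h1
    _ = ∫ x, ∑ b ∈ F, a * ((fun x => x - b) ⁻¹' arc ρ).indicator (fun _ => (1 : ℝ)) x ∂(vol 1) :=
        (integral_finsetSum _ fun b _ => hi b).symm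
    _ ≤ ∫ x, f x ∂(vol 1) := by
        refine integral_mono (integrable_finsetSum _ fun b _ => hi b) hf fun x => ?_
        by_cases hx : ∃ b ∈ F, x - b ∈ arc ρ
        · obtain ⟨b, hb, hxb⟩ := hx
          simp only
          rw [Finset.sum_eq_single b]
          · rw [indicator_of_mem (show x ∈ (fun x => x - b) ⁻¹' arc ρ from hxb), mul_one]
            obtain ⟨s, hs, hsx⟩ := hxb
            have := hfa b hb s hs
            rwa [hsx, add_sub_cancel] at this
          · intro b' hb' hne
            rw [indicator_of_notMem, mul_zero]
            intro hxb'
            exact hne ((hF b' hb').eq_of_mem_arc (hF b hb) hxb' hxb)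
          · exact fun hb' => absurd hb hb'
        · push Not at hx
          simp only
          rw [Finset.sum_eq_zero]
          · exact hf0 x
          · intro b hb
            rw [indicator_of_notMem (show x ∉ (fun x => x - b) ⁻¹' arc ρ from hx b hb), mul_zero]

/-- A closed null subset of the circle with finitely many gap points consists of gap points. -/
theorem exists_gap_of_mem {B : Set (UnitAddTorus (Fin 1))} (hB : IsClosed B) (h0 : vol 1 B = 0)
    (hfin : {b | ∃ ρ > 0, IsGapPoint B ρ b}.Finite) {b : UnitAddTorus (Fin 1)} (hb : b ∈ B) :
    ∃ ρ > 0, IsGapPoint B ρ b := by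
  set B' := {b | ∃ ρ > 0, IsGapPoint B ρ b} with hB'
  have hcont : Continuous fun s : ℝ => b + linePoint s := continuous_const.add continuous_linePoint
  -- Finiteness isolates b from all other gap points: within parameter distance ρ there are none.
  have hopen : IsOpen ((fun s : ℝ => b + linePoint s) ⁻¹' (B' \ {b})ᶜ) :=
    ((hfin.subset sdiff_subset).isClosed.isOpen_compl).preimage hcont
  obtain ⟨ρ, hρ0, hρ⟩ := Metric.isOpen_iff.1 hopen 0 (by simp [linePoint_zero])
  obtain ⟨s₂, hs₂, hs₂B⟩ : ∃ s ∈ Ioo 0 (min ρ (1 / 2)), b + linePoint s ∉ B := by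
    by_contra hcon
    push Not at hcon
    have hδ0 : 0 < min ρ (1 / 2) := lt_min hρ0 (by norm_num)
    have h1 := le_vol_arc hδ0.le (min_le_right ρ (1 / 2))
    have h2 : (fun x => x - b) ⁻¹' arc (min ρ (1 / 2)) ⊆ B := by
      rintro x ⟨s, hs, hsx⟩
      have := hcon s hs
      rwa [hsx, add_sub_cancel] at this
    have h3 : vol 1 ((fun x => x - b) ⁻¹' arc (min ρ (1 / 2))) = 0 := measure_mono_null h2 h0
    simp only [sub_eq_add_neg] at h3
    rw [measure_preimage_add_right] at h3
    rw [measureReal_def, h3, ENNReal.toReal_zero] at h1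
    linarith
  have hcl : IsClosed ((fun s : ℝ => b + linePoint s) ⁻¹' B) := hB.preimage hcont
  have hK : IsCompact (Icc 0 s₂ ∩ (fun s : ℝ => b + linePoint s) ⁻¹' B) :=
    isCompact_Icc.inter_right hcl
  -- Since B is null, some s₂ close to 0 leaves B. The last point of B before it is a gap point, and
  -- by isolation it is b.
  obtain ⟨s₃, hs₃, hmax⟩ := hK.exists_isGreatest ⟨0, ⟨le_rfl, hs₂.1.le⟩, by
    simpa [linePoint_zero] using hb⟩
  have hs₃₂ : s₃ < s₂ := lt_of_le_of_ne hs₃.1.2 fun heq => hs₂B (heq ▸ hs₃.2)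
  have hgap : IsGapPoint B (s₂ - s₃) (b + linePoint s₃) := by
    refine ⟨hs₃.2, fun s hs hsB => ?_⟩
    have h1 : s₃ + s ≤ s₃ := hmax ⟨⟨by linarith [hs.1, hs₃.1.1], by linarith [hs.2]⟩, by
      simpa [linePoint_add, add_assoc] using hsB⟩
    linarith [hs.1]
  have hmem : b + linePoint s₃ ∈ B' := ⟨_, by linarith, hgap⟩
  have hball : s₃ ∈ Metric.ball (0 : ℝ) ρ := by
    rw [mem_ball_zero_iff, Real.norm_eq_abs, abs_of_nonneg hs₃.1.1]
    exact hs₃₂.trans (hs₂.2.trans_le (min_le_left _ _))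
  have hnot := hρ hball
  have heq : b + linePoint s₃ = b := by
    by_contra hne
    exact hnot ⟨hmem, hne⟩
  rw [heq] at hmem
  exact hmem

end Circle

/-! ### Parseval and translation in L² -/

section Parseval

variable {d : ℕ} {η : EuclideanSpace ℝ (Fin d) → ℝ}

theorem hasSum_sq_norm_mFourierCoeff {f : UnitAddTorus (Fin d) → ℂ} (hf : Continuous f) :
    HasSum (fun k => ‖UnitAddTorus.mFourierCoeff f k‖ ^ 2) (∫ x, ‖f x‖ ^ 2 ∂(vol d)) := by
  let G : C(UnitAddTorus (Fin d), ℂ) := ⟨f, hf⟩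
  have h1 : HasSum
      (fun k => ‖UnitAddTorus.mFourierCoeff (ContinuousMap.toLp 2 (vol d) ℂ G) k‖ ^ 2)
      (∫ x, ‖ContinuousMap.toLp 2 (vol d) ℂ G x‖ ^ 2 ∂(vol d)) :=
    UnitAddTorus.hasSum_sq_mFourierCoeff (ContinuousMap.toLp 2 (vol d) ℂ G)
  have h2 : (fun k => ‖UnitAddTorus.mFourierCoeff (ContinuousMap.toLp 2 (vol d) ℂ G) k‖ ^ 2) =
      fun k => ‖UnitAddTorus.mFourierCoeff f k‖ ^ 2 :=
    funext fun k => congrArg (fun z : ℂ => ‖z‖ ^ 2) (UnitAddTorus.mFourierCoeff_toLp G k)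
  have h3 : ∫ x, ‖ContinuousMap.toLp 2 (vol d) ℂ G x‖ ^ 2 ∂(vol d) = ∫ x, ‖f x‖ ^ 2 ∂(vol d) := by
    refine integral_congr_ae ?_
    filter_upwards [ContinuousMap.coeFn_toLp (p := 2) (vol d) (𝕜 := ℂ) G] with x hx
    rw [hx]
    rfl
  rwa [h2, h3] at h1

theorem mFourierCoeff_comp_add {f : UnitAddTorus (Fin d) → ℂ} (z : UnitAddTorus (Fin d))
    (k : Fin d → ℤ) : UnitAddTorus.mFourierCoeff (fun x => f (x + z)) k =
      UnitAddTorus.mFourier k z * UnitAddTorus.mFourierCoeff f k := by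
  have h0 : UnitAddTorus.mFourier k z * UnitAddTorus.mFourier (-k) z = 1 := by
    rw [← UnitAddTorus.mFourier_add, add_neg_cancel, UnitAddTorus.mFourier_zero,
      ContinuousMap.one_apply]
  rw [mFourierCoeff_eq, mFourierCoeff_eq, ← integral_const_mul,
    ← integral_add_right_eq_self (fun x => UnitAddTorus.mFourier k z *
      (UnitAddTorus.mFourier (-k) x * f x)) z]
  congr 1
  ext x
  rw [mFourier_add_apply]
  linear_combination (-(UnitAddTorus.mFourier (-k) x * f (x + z))) * h0

theorem norm_mFourier_toTorus_sub_one_le (k : Fin d → ℤ) (v : EuclideanSpace ℝ (Fin d)) :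
    ‖UnitAddTorus.mFourier k (toTorus v) - 1‖ ≤ 2 * Real.pi * (‖v‖ * freqNorm k) := by
  rw [mFourier_toTorus, mul_comm (_ : ℂ) Complex.I]
  refine Real.norm_exp_I_mul_ofReal_sub_one_le.trans ?_
  rw [norm_mul, Real.norm_eq_abs, abs_of_pos Real.two_pi_pos, ← norm_freqVec]
  exact mul_le_mul_of_nonneg_left (norm_inner_le_norm _ _) Real.two_pi_pos.le

/-- Under Fourier decay of order one, translates of the smoothed `psiDist` are close in `L²`. -/
theorem IsProfile.integral_sq_translate_le (h : IsProfile η) {β : ℝ}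
    {Ω : Set (UnitAddTorus (Fin d))} {C : ℝ≥0∞} (hb : FourierDecayBound η 1 β Ω C) (hC : C ≠ ⊤)
    {R : ℝ} (hR : 0 < R) (v : EuclideanSpace ℝ (Fin d)) :
    ∫ x, (smoothing η R (psiDist η Ω R) (x + toTorus v) -
        smoothing η R (psiDist η Ω R) x) ^ 2 ∂(vol d) ≤
      (freqBall d R).card * (2 * Real.pi * ‖v‖ * C.toReal) ^ 2 := by
  set G := smoothing η R (psiDist η Ω R) with hG
  have hm := h.measurable_psiDist Ω R
  have hB := h.abs_psiDist_le Ω R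
  have hGc : Continuous fun x => (G x : ℂ) :=
    Complex.continuous_ofReal.comp (h.smoothing_continuous hm hB hR)
  have hGt : Continuous fun x => (G (x + toTorus v) : ℂ) := hGc.comp (continuous_add_const _)
  have hcoef : ∀ k, UnitAddTorus.mFourierCoeff
      (fun x => (G (x + toTorus v) : ℂ) - (G x : ℂ)) k =
      (UnitAddTorus.mFourier k (toTorus v) - 1) * ((kernelHat η (R⁻¹ • freqVec k) : ℂ) *
        UnitAddTorus.mFourierCoeff (fun x => (psiDist η Ω R x : ℂ)) k) := by
    intro k
    rw [sub_mul, one_mul, ← h.mFourierCoeff_smoothing hm hB R k, ← mFourierCoeff_comp_add,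
      mFourierCoeff_eq, mFourierCoeff_eq, mFourierCoeff_eq, ← integral_sub]
    · simp only [mul_sub]; rfl
    · exact (((UnitAddTorus.mFourier (-k)).continuous.mul hGt).integrable_of_hasCompactSupport
        (HasCompactSupport.of_compactSpace _))
    · exact (((UnitAddTorus.mFourier (-k)).continuous.mul hGc).integrable_of_hasCompactSupport
        (HasCompactSupport.of_compactSpace _))
  have hs := hasSum_sq_norm_mFourierCoeff
    (f := fun x => (G (x + toTorus v) : ℂ) - (G x : ℂ)) (hGt.sub hGc)
  simp only [hcoef] at hs
  have hs2 := hasSum_sum_of_ne_finset_zero (L := SummationFilter.unconditional _)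
    (s := freqBall d R) (f := fun k =>
    ‖(UnitAddTorus.mFourier k (toTorus v) - 1) * ((kernelHat η (R⁻¹ • freqVec k) : ℂ) *
        UnitAddTorus.mFourierCoeff (fun x => (psiDist η Ω R x : ℂ)) k)‖ ^ 2) (fun k hk => by
    rw [mem_freqBall, not_lt] at hk
    rw [h.kernelHat_smul_freqVec hR hk]; simp)
  have heq := hs.unique hs2
  have hn : ∀ x, ‖(G (x + toTorus v) : ℂ) - (G x : ℂ)‖ ^ 2 = (G (x + toTorus v) - G x) ^ 2 := by
    intro x
    rw [← Complex.ofReal_sub, Complex.norm_real, Real.norm_eq_abs, sq_abs]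
  simp only [hn] at heq
  rw [heq, ← nsmul_eq_mul]
  refine Finset.sum_le_card_nsmul _ _ _ fun k hk => ?_
  rw [mem_freqBall] at hk
  refine pow_le_pow_left₀ (norm_nonneg _) ?_ 2
  rw [norm_mul, norm_mul, Complex.norm_real, Real.norm_eq_abs]
  rcases eq_or_ne k 0 with rfl | hk0
  · rw [UnitAddTorus.mFourier_zero, ContinuousMap.one_apply, sub_self, norm_zero, zero_mul]
    have := Real.pi_pos
    positivity
  -- The factor |k| from translating the character cancels the decay C/|k|, so all frequencies below
  -- R obey the same bound.
  · have h1 := norm_mFourier_toTorus_sub_one_le k v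
    have h2 := hb.norm_psiDist_le hC hR hk0 hk
    have h3 := h.abs_kernelHat_le (R⁻¹ • freqVec k)
    have hpos : 0 < freqNorm k :=
      lt_of_lt_of_le (by exact_mod_cast one_le_freqSup hk0) (freqSup_le_freqNorm k)
    rw [Real.rpow_neg_one] at h2
    calc _ ≤ (2 * Real.pi * (‖v‖ * freqNorm k)) * (1 * (C.toReal * (freqNorm k)⁻¹)) :=
          mul_le_mul h1 (mul_le_mul h3 h2 (norm_nonneg _) zero_le_one) (by positivity)
            ((norm_nonneg _).trans h1)
      _ = _ := by field_simp

end Parseval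

/-! ### Finiteness of the boundary for d = α = 1 -/

section CriticalCase

variable {η : EuclideanSpace ℝ (Fin 1) → ℝ}

theorem card_freqBall_one_le {R : ℝ} (hR : 1 ≤ R) : ((freqBall 1 R).card : ℝ) ≤ 5 * R := by
  have h1 := Finset.card_filter_le (Fintype.piFinset fun _ : Fin 1 => Finset.Icc (-⌈R⌉) ⌈R⌉)
    (fun k => freqNorm k < R)
  have h2 : (Fintype.piFinset fun _ : Fin 1 => Finset.Icc (-⌈R⌉) ⌈R⌉).card =
      (⌈R⌉ + 1 - -⌈R⌉).toNat := by simp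
  rw [h2] at h1
  have h3 : (0 : ℤ) ≤ ⌈R⌉ := Int.ceil_nonneg (by linarith)
  have h4 : (((⌈R⌉ + 1 - -⌈R⌉).toNat : ℤ) : ℝ) = 2 * (⌈R⌉ : ℝ) + 1 := by
    rw [Int.toNat_of_nonneg (by omega)]; push_cast; ring
  have h5 : ((freqBall 1 R).card : ℝ) ≤ (((⌈R⌉ + 1 - -⌈R⌉).toNat : ℤ) : ℝ) := by
    exact_mod_cast h1
  have h6 := Int.ceil_lt_add_one R
  linarith

theorem exists_common_gap {B : Set (UnitAddTorus (Fin 1))} (F : Finset (UnitAddTorus (Fin 1)))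
    (hF : ∀ b ∈ F, ∃ ρ > 0, IsGapPoint B ρ b) :
    ∃ ρ > 0, ∀ b ∈ F, IsGapPoint B ρ b := by
  classical
  induction F using Finset.induction_on with
  | empty => exact ⟨1, one_pos, by simp⟩
  | insert a F _ ih =>
    obtain ⟨ρ, hρ, h1⟩ := ih fun b hb => hF b (Finset.mem_insert_of_mem hb)
    obtain ⟨ρ', hρ', h2⟩ := hF a (Finset.mem_insert_self a F)
    refine ⟨min ρ ρ', lt_min hρ hρ', fun b hb => ?_⟩
    rcases Finset.mem_insert.1 hb with rfl | hb
    · exact h2.mono (min_le_right _ _)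
    · exact (h1 b hb).mono (min_le_left _ _)

theorem distBdry_add_linePoint_le {Ω : Set (UnitAddTorus (Fin 1))} {b : UnitAddTorus (Fin 1)}
    (hb : b ∈ frontier Ω) (s : ℝ) : distBdry Ω (b + linePoint s) ≤ ENNReal.ofReal |s| := by
  rw [← norm_toLp_const]
  refine distBdry_le_of_mem Ω ?_
  change b + linePoint s - linePoint s ∈ _
  rwa [add_sub_cancel_right]

theorem exists_linePoint_distBdry_eq {Ω : Set (UnitAddTorus (Fin 1))}
    (hΩ : (frontier Ω).Nonempty) (x : UnitAddTorus (Fin 1)) :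
    ∃ s : ℝ, x - linePoint s ∈ frontier Ω ∧ distBdry Ω x = ENNReal.ofReal |s| := by
  obtain ⟨v, hv, hx⟩ := exists_mem_frontier_distBdry_eq hΩ x
  exact ⟨v 0, by rwa [← toTorus_eq_linePoint], by rw [hx, norm_eq_abs_apply_zero]⟩

theorem IsGapPoint.le_distBdry {Ω : Set (UnitAddTorus (Fin 1))} {ρ r s : ℝ}
    {b : UnitAddTorus (Fin 1)} (hb : IsGapPoint (frontier Ω) ρ b) (h0 : r ≤ s) (h1 : s + r ≤ ρ) :
    ENNReal.ofReal r ≤ distBdry Ω (b + linePoint s) := by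
  obtain ⟨u, hu, hdist⟩ := exists_linePoint_distBdry_eq ⟨b, hb.1⟩ (b + linePoint s)
  rw [hdist]
  refine ENNReal.ofReal_le_ofReal (not_lt.1 fun hlt => ?_)
  rw [abs_lt] at hlt
  refine hb.2 (s - u) ⟨by linarith, by linarith⟩ ?_
  rwa [linePoint_sub, ← add_sub_assoc]

/-- Under Fourier decay of order one, the number of gap points of the boundary is bounded. -/
theorem IsProfile.exists_card_gapPoints_le (h : IsProfile η) {β : ℝ}
    {Ω : Set (UnitAddTorus (Fin 1))} {C : ℝ≥0∞} (hb : FourierDecayBound η 1 β Ω C) (hC : C ≠ ⊤) :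
    ∃ N : ℝ, ∀ F : Finset (UnitAddTorus (Fin 1)),
      (∀ b ∈ F, ∃ ρ > 0, IsGapPoint (frontier Ω) ρ b) → (F.card : ℝ) ≤ N := by
  set τ := tail η 1 with hτ
  have hτ0 : 0 < τ := h.tail_pos one_pos 1
  have hF0 := h.psiFactor_pos
  -- The smoothed function is at least τ within 1/R of the boundary; this t makes it at most τ/2 at
  -- distance A/R or more.
  obtain ⟨t, ht0, ht⟩ := h.exists_tail_le (ε := τ / (4 * psiFactor η)) (by positivity)
  set A := 4 * t with hA
  have hA0 : 0 < A := by positivity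
  have hAt : 2 * psiFactor η * tail η (A / 4) ≤ τ / 2 := by
    rw [show A / 4 = t by rw [hA]; ring]
    calc 2 * psiFactor η * tail η t ≤ 2 * psiFactor η * (τ / (4 * psiFactor η)) :=
          mul_le_mul_of_nonneg_left ht (by positivity)
      _ = τ / 2 := by field_simp; ring
  refine ⟨5 * (2 * Real.pi * (A + 1) * C.toReal) ^ 2 / (τ / 2) ^ 2, fun F hF => ?_⟩
  obtain ⟨ρ, hρ0, hρ⟩ := exists_common_gap F hF
  -- The gap must hold an arc of length 1/R, the shift (A+1)/R and a further margin A/R, in all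
  -- (2A+2)/R.
  set R := (2 * A + 2) / ρ + 2 with hR
  have hR2 : 2 ≤ R := by
    have : 0 ≤ (2 * A + 2) / ρ := by positivity
    linarith
  have hR0 : 0 < R := by linarith
  have hRρ : (2 * A + 2) / R ≤ ρ := by
    rw [div_le_iff₀ hR0, hR, mul_add, mul_div_cancel₀ _ hρ0.ne']
    linarith
  have hR1 : 1 / R ≤ 1 / 2 := one_div_le_one_div_of_le two_pos hR2
  have hRinv : 0 < 1 / R := by positivity
  have hsplit : (2 * A + 2) / R = A / R + (A + 1) / R + 1 / R := by ring
  have hsplit2 : (A + 1) / R = A / R + 1 / R := by ring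
  have hAR : 0 < A / R := by positivity
  set v : EuclideanSpace ℝ (Fin 1) := WithLp.toLp 2 fun _ => (A + 1) / R with hv
  have hvn : ‖v‖ = (A + 1) / R := by rw [hv, norm_toLp_const, abs_of_pos (by positivity)]
  set G := smoothing η R (psiDist η Ω R) with hG
  have hGc : Continuous G :=
    h.smoothing_continuous (h.measurable_psiDist Ω R) (h.abs_psiDist_le Ω R) hR0
  have hDc : Continuous fun x => (G (x + toTorus v) - G x) ^ 2 :=
    ((hGc.comp (continuous_add_const _)).sub hGc).pow 2
  have hlow := card_mul_le_integral (B := frontier Ω) hRinv.le hR1 (F := F)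
    (fun b hbF => (hρ b hbF).mono (by linarith)) (f := fun x => (G (x + toTorus v) - G x) ^ 2)
    (hDc.integrable_of_hasCompactSupport (HasCompactSupport.of_compactSpace _))
    (fun x => sq_nonneg _) (a := (τ / 2) ^ 2) (sq_nonneg _) (by
      intro b hbF s hs
      have e1 : τ ≤ G (b + linePoint s) := by
        have hle := distBdry_add_linePoint_le (hρ b hbF).1 s
        have hne : distBdry Ω (b + linePoint s) ≠ ⊤ := ne_top_of_le_ne_top ENNReal.ofReal_ne_top hle
        refine le_trans (h.tail_antitone ?_) (h.tail_le_smoothing hR0 hne)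
        have h1 := ENNReal.toReal_le_of_le_ofReal (abs_nonneg s) hle
        rw [abs_of_pos hs.1] at h1
        have h2 : R * (distBdry Ω (b + linePoint s)).toReal ≤ R * (1 / R) :=
          mul_le_mul_of_nonneg_left (h1.trans hs.2.le) hR0.le
        rwa [mul_one_div_cancel hR0.ne'] at h2
      have e2 : G (b + linePoint s + toTorus v) ≤ τ / 2 := by
        have h1 : b + linePoint s + toTorus v = b + linePoint (s + (A + 1) / R) := by
          rw [linePoint_add, ← add_assoc]; rfl
        rw [h1]
        refine (h.smoothing_psiDist_le hR0 hA0 ((hρ b hbF).le_distBdry ?_ ?_)).trans hAt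
        · linarith [hs.1]
        · linarith [hs.2]
      have e3 : τ / 2 ≤ G (b + linePoint s) - G (b + linePoint s + toTorus v) := by linarith
      rw [← neg_sub, neg_sq]
      exact pow_le_pow_left₀ (by positivity) e3 2)
  have hup := h.integral_sq_translate_le hb hC hR0 v
  have hcard := card_freqBall_one_le (by linarith : (1 : ℝ) ≤ R)
  rw [hvn] at hup
  have h1 := hlow.trans (hup.trans (mul_le_mul_of_nonneg_right hcard (sq_nonneg _)))
  rw [le_div_iff₀ (by positivity)]
  -- Both the Parseval bound and the contribution of one gap scale as 1/R, so the bound on their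
  -- number does not involve ρ.
  have h2 : 5 * R * (2 * Real.pi * ((A + 1) / R) * C.toReal) ^ 2 =
      5 * (2 * Real.pi * (A + 1) * C.toReal) ^ 2 * (1 / R) := by
    field_simp
  rw [h2, ← mul_assoc] at h1
  exact le_of_mul_le_mul_right h1 hRinv

theorem IsProfile.finite_frontier (h : IsProfile η) {β : ℝ} (hβ : 0 < β)
    {Ω : Set (UnitAddTorus (Fin 1))} {C : ℝ≥0∞} (hb : FourierDecayBound η 1 β Ω C) (hC : C ≠ ⊤) :
    (frontier Ω).Finite := by
  obtain ⟨N, hN⟩ := h.exists_card_gapPoints_le hb hC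
  have hfin : {b | ∃ ρ > 0, IsGapPoint (frontier Ω) ρ b}.Finite := by
    by_contra hinf
    obtain ⟨F, hF, hcard⟩ := Set.Infinite.exists_subset_card_eq hinf (⌊N⌋₊ + 1)
    have h1 := hN F fun b hbF => hF hbF
    rw [hcard] at h1
    push_cast at h1
    linarith [Nat.lt_floor_add_one N]
  exact hfin.subset fun b hbB => exists_gap_of_mem isClosed_frontier
    (h.vol_frontier_eq_zero one_pos hβ hb hC) hfin hbB

end CriticalCase

/-! ### Simultaneous approximation and integrals near a finite boundary -/

section CriticalBound

variable {η : EuclideanSpace ℝ (Fin 1) → ℝ}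

/-- Simultaneous Dirichlet approximation by compactness: the vectors of character values have a
convergent subsequence, and the difference of two late, well-separated indices is the required
multiple. -/
theorem exists_norm_mFourier_sub_one_le {d : ℕ} (F : Finset (UnitAddTorus (Fin d)))
    (q : Fin d → ℤ) (K : ℕ) {ε : ℝ} (hε : 0 < ε) :
    ∃ k : ℕ, K ≤ k ∧ ∀ b ∈ F, ‖UnitAddTorus.mFourier (k • q) b - 1‖ ≤ ε := by
  let u : ℕ → F → ℂ := fun k b => UnitAddTorus.mFourier (k • q) b.1
  have hu : ∀ k, u k ∈ Metric.closedBall (0 : F → ℂ) 1 := fun k => by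
    rw [mem_closedBall_zero_iff, pi_norm_le_iff_of_nonneg zero_le_one]
    exact fun b => (norm_mFourier_apply _ _).le
  obtain ⟨a, -, φ, hφ, hlim⟩ := tendsto_subseq_of_bounded Metric.isBounded_closedBall hu
  obtain ⟨N, hN⟩ := Metric.cauchySeq_iff'.1 hlim.cauchySeq ε hε
  have hle : φ N ≤ φ (N + K) := hφ.monotone (Nat.le_add_right N K)
  refine ⟨φ (N + K) - φ N, ?_, fun b hb => ?_⟩
  · have := hφ.add_le_nat K N
    rw [add_comm K N] at this
    omega
  · have h1 := (norm_le_pi_norm _ (⟨b, hb⟩ : F)).trans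
      ((dist_eq_norm _ _).symm.le.trans (hN (N + K) (Nat.le_add_right N K)).le)
    have h2 : φ (N + K) • q = φ N • q + (φ (N + K) - φ N) • q := by
      rw [← add_nsmul, Nat.add_sub_cancel' hle]
    refine le_trans (le_of_eq ?_) h1
    change _ = ‖UnitAddTorus.mFourier (φ (N + K) • q) b - UnitAddTorus.mFourier (φ N • q) b‖
    rw [h2, UnitAddTorus.mFourier_add, ← mul_sub_one, norm_mul, norm_mFourier_apply, one_mul]

theorem norm_linePoint_apply_le (s : ℝ) (i : Fin 1) : ‖linePoint s i‖ ≤ |s| := by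
  rw [linePoint_apply]
  exact QuotientAddGroup.norm_mk_le_norm

theorem norm_linePoint_apply {s : ℝ} (hs : s ∈ Ioc (-(1 / 2) : ℝ) (1 / 2)) (i : Fin 1) :
    ‖linePoint s i‖ = |s| := by
  rw [linePoint_apply, AddCircle.norm_coe_eq_abs_iff 1 one_ne_zero, abs_one, abs_le]
  exact ⟨hs.1.le, hs.2⟩

/-- A function bounded by a sum of radial functions centred at points of `F`. -/
theorem integral_le_card_mul {F : Finset (UnitAddTorus (Fin 1))} {f : UnitAddTorus (Fin 1) → ℝ}
    (hf : Integrable f (vol 1)) {g : ℝ → ℝ} (hg : Measurable g) (hg0 : ∀ s, 0 ≤ g s) {M : ℝ}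
    (hgM : ∀ s, g s ≤ M) (hgi : Integrable fun s : ℝ => g |s|)
    (hfg : ∀ x, f x ≤ ∑ b ∈ F, g ‖(x - b) 0‖) :
    ∫ x, f x ∂(vol 1) ≤ F.card * ∫ s : ℝ, g |s| := by
  have hm : Measurable fun x : UnitAddTorus (Fin 1) => ‖x 0‖ := by fun_prop
  have hi : ∀ b : UnitAddTorus (Fin 1), Integrable (fun x => g ‖(x - b) 0‖) (vol 1) := by
    intro b
    refine Integrable.of_bound (hg.comp (hm.comp (measurable_sub_const b))).aestronglyMeasurable M
      (Filter.Eventually.of_forall fun x => ?_)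
    rw [Real.norm_eq_abs, abs_of_nonneg (hg0 _)]
    exact hgM _
  calc ∫ x, f x ∂(vol 1) ≤ ∫ x, ∑ b ∈ F, g ‖(x - b) 0‖ ∂(vol 1) :=
        integral_mono hf (integrable_finsetSum _ fun b _ => hi b) hfg
    _ = ∑ b ∈ F, ∫ x, g ‖(x - b) 0‖ ∂(vol 1) := integral_finsetSum _ fun b _ => hi b
    _ ≤ ∑ b ∈ F, ∫ s : ℝ, g |s| := by
        refine Finset.sum_le_sum fun b _ => ?_
        rw [integral_sub_right_eq_self (fun x : UnitAddTorus (Fin 1) => g ‖x 0‖) b,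
          integral_vol_one]
        rw [setIntegral_congr_fun measurableSet_Ioc fun s hs => by
          rw [norm_linePoint_apply hs]]
        exact setIntegral_le_integral hgi (Filter.Eventually.of_forall fun s => hg0 _)
    _ = _ := by rw [Finset.sum_const, nsmul_eq_mul]

theorem vol_real_distBdry_lt_le {Ω : Set (UnitAddTorus (Fin 1))} {F : Finset (UnitAddTorus (Fin 1))}
    (hF : frontier Ω ⊆ F) {t : ℝ} (ht : 0 < t) :
    (vol 1).real {x | distBdry Ω x < ENNReal.ofReal t} ≤ F.card * (2 * t) := by
  have hDm : MeasurableSet {x | distBdry Ω x < ENNReal.ofReal t} :=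
    measurableSet_lt (continuous_distBdry Ω).measurable measurable_const
  have h1 : (fun s : ℝ => (Iio t).indicator (fun _ => (1 : ℝ)) |s|) =
      (Ioo (-t) t).indicator fun _ => 1 := by
    ext s
    by_cases hs : |s| < t
    · rw [indicator_of_mem (show |s| ∈ Iio t from hs),
        indicator_of_mem (show s ∈ Ioo (-t) t from abs_lt.1 hs)]
    · rw [indicator_of_notMem (show |s| ∉ Iio t from hs),
        indicator_of_notMem (show s ∉ Ioo (-t) t from fun h => hs (abs_lt.2 h))]
  have h2 : ∫ s : ℝ, (Iio t).indicator (fun _ => (1 : ℝ)) |s| = 2 * t := by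
    rw [h1, integral_indicator measurableSet_Ioo, setIntegral_const, Real.volume_real_Ioo_of_le
      (by linarith), smul_eq_mul]
    ring
  rw [← integral_indicator_const_one hDm, ← h2]
  refine integral_le_card_mul ((integrable_const _).indicator hDm) (M := 1)
    (measurable_const.indicator measurableSet_Iio)
    (fun s => indicator_nonneg (fun _ _ => zero_le_one) s)
    (fun s => indicator_le' (fun _ _ => le_rfl) (fun _ _ => zero_le_one) s) ?_ fun x => ?_
  · rw [h1]
    exact (integrable_indicator_iff measurableSet_Ioo).2 (integrableOn_const (by simp))
  · have hnn : ∀ b ∈ F, 0 ≤ (Iio t).indicator (fun _ => (1 : ℝ)) ‖(x - b) 0‖ :=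
      fun b _ => indicator_nonneg (fun _ _ => zero_le_one) _
    by_cases hx : distBdry Ω x < ENNReal.ofReal t
    · rw [indicator_of_mem (show x ∈ {x | distBdry Ω x < ENNReal.ofReal t} from hx)]
      have hne : (frontier Ω).Nonempty := by
        rw [nonempty_iff_ne_empty]
        intro he
        rw [distBdry_eq_top_iff.2 he] at hx
        exact not_top_lt hx
      obtain ⟨s, hs, hxs⟩ := exists_linePoint_distBdry_eq hne x
      rw [hxs, ENNReal.ofReal_lt_ofReal_iff ht] at hx
      refine le_trans (le_of_eq ?_) (Finset.single_le_sum hnn (hF hs))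
      rw [sub_sub_cancel, indicator_of_mem]
      exact (norm_linePoint_apply_le s 0).trans_lt hx
    · rw [indicator_of_notMem (show x ∉ {x | distBdry Ω x < ENNReal.ofReal t} from hx)]
      exact Finset.sum_nonneg hnn

theorem integral_div_sq_add_sq {S R D : ℝ} (hS : 0 < S) (hR : 0 < R) :
    (Integrable fun s : ℝ => D / (S ^ 2 + (R * |s|) ^ 2)) ∧
      ∫ s : ℝ, D / (S ^ 2 + (R * |s|) ^ 2) = D * Real.pi / (S * R) := by
  have h1 : (fun s : ℝ => D / (S ^ 2 + (R * |s|) ^ 2)) =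
      fun s => D / S ^ 2 * (1 + (R / S * s) ^ 2)⁻¹ := by
    ext s
    rw [mul_pow, sq_abs]
    field_simp
  have hRS : 0 < R / S := by positivity
  rw [h1]
  refine ⟨((integrable_comp_mul_left_iff (fun s : ℝ => (1 + s ^ 2)⁻¹) hRS.ne').2
    integrable_inv_one_add_sq).const_mul _, ?_⟩
  rw [integral_const_mul, Measure.integral_comp_mul_left (fun s : ℝ => (1 + s ^ 2)⁻¹),
    integral_univ_inv_one_add_sq, abs_of_pos (inv_pos.2 hRS), smul_eq_mul]
  field_simp

theorem IsProfile.exists_psi_le_div_sq {d : ℕ} {η : EuclideanSpace ℝ (Fin d) → ℝ}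
    (h : IsProfile η) : ∃ D : ℝ, 0 < D ∧ ∀ t, 0 < t → psi η t ≤ D / t ^ 2 := by
  have hF := h.psiFactor_pos
  have hD : 0 ≤ ∫ x, ‖x‖ ^ 2 * kernel η x :=
    integral_nonneg fun x => mul_nonneg (sq_nonneg _) (h.kernel_nonneg x)
  refine ⟨psiFactor η * 4 * ((∫ x, ‖x‖ ^ 2 * kernel η x) + 1), by positivity, fun t ht => ?_⟩
  rw [psi_eq]
  calc psiFactor η * tail η (t / 2)
      ≤ psiFactor η * (((∫ x, ‖x‖ ^ 2 * kernel η x) + 1) / (t / 2) ^ 2) := by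
        refine mul_le_mul_of_nonneg_left ((h.tail_le_div_sq (by positivity)).trans ?_) hF.le
        gcongr
        linarith
    _ = _ := by field_simp; ring

/-- The part of the integral of `psiDist` away from a finite boundary is small. -/
theorem IsProfile.integral_indicator_psiDist_le {Ω : Set (UnitAddTorus (Fin 1))}
    (h : IsProfile η) {F : Finset (UnitAddTorus (Fin 1))}
    (hF : frontier Ω ⊆ F) {D S R : ℝ} (hD0 : 0 < D) (hD : ∀ t, 0 < t → psi η t ≤ D / t ^ 2)
    (hS : 0 < S) (hR : 0 < R) :
    ∫ x, {x | ENNReal.ofReal (S / R) < distBdry Ω x}.indicator (psiDist η Ω R) x ∂(vol 1) ≤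
      F.card * (2 * D * Real.pi / (S * R)) := by
  have hm : MeasurableSet {x | ENNReal.ofReal (S / R) < distBdry Ω x} :=
    measurableSet_lt measurable_const (continuous_distBdry Ω).measurable
  obtain ⟨hi, he⟩ := integral_div_sq_add_sq (D := 2 * D) hS hR
  rw [← he]
  have hnn : ∀ s : ℝ, 0 ≤ 2 * D / (S ^ 2 + (R * s) ^ 2) := fun s => by positivity
  refine integral_le_card_mul (g := fun s => 2 * D / (S ^ 2 + (R * s) ^ 2)) (M := 2 * D / S ^ 2)
    ((h.integrable_psiDist Ω R).indicator hm) (by fun_prop) hnn (fun s => ?_) hi fun x => ?_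
  · have : 0 ≤ (R * s) ^ 2 := sq_nonneg _
    gcongr
    linarith
  · have hsum : ∀ b ∈ F, 0 ≤ 2 * D / (S ^ 2 + (R * ‖(x - b) 0‖) ^ 2) := fun b _ => hnn _
    by_cases hx : ENNReal.ofReal (S / R) < distBdry Ω x
    · rw [indicator_of_mem (show x ∈ {x | ENNReal.ofReal (S / R) < distBdry Ω x} from hx)]
      by_cases hne : (frontier Ω).Nonempty
      · obtain ⟨s, hs, hxs⟩ := exists_linePoint_distBdry_eq hne x
        refine le_trans ?_ (Finset.single_le_sum hsum (hF hs))
        rw [psiDist, if_neg (by rw [hxs]; exact ENNReal.ofReal_ne_top), hxs,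
          ENNReal.toReal_ofReal (abs_nonneg s), sub_sub_cancel]
        rw [hxs] at hx
        have hSs : S < R * |s| := by
          have := lt_of_not_ge fun hle => not_lt.2 (ENNReal.ofReal_le_ofReal hle) hx
          rw [div_lt_iff₀ hR] at this
          linarith
        have h0 : 0 < R * |s| := hS.trans hSs
        have h1 := norm_linePoint_apply_le s 0
        have h2 : (R * ‖linePoint s 0‖) ^ 2 ≤ (R * |s|) ^ 2 := by gcongr
        have h3 : S ^ 2 ≤ (R * |s|) ^ 2 := by gcongr
        -- Away from the boundary S ≤ R|s|; adding S² to the denominator costs a factor 2 and makes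
        -- the bound integrable on the whole line.
        calc psi η (R * |s|) ≤ D / (R * |s|) ^ 2 := hD _ h0
          _ = 2 * D / (2 * (R * |s|) ^ 2) := by field_simp
          _ ≤ 2 * D / (S ^ 2 + (R * ‖linePoint s 0‖) ^ 2) := by
              gcongr
              linarith
      · rw [psiDist, if_pos (distBdry_eq_top_iff.2 (not_nonempty_iff_eq_empty.1 hne))]
        exact Finset.sum_nonneg hsum
    · rw [indicator_of_notMem (show x ∉ {x | ENNReal.ofReal (S / R) < distBdry Ω x} from hx)]
      exact Finset.sum_nonneg hsum

/-- Near a point where the character is almost `1` it has real part at least `1/2`. -/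
theorem half_le_re_mFourier {k : Fin 1 → ℤ} {b : UnitAddTorus (Fin 1)}
    (hb : ‖UnitAddTorus.mFourier k b - 1‖ ≤ 1 / 4) {s : ℝ} (hs : 8 * (|s| * freqNorm k) ≤ 1 / 4) :
    1 / 2 ≤ (UnitAddTorus.mFourier k (b + linePoint s)).re := by
  have h1 := norm_mFourier_toTorus_sub_one_le k (WithLp.toLp 2 fun _ => s)
  rw [norm_toLp_const] at h1
  change ‖UnitAddTorus.mFourier k (linePoint s) - 1‖ ≤ _ at h1
  have h2 : 2 * Real.pi * (|s| * freqNorm k) ≤ 8 * (|s| * freqNorm k) := by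
    have := Real.pi_le_four
    exact mul_le_mul_of_nonneg_right (by linarith)
      (mul_nonneg (abs_nonneg _) (freqNorm_nonneg _))
  have h3 : ‖UnitAddTorus.mFourier k (b + linePoint s) - 1‖ ≤ 1 / 2 := by
    have h4 : UnitAddTorus.mFourier k (b + linePoint s) - 1 =
        UnitAddTorus.mFourier k b * (UnitAddTorus.mFourier k (linePoint s) - 1) +
          (UnitAddTorus.mFourier k b - 1) := by
      rw [mFourier_add_apply]; ring
    rw [h4]
    refine (norm_add_le _ _).trans ?_
    rw [norm_mul, norm_mFourier_apply, one_mul]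
    linarith
  have h5 := (Complex.abs_re_le_norm _).trans h3
  rw [Complex.sub_re, Complex.one_re, abs_le] at h5
  linarith [h5.1]

end CriticalBound

/-! ### Linear count of boundary points and the critical bound -/

section CriticalDiscrepancy

variable {η : EuclideanSpace ℝ (Fin 1) → ℝ}

/-- Under Fourier decay of order one, the boundary has boundedly many points, linearly in the
decay constant. -/
theorem IsProfile.card_frontier_le (h : IsProfile η) {D S : ℝ} (hD0 : 0 < D)
    (hD : ∀ t, 0 < t → psi η t ≤ D / t ^ 2) (hS1 : 1 ≤ S)
    (hS : 12 * D * Real.pi ≤ psi η 1 * S) {β : ℝ}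
    {Ω : Set (UnitAddTorus (Fin 1))} {C : ℝ≥0∞} (hb : FourierDecayBound η 1 β Ω C) (hC : C ≠ ⊤)
    {F : Finset (UnitAddTorus (Fin 1))} (hF : frontier Ω = F) {ρ : ℝ} (hρ0 : 0 < ρ)
    (hρ : ∀ b ∈ F, IsGapPoint (frontier Ω) ρ b) :
    F.card * psi η 1 ≤ 128 * S * C.toReal := by
  have hψ := h.psi_pos one_pos 1
  obtain ⟨k, hkK, hk⟩ := exists_norm_mFourier_sub_one_le F 1 (⌈1 / ρ⌉₊ + 1)
    (by norm_num : (0 : ℝ) < 1 / 4)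
  have hk1 : (1 : ℝ) ≤ k := by exact_mod_cast (Nat.le_add_left 1 _).trans hkK
  have hk0 : (0 : ℝ) < k := by linarith
  have hkρ : 1 / ρ ≤ k := (Nat.le_ceil _).trans (by exact_mod_cast (Nat.le_succ _).trans hkK)
  -- The near region is |s| ≤ S/R = 1/(32k), where 8|s|k ≤ 1/4 as `half_le_re_mFourier` asks. R is
  -- proportional to k, so the bound C/k compares with the 1/R contributed by each boundary point.
  set R : ℝ := 32 * S * k with hR
  have hS0 : 0 < S := by linarith
  have hR0 : 0 < R := by positivity
  have hkR : (k : ℝ) < R := by nlinarith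
  have hR2 : 2 ≤ R := by nlinarith
  have hRρ : 1 / R ≤ ρ := by
    rw [div_le_iff₀ hR0]
    rw [div_le_iff₀ hρ0] at hkρ
    nlinarith
  have hfreq : ∀ q : Fin 1 → ℤ, q = k • 1 ∨ q = -(k • 1) → freqNorm q = k := by
    rintro q (rfl | rfl) <;> simp [freqNorm, Real.sqrt_sq hk0.le]
  have hκ := hfreq _ (Or.inr rfl)
  have hκ0 : -(k • (1 : Fin 1 → ℤ)) ≠ 0 := by
    intro h0
    rw [h0, freqNorm_zero] at hκ
    linarith
  have hup := hb.norm_psiDist_le hC hR0 hκ0 (by rwa [hκ])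
  rw [hκ, Real.rpow_neg_one, mFourierCoeff_eq, neg_neg] at hup
  have hfar : MeasurableSet {x | ENNReal.ofReal (S / R) < distBdry Ω x} :=
    measurableSet_lt measurable_const (continuous_distBdry Ω).measurable
  have hint := h.integrable_psiDist Ω R
  have hprod : Integrable (fun x => UnitAddTorus.mFourier (k • 1) x * (psiDist η Ω R x : ℂ))
      (vol 1) :=
    (hint.ofReal (𝕜 := ℂ)).bdd_mul
      (UnitAddTorus.mFourier (k • 1)).continuous.aestronglyMeasurable
      (Filter.Eventually.of_forall fun x => (norm_mFourier_apply _ x).le)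
  have hre := (Complex.re_le_norm _).trans hup
  rw [← RCLike.re_eq_complex_re, ← integral_re hprod] at hre
  -- The real part of the character is at least 1/2 near the boundary and at least -1 = 1/2 - 3/2
  -- elsewhere.
  have hlow : ∫ x, (1 / 2 * psiDist η Ω R x - 3 / 2 *
      {x | ENNReal.ofReal (S / R) < distBdry Ω x}.indicator (psiDist η Ω R) x) ∂(vol 1) ≤
      ∫ x, RCLike.re (UnitAddTorus.mFourier (k • 1) x * (psiDist η Ω R x : ℂ)) ∂(vol 1) := by
    refine integral_mono ((hint.const_mul _).sub ((hint.indicator hfar).const_mul _)) hprod.re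
      fun x => ?_
    have h0 := h.psiDist_nonneg Ω R x
    simp only [RCLike.re_eq_complex_re, Complex.re_mul_ofReal]
    by_cases hx : ENNReal.ofReal (S / R) < distBdry Ω x
    · rw [indicator_of_mem (show x ∈ {x | ENNReal.ofReal (S / R) < distBdry Ω x} from hx)]
      have h1 := (Complex.abs_re_le_norm _).trans
        (norm_mFourier_apply (k • (1 : Fin 1 → ℤ)) x).le
      have h2 := mul_le_mul_of_nonneg_right (abs_le.1 h1).1 h0
      linarith
    · rw [indicator_of_notMem (show x ∉ {x | ENNReal.ofReal (S / R) < distBdry Ω x} from hx),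
        mul_zero, sub_zero]
      refine mul_le_mul_of_nonneg_right ?_ h0
      have hne : (frontier Ω).Nonempty := by
        rw [nonempty_iff_ne_empty]
        intro he
        rw [distBdry_eq_top_iff.2 he] at hx
        exact hx ENNReal.ofReal_lt_top
      obtain ⟨s, hs, hxs⟩ := exists_linePoint_distBdry_eq hne x
      rw [hxs, not_lt, ENNReal.ofReal_le_ofReal_iff (by positivity), le_div_iff₀ hR0] at hx
      rw [hF] at hs
      rw [← sub_add_cancel x (linePoint s)]
      refine half_le_re_mFourier (hk _ hs) ?_
      rw [hfreq _ (Or.inl rfl)]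
      have : S * (32 * (|s| * k)) ≤ S * 1 := by rw [hR] at hx; linarith
      linarith [le_of_mul_le_mul_left this hS0]
  rw [integral_sub (hint.const_mul _) ((hint.indicator hfar).const_mul _), integral_const_mul,
    integral_const_mul] at hlow
  have hcard := card_mul_le_integral (B := frontier Ω) (ρ := 1 / R) (by positivity)
    (one_div_le_one_div_of_le two_pos hR2) (F := F) (fun b hbF => (hρ b hbF).mono hRρ)
    hint (h.psiDist_nonneg Ω R) hψ.le (by
      intro b hbF s hs
      have h1 := h.psi_le_psiDist hR0 (abs_nonneg s) (distBdry_add_linePoint_le (hρ b hbF).1 s)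
      refine le_trans (h.psi_antitone ?_) h1
      rw [abs_of_pos hs.1]
      have := mul_le_mul_of_nonneg_left hs.2.le hR0.le
      rwa [mul_one_div_cancel hR0.ne'] at this)
  have htail := h.integral_indicator_psiDist_le hF.subset hD0 hD hS0 hR0
  have hfin := hlow.trans hre
  -- The size of S keeps the far part to a sixth of the main term; since 1/2 - (3/2)(1/6) = 1/4, a
  -- quarter survives.
  have hq : 2 * D * Real.pi / (S * R) ≤ psi η 1 / 6 * (1 / R) := by
    rw [div_le_iff₀ (by positivity)]
    field_simp
    linarith
  have htail2 := htail.trans (mul_le_mul_of_nonneg_left hq (Nat.cast_nonneg _))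
  have h1 : F.card * (psi η 1 * (1 / R)) / 4 ≤ C.toReal * (k : ℝ)⁻¹ := by linarith
  have h2 := mul_le_mul_of_nonneg_right h1 hR0.le
  have e1 : F.card * (psi η 1 * (1 / R)) / 4 * R = F.card * psi η 1 / 4 := by
    field_simp
  have e2 : C.toReal * (k : ℝ)⁻¹ * R = 32 * S * C.toReal := by
    rw [hR]; field_simp
  linarith

/-- The discrepancy bound on the circle for Fourier decay of order one. -/
theorem IsProfile.exists_latticeDiscrepancy_le_of_critical (h : IsProfile η) :
    ∃ A : ℝ, 0 < A ∧ ∀ {β : ℝ}, 0 < β → ∀ {Ω : Set (UnitAddTorus (Fin 1))},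
      NullMeasurableSet Ω (vol 1) → ∀ {C : ℝ≥0∞}, FourierDecayBound η 1 β Ω C → C ≠ ⊤ →
        ∀ {n : ℕ}, 0 < n → latticeDiscrepancy 1 n Ω ≤ A * C.toReal * (n : ℝ)⁻¹ := by
  obtain ⟨D, hD0, hD⟩ := h.exists_psi_le_div_sq
  have hψ := h.psi_pos one_pos 1
  have hπ := Real.pi_pos
  set S := 12 * D * Real.pi / psi η 1 + 1 with hS
  have hS1 : 1 ≤ S := by
    have : 0 ≤ 12 * D * Real.pi / psi η 1 := by positivity
    linarith
  have hSψ : 12 * D * Real.pi ≤ psi η 1 * S := by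
    rw [hS, mul_add, mul_div_cancel₀ _ hψ.ne']
    linarith
  refine ⟨4 * (128 * S) / psi η 1, by positivity, ?_⟩
  intro β hβ Ω hΩ C hb hC n hn
  have hn0 : (0 : ℝ) < n := by exact_mod_cast hn
  have hfin := h.finite_frontier hβ hb hC
  obtain ⟨ρ, hρ0, hρ⟩ := exists_common_gap hfin.toFinset fun b hbF =>
    exists_gap_of_mem isClosed_frontier (h.vol_frontier_eq_zero one_pos hβ hb hC)
      (hfin.subset fun b hb' => hb'.choose_spec.2.1) (hfin.mem_toFinset.1 hbF)
  have hcard := h.card_frontier_le hD0 hD hS1 hSψ hb hC hfin.coe_toFinset.symm hρ0 hρ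
  have h1 := latticeDiscrepancy_le_vol hn hΩ (t := 2 / n) (by
    rw [Nat.cast_one, Real.sqrt_one]
    exact div_lt_div_of_pos_right (by norm_num) hn0)
  have h2 := vol_real_distBdry_lt_le hfin.coe_toFinset.symm.subset (t := 2 / (n : ℝ))
    (by positivity)
  refine (h1.trans h2).trans ?_
  rw [← le_div_iff₀ hψ] at hcard
  calc (hfin.toFinset.card : ℝ) * (2 * (2 / n)) ≤ 128 * S * C.toReal / psi η 1 * (2 * (2 / n)) :=
        mul_le_mul_of_nonneg_right hcard (by positivity)
    _ = _ := by field_simp; ring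

end CriticalDiscrepancy

end TorusDiscrepancy

/-! ### Choice of constants and conclusion -/

theorem mainTheorem5 (d : ℕ) (hd : 0 < d) :
    (∀ η : EuclideanSpace ℝ (Fin d) → ℝ, TorusDiscrepancy.IsProfile η →
      ∃ c : ℝ → ℝ≥0, (2 ≤ d → ∀ α α' : ℝ, c α = c α') ∧
        ∀ α β : ℝ, 0 ≤ α → α ≤ ((d : ℝ) + 1) / 2 → 0 ≤ β → β ≤ 1 → α < d + β →
          ∀ m n : ℕ, 0 < n → m = n ^ d →
            ∀ Ω : Set (UnitAddTorus (Fin d)), NullMeasurableSet Ω (TorusDiscrepancy.vol d) →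
              ENNReal.ofReal (TorusDiscrepancy.latticeDiscrepancy d n Ω) ≤
                (c α : ℝ≥0∞) * TorusDiscrepancy.decayConst η α β Ω *
                  ENNReal.ofReal ((m : ℝ) ^ (-(β / (d + β - α))))) ∧
    (∃ c : ℝ, ∀ α : ℝ, 0 ≤ α → α ≤ 1 →
      ∀ m n : ℕ, 0 < n → m = n ^ d →
        ∀ γ : ℝ, ∀ Ω : Set (UnitAddTorus (Fin d)),
          NullMeasurableSet Ω (TorusDiscrepancy.vol d) →
            TorusDiscrepancy.minkowskiConst α Ω < ENNReal.ofReal γ →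
              TorusDiscrepancy.latticeDiscrepancy d n Ω ≤ c * γ * (m : ℝ) ^ (-(α / d))) := by
  refine ⟨fun η h => ?_, Real.sqrt d + 1, fun α _ hα1 m n hn hm γ Ω hΩ hM => ?_⟩
  · have hψ := h.psi_pos hd (Real.sqrt d)
    have hpos : ∀ σ : ℝ, σ < 1 →
        0 < 1 + 2 * (2 * d * 3 ^ (d - 1) / (1 - σ)) + (TorusDiscrepancy.psi η (Real.sqrt d))⁻¹ := by
      intro σ hσ
      have : 0 < 1 - σ := by linarith
      positivity
    have hX : ∀ {n : ℕ} (e : ℝ), 0 < n → 0 < ((n ^ d : ℕ) : ℝ) ^ e := fun e hn =>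
      Real.rpow_pos_of_pos (by positivity) _
    rcases Nat.lt_or_ge d 2 with hd2 | hd2
    · obtain rfl : d = 1 := by omega
      obtain ⟨A, hA0, hA⟩ := h.exists_latticeDiscrepancy_le_of_critical
      -- On the circle d - 1 - α + σ ≥ 0 requires σ ≥ α, so σ = α is taken; the resulting constant
      -- blows up as α → 1, and α = 1 gets its own.
      refine ⟨fun α => if α < 1 then (1 + 2 * (2 * (1 : ℕ) * 3 ^ (1 - 1) / (1 - α)) +
        (TorusDiscrepancy.psi η (Real.sqrt (1 : ℕ)))⁻¹).toNNReal else A.toNNReal,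
        fun h2 => absurd h2 (by norm_num), ?_⟩
      rintro α β hα0 hα hβ0 - hαβ m n hn rfl Ω hΩ
      by_cases hα1 : α < 1
      · simp only [if_pos hα1]
        refine TorusDiscrepancy.ofReal_le_mul_decayConst (Real.toNNReal_pos.2 (hpos α hα1))
          (hX _ hn) fun C hb hC => ?_
        rw [Real.coe_toNNReal _ (hpos α hα1).le]
        exact h.latticeDiscrepancy_le hd hα0 hβ0 hαβ hα0 hα1 (by norm_num) hb hC hn
      · simp only [if_neg hα1]
        refine TorusDiscrepancy.ofReal_le_mul_decayConst (Real.toNNReal_pos.2 hA0)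
          (hX _ hn) fun C hb hC => ?_
        rw [Nat.cast_one] at hα hαβ
        obtain rfl : α = 1 := by linarith
        -- At d = α = 1 the condition d + β - α > 0 means β > 0, and the exponent of m is then -1
        -- for every β.
        have hβ : 0 < β := by linarith
        rw [Real.coe_toNNReal _ hA0.le, Nat.cast_one, add_sub_cancel_left, div_self hβ.ne',
          Real.rpow_neg_one, pow_one]
        exact hA hβ hΩ hb hC hn
    · have hσ : (1 / 2 : ℝ) < 1 := by norm_num
      -- For d ≥ 2 and α ≤ (d+1)/2, σ = 1/2 always works: d - 1 - α + 1/2 ≥ d/2 - 1 ≥ 0.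
      refine ⟨fun _ => (1 + 2 * (2 * d * 3 ^ (d - 1) / (1 - 1 / 2)) +
        (TorusDiscrepancy.psi η (Real.sqrt d))⁻¹).toNNReal, fun _ _ _ => rfl, ?_⟩
      rintro α β hα0 hα hβ0 - hαβ m n hn rfl Ω hΩ
      refine TorusDiscrepancy.ofReal_le_mul_decayConst (Real.toNNReal_pos.2 (hpos _ hσ))
        (hX _ hn) fun C hb hC => ?_
      rw [Real.coe_toNNReal _ (hpos _ hσ).le]
      have hd2' : (2 : ℝ) ≤ d := by exact_mod_cast hd2
      exact h.latticeDiscrepancy_le hd hα0 hβ0 hαβ (by norm_num) hσ (by linarith) hb hC hn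
  · subst hm
    exact TorusDiscrepancy.latticeDiscrepancy_le_minkowski hd hα1 hn hΩ hM
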